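/- **Theorem (1D mixed flat-foldability).** A *1D crease pattern* with $n \ge 0$ creases is a line segment (the paper) with ends $v_0 < v_{n+1}$ and creases $v_1 < \dots < v_n$ strictly between them, at real positions. In a *1D mixed crease pattern* each crease is labelled mountain, valley or unassigned. The segments of the pattern are $[v_j, v_{j+1}]$, $0 \le j \le n$. In the folded state all creases are folded: the first segment stays in place, and the successive segments go alternately right and left, so that vertex $v_k$ lands at $f(v_k) = v_0 + \sum_{j<k} (-1)^j (v_{j+1} - v_j)$. Given a mountain/valley choice for every crease, the pattern is *flat-foldable* if the segments can be stacked in a linear order such that: (i) at each valley (respectively mountain) crease, the top (respectively bottom) sides of the two adjacent segments face each other; (ii) no segment whose folded image contains the folded position of a crease in its interior lies, in the stacking, between the two segments meeting at that crease; (iii) for two creases with the same folded position whose segments lie on the same side of it, the two pairs of adjacent segments do not interleave in the stacking. An assignment of a mixed crease pattern chooses mountain or valley for each unassigned crease; it is *valid* if the resulting assigned crease pattern is flat-foldable. Then there are a single program for a random access machine with natural-number and real-number registers, whose only arithmetic operations are addition, subtraction and comparison, each taking one step, and a constant $C$, such that for every $n \ge 0$ and every 1D mixed crease pattern with $n$ creases,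 given by $n$, its vertex positions from left to right and its crease labels, the program halts after at most $C (n+1)^3$ steps, and outputs a valid assignment if one exists, and reports that there is none otherwise. In particular, one can in polynomial time, namely $O(n^3)$, determine whether a 1D mixed crease pattern has a valid assignment, and find one if it exists. -/

import Mathlib

/-! ### One-dimensional crease patterns and their flat foldings -/

/-- A one-dimensional crease pattern with `n` creases: its vertices, listed from left to right.
Vertices `0` and `n + 1` are the two ends of the paper; the others are the creases. Crease number
`i : Fin n` is the vertex `i + 1`, and segment number `j : Fin (n + 1)` joins the consecutive
vertices `j` and `j + 1`. -/
structure CreasePattern (n : ℕ) where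
  vertex : Fin (n + 2) → ℝ
  strictMono : StrictMono vertex

/-- The two possible orientations of an assigned crease. -/
inductive CreaseOrientation where
  | mountain
  | valley

namespace CreasePattern

variable {n : ℕ}

/-- The horizontal position of the `k`-th vertex in the folded state: the first segment stays in
place, and the successive segments go alternately to the right and to the left. -/
noncomputable def foldedVertex (P : CreasePattern n) (k : Fin (n + 2)) : ℝ :=
  P.vertex 0 + ∑ j : Fin (n + 1),
    if j.val < k.val then (-1) ^ j.val * (P.vertex j.succ - P.vertex j.castSucc) else 0

/-- The position of crease `i` in the folded state. -/
noncomputable def foldedCrease (P : CreasePattern n) (i : Fin n) : ℝ :=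
  P.foldedVertex i.castSucc.succ

/-- The image of the relative interior of segment `j` in the folded state. -/
noncomputable def segmentImage (P : CreasePattern n) (j : Fin (n + 1)) : Set ℝ :=
  Set.Ioo (min (P.foldedVertex j.castSucc) (P.foldedVertex j.succ))
    (max (P.foldedVertex j.castSucc) (P.foldedVertex j.succ))

/-- Segment `j` is stacked strictly between the two segments that meet at crease `i`, when the
segments are stacked by the heights `h`. -/
def LayerBetween (h : Fin (n + 1) → ℝ) (i : Fin n) (j : Fin (n + 1)) : Prop :=
  (h i.castSucc < h j ∧ h j < h i.succ) ∨ (h i.succ < h j ∧ h j < h i.castSucc)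

/-- The stacking order given by the heights `h` is a flat folded state of the crease pattern `P`
with mountain-valley assignment `A`.

* The segments `0, 2, 4, …` keep their top side up in the folded state and the others are turned
  over. A valley crease brings the top sides of its two segments together, a mountain crease
  brings the bottom sides together. Hence, at a valley crease preceded by a segment which is not
  turned over, the following segment lies above the preceding one; turning the preceding segment
  over, or replacing valley by mountain, reverses this.
* The paper does not cross itself: a segment that passes across the position of a crease is not
  stacked between the two segments of this crease, and the segment pairs of two creases at the
  same position, facing the same side, are nested or disjoint in the stacking, not interleaved.
  (Creases `i` and `i'` have their segments on the same side iff `i` and `i'` have equal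
  parity.) -/
structure IsFlatFoldedState (P : CreasePattern n) (A : Fin n → CreaseOrientation)
    (h : Fin (n + 1) → ℝ) : Prop where
  injective : Function.Injective h
  valley : ∀ i : Fin n, A i = CreaseOrientation.valley → (h i.castSucc < h i.succ ↔ Even i.val)
  mountain : ∀ i : Fin n, A i = CreaseOrientation.mountain → (h i.castSucc < h i.succ ↔ Odd i.val)
  crease_segment : ∀ (i : Fin n) (j : Fin (n + 1)),
    P.foldedCrease i ∈ P.segmentImage j → ¬ LayerBetween h i j
  crease_crease : ∀ i i' : Fin n, i ≠ i' → P.foldedCrease i = P.foldedCrease i' →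
    (Even i.val ↔ Even i'.val) → (LayerBetween h i i'.castSucc ↔ LayerBetween h i i'.succ)

/-- The crease pattern `P` with mountain-valley assignment `A` is flat-foldable: it has a flat
folded state (in which every crease is folded according to `A`). -/
def FlatFoldable (P : CreasePattern n) (A : Fin n → CreaseOrientation) : Prop :=
  ∃ h : Fin (n + 1) → ℝ, P.IsFlatFoldedState A h

end CreasePattern

/-- A one-dimensional mixed crease pattern: each crease is mountain, valley or unassigned
(`none`). -/
structure MixedCreasePattern (n : ℕ) extends CreasePattern n where
  label : Fin n → Option CreaseOrientation

/-- A valid assignment of a mixed crease pattern: an orientation for every crease which agrees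
with the given labels and makes the pattern flat-foldable. -/
def MixedCreasePattern.IsValid {n : ℕ} (P : MixedCreasePattern n) (A : Fin n → CreaseOrientation) :
    Prop :=
  (∀ i o, P.label i = some o → A i = o) ∧ P.toCreasePattern.FlatFoldable A

/-! ### Programs on a random access machine with real-number registers

Memory consists of natural-number arrays and real-number arrays with names `0, 1, 2, …`.
The only operations on numbers are addition, subtraction (truncated on natural numbers) and
comparison. Evaluating an expression costs one step for each of its nodes, and each write to
memory and each branching costs one further step. -/

namespace RealRAM

/-- The memory: `nat a i` and `real a i` are the `i`-th cells of the arrays with name `a`. -/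
structure State where
  nat : ℕ → ℕ → ℕ
  real : ℕ → ℕ → ℝ

/-- Expressions for natural numbers; `get a i` reads cell `i` of array `a`. -/
inductive NatExpr where
  | const (c : ℕ)
  | get (a : ℕ) (i : NatExpr)
  | plus (e₁ e₂ : NatExpr)
  | minus (e₁ e₂ : NatExpr)

/-- Expressions for real numbers; `get a i` reads cell `i` of array `a`. -/
inductive RealExpr where
  | zero
  | get (a : ℕ) (i : NatExpr)
  | plus (e₁ e₂ : RealExpr)
  | minus (e₁ e₂ : RealExpr)

/-- Tests. -/
inductive Test where
  | natLt (e₁ e₂ : NatExpr)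
  | realLt (e₁ e₂ : RealExpr)
  | neg (b : Test)
  | conj (b₁ b₂ : Test)

/-- Programs; `setNat a i e` writes the value of `e` to cell `i` of array `a`. -/
inductive Program where
  | skip
  | setNat (a : ℕ) (i e : NatExpr)
  | setReal (a : ℕ) (i : NatExpr) (e : RealExpr)
  | seq (p q : Program)
  | ite (b : Test) (p q : Program)
  | loop (b : Test) (p : Program)

def NatExpr.eval (s : State) : NatExpr → ℕ
  | const c => c
  | get a i => s.nat a (i.eval s)
  | plus e₁ e₂ => e₁.eval s + e₂.eval s
  | minus e₁ e₂ => e₁.eval s - e₂.eval s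

def NatExpr.cost : NatExpr → ℕ
  | const _ => 1
  | get _ i => i.cost + 1
  | plus e₁ e₂ => e₁.cost + e₂.cost + 1
  | minus e₁ e₂ => e₁.cost + e₂.cost + 1

noncomputable def RealExpr.eval (s : State) : RealExpr → ℝ
  | zero => 0
  | get a i => s.real a (i.eval s)
  | plus e₁ e₂ => e₁.eval s + e₂.eval s
  | minus e₁ e₂ => e₁.eval s - e₂.eval s

def RealExpr.cost : RealExpr → ℕ
  | zero => 1
  | get _ i => i.cost + 1
  | plus e₁ e₂ => e₁.cost + e₂.cost + 1
  | minus e₁ e₂ => e₁.cost + e₂.cost + 1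

def Test.Holds (s : State) : Test → Prop
  | natLt e₁ e₂ => e₁.eval s < e₂.eval s
  | realLt e₁ e₂ => e₁.eval s < e₂.eval s
  | neg b => ¬ b.Holds s
  | conj b₁ b₂ => b₁.Holds s ∧ b₂.Holds s

def Test.cost : Test → ℕ
  | natLt e₁ e₂ => e₁.cost + e₂.cost + 1
  | realLt e₁ e₂ => e₁.cost + e₂.cost + 1
  | neg b => b.cost + 1
  | conj b₁ b₂ => b₁.cost + b₂.cost + 1

/-- Write the natural number `v` to cell `i` of array `a`. -/
def State.writeNat (s : State) (a i v : ℕ) : State :=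
  { s with nat := Function.update s.nat a (Function.update (s.nat a) i v) }

/-- Write the real number `v` to cell `i` of array `a`. -/
noncomputable def State.writeReal (s : State) (a i : ℕ) (v : ℝ) : State :=
  { s with real := Function.update s.real a (Function.update (s.real a) i v) }

/-- `Runs p s t s'`: started in memory state `s`, the program `p` halts after `t` steps in memory
state `s'`. Programs are deterministic: `t` and `s'` are determined by `p` and `s`. -/
inductive Runs : Program → State → ℕ → State → Prop
  | skip (s : State) : Runs .skip s 1 s
  | setNat (a : ℕ) (i e : NatExpr) (s : State) :
      Runs (.setNat a i e) s (i.cost + e.cost + 1) (s.writeNat a (i.eval s) (e.eval s))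
  | setReal (a : ℕ) (i : NatExpr) (e : RealExpr) (s : State) :
      Runs (.setReal a i e) s (i.cost + e.cost + 1) (s.writeReal a (i.eval s) (e.eval s))
  | seq {p q : Program} {s s₁ s₂ : State} {t₁ t₂ : ℕ} (hp : Runs p s t₁ s₁)
      (hq : Runs q s₁ t₂ s₂) : Runs (.seq p q) s (t₁ + t₂) s₂
  | ite_true {b : Test} {p q : Program} {s s' : State} {t : ℕ} (hb : b.Holds s)
      (hp : Runs p s t s') : Runs (.ite b p q) s (b.cost + 1 + t) s'
  | ite_false {b : Test} {p q : Program} {s s' : State} {t : ℕ} (hb : ¬ b.Holds s)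
      (hq : Runs q s t s') : Runs (.ite b p q) s (b.cost + 1 + t) s'
  | loop_true {b : Test} {p : Program} {s s₁ s₂ : State} {t₁ t₂ : ℕ} (hb : b.Holds s)
      (hp : Runs p s t₁ s₁) (hl : Runs (.loop b p) s₁ t₂ s₂) :
      Runs (.loop b p) s (b.cost + 1 + t₁ + t₂) s₂
  | loop_false {b : Test} {p : Program} {s : State} (hb : ¬ b.Holds s) :
      Runs (.loop b p) s (b.cost + 1) s

end RealRAM

/-! ### Input and output -/

/-- The code of a crease label in memory. -/
def labelCode : Option CreaseOrientation → ℕ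
  | none => 0
  | some CreaseOrientation.mountain => 1
  | some CreaseOrientation.valley => 2

/-- The memory state that presents a mixed crease pattern to a program: real array `0` holds the
positions of the `n + 2` vertices from left to right, cell `0` of natural-number array `0` holds
`n`, and natural-number array `1` holds the codes of the labels of the `n` creases. All other
cells are `0`. -/
noncomputable def MixedCreasePattern.inputState {n : ℕ} (P : MixedCreasePattern n) :
    RealRAM.State where
  nat a i :=
    if a = 0 ∧ i = 0 then n
    else if a = 1 then (if hi : i < n then labelCode (P.label ⟨i, hi⟩) else 0)
    else 0
  real a i := if a = 0 then (if hi : i < n + 2 then P.vertex ⟨i, hi⟩ else 0) else 0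

/-- How a final memory state presents the answer, for a pattern with `n` creases: cell `0` of
natural-number array `2` holds `0` for the answer `none` (there is no valid assignment), and `1`
for the answer `some A`, in which case natural-number array `3` holds the codes of the
orientations `A i`. -/
def RealRAM.State.Outputs {n : ℕ} (s : RealRAM.State) : Option (Fin n → CreaseOrientation) → Prop
  | none => s.nat 2 0 = 0
  | some A => s.nat 2 0 = 1 ∧ ∀ i : Fin n, s.nat 3 i.val = labelCode (some (A i))

/-! The decision procedure rests on local moves that delete creases without changing
flat-foldability. The crimp: if a segment is at most as long as both neighbours and its two creases
have opposite labels, then the three segments may be replaced by one, of length `p - q + r`. Given a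
folded state, the layers caught in the two pockets of the zigzag can be moved above or below the
straightened segment (`LayerOrder.crimp`); conversely, a layer can be split into three neighbouring
ones (`LayerOrder.uncrimp`). As chains of labelled lengths this is `foldable_crimp`.

Take a run of equal segments between two strictly longer ones. Cancelling adjacent opposite labels
by crimps leaves creases of one kind. If two or more remain, the layers would spiral inwards and the
longer segment at the end would have to sit inside a crease that it crosses
(`LayerOrder.not_spiral`). So the numbers of mountains and valleys differ by at most one, and the
run reduces to no crease or to one crease of the majority kind (`foldable_crun_iff`). With
unassigned creases the possible valley counts form an interval (`exists_completion_count_iff`), so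
an even run disappears if it can be balanced, and an odd run leaves one crease whose label is forced
or free (`clip`). A first segment no longer than the second can simply be folded over
(`mixedFoldable_cons_iff`), and a chain of weakly decreasing lengths always folds
(`mixedFoldable_of_sorted`).

Reading the pattern from left to right with a stack of runs of strictly decreasing lengths performs
all these reductions. A linear potential drops at every step (`Config.step_spec`), so the decision
takes linear time. An assignment is then found by self-reduction: each unassigned crease is tried as
a mountain, the decision is repeated, and the crease is made a valley on failure. This uses
quadratic time, within the cubic bound. -/

/-- `x` lies strictly between `a` and `b`. -/
def Between (a b x : ℝ) : Prop := (a < x ∧ x < b) ∨ (b < x ∧ x < a)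

/-! ### Restacking the layers around a crimp -/

namespace Crimp

/-- Height after a crimp of three segments with heights `a < b < c`, meeting at the positions
`x < y`, for a segment of height `h` with left end `lo`. -/
noncomputable def restack (x y a b c lo h : ℝ) : ℝ :=
  -- The layers to pass below the merged segment are lowered. Lowering everything below `a` by `c -
  -- a` too frees the interval from `2a - c` to `a`, where the layers taken from between `a` and `c`
  -- land in unchanged order. The outer segments `a` and `c` both end at `a`.
  if h < a ∨ (a < h ∧ h < b ∧ y ≤ lo) ∨ (b < h ∧ h < c ∧ x ≤ lo) then h - (c - a)
  else if h = c then a else h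

/-- What the noncrossing conditions of the two crimped creases say about another segment. -/
structure Layer (x y a b c lo hi h : ℝ) : Prop where
  lt : lo < hi
  ne : h ≠ b
  first : h = a → hi = y ∧ lo ≤ x
  third : h = c → lo = x ∧ y ≤ hi
  left : a < h → h < b → hi ≤ y ∨ y ≤ lo
  right : b < h → h < c → hi ≤ x ∨ x ≤ lo

/-- The forms that `restack` takes for segments reaching left of `x`, right of `y`, and into the
strip between. The first two are strictly monotone, so they preserve every betweenness relation. In
the strip the blocks `(a, b)` and `(b, c)` change places; a segment to which several forms apply
gets the same height from each. -/
noncomputable def restack₁ (a c h : ℝ) : ℝ := if h < a then h - (c - a) else h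
noncomputable def restack₂ (a c h : ℝ) : ℝ :=
  if h < c then h - (c - a) else if h = c then a else h
noncomputable def restack₃ (a b c h : ℝ) : ℝ :=
  if h < a ∨ (b < h ∧ h < c) then h - (c - a) else if h = c then a else h

variable {x y a b c z : ℝ}

theorem restack₁_strictMono (hac : a < c) : StrictMono (restack₁ a c) := by
  intro u w h
  unfold restack₁
  split_ifs <;> linarith

theorem restack₂_strictMono (hac : a < c) : StrictMono (restack₂ a c) := by
  intro u w h
  unfold restack₂
  split_ifs <;> linarith

theorem between_map_iff {g : ℝ → ℝ} (hg : StrictMono g) (u w j : ℝ) :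
    Between (g u) (g w) (g j) ↔ Between u w j := by
  simp [Between, hg.lt_iff_lt]

theorem restack₃_eq₁ {h : ℝ} (hbc : b < c) (hh : ¬ (b < h ∧ h ≤ c)) :
    restack₃ a b c h = restack₁ a c h := by
  unfold restack₃ restack₁
  grind

theorem restack₃_eq₂ {h : ℝ} (hab : a < b) (hbc : b < c) (hb : h ≠ b) (hh : ¬ (a ≤ h ∧ h < b)) :
    restack₃ a b c h = restack₂ a c h := by
  unfold restack₃ restack₂
  grind

theorem Layer.restack_eq₁ {lo hi h : ℝ} (hxy : x < y) (L : Layer x y a b c lo hi h)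
    (hlo : lo < x) : restack x y a b c lo h = restack₁ a c h := by
  have := L.third
  unfold restack restack₁
  grind

theorem Layer.restack_eq₂ {lo hi h : ℝ} (hxy : x < y) (hab : a < b) (hbc : b < c)
    (L : Layer x y a b c lo hi h)
    (hhi : y < hi) : restack x y a b c lo h = restack₂ a c h := by
  have := L.ne
  have := L.first
  have := L.left
  have := L.right
  unfold restack restack₂
  grind

theorem Layer.restack_eq₃ {lo hi h : ℝ} (L : Layer x y a b c lo hi h)
    (hlo : lo < y) (hhi : x < hi) : restack x y a b c lo h = restack₃ a b c h := by
  have := L.right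
  unfold restack restack₃
  grind

/-- The values `a`, `b`, `c` cut the heights into four open blocks. Each is translated, and no other
height enters between two points of its image. Under the hypotheses `u` and `w` lie in one block. -/
theorem not_between_restack₃ {u w j : ℝ} (hab : a < b) (hbc : b < c)
    (ha : ¬ Between u w a) (hb : ¬ Between u w b)
    (hc : ¬ Between u w c) (hj : ¬ Between u w j)
    (ua : u ≠ a) (wa : w ≠ a) (uc : u ≠ c) (wc : w ≠ c) (ub : u ≠ b) (wb : w ≠ b) :
    ¬ Between (restack₃ a b c u) (restack₃ a b c w) (restack₃ a b c j) := by
  have key : ∀ u w : ℝ, u < w → ¬ Between u w a → ¬ Between u w b → ¬ Between u w c →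
      ¬ Between u w j → u ≠ a → w ≠ a → u ≠ c → w ≠ c → u ≠ b → w ≠ b →
      restack₃ a b c u < restack₃ a b c w ∧ (restack₃ a b c j ≤ restack₃ a b c u ∨
        restack₃ a b c w ≤ restack₃ a b c j) := by
    intro u w huw ha hb hc hj ua wa uc wc ub wb
    have ha' : w < a ∨ a < u := by unfold Between at ha; grind
    have hb' : w < b ∨ b < u := by unfold Between at hb; grind
    have hc' : w < c ∨ c < u := by unfold Between at hc; grind
    have hj' : j ≤ u ∨ w ≤ j := by unfold Between at hj; grind
    clear ha hb hc hj
    unfold restack₃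
    constructor
    · split_ifs <;> grind
    · rcases ha' with h1 | h1
      · grind
      rcases hb' with h2 | h2
      · grind
      rcases hc' with h3 | h3 <;> grind
  have symm : ∀ u w x : ℝ, Between u w x ↔ Between w u x := fun u w x => by
    unfold Between; tauto
  rcases lt_trichotomy u w with h | h | h
  · have := key u w h ha hb hc hj ua wa uc wc ub wb
    unfold Between; grind
  · subst h; unfold Between; grind
  · have := key w u h (by rwa [symm]) (by rwa [symm]) (by rwa [symm]) (by rwa [symm])
      wa ua wc uc wb ub
    unfold Between; grind

/-- If one of `u'`, `w'` is between `u` and `w`, so is the other, and all four lie in one block, on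
which `restack₃` agrees with a strictly monotone map. Otherwise `not_between_restack₃` applies to
both. -/
theorem between_congr_restack₃ {u w u' w' : ℝ} (hab : a < b) (hbc : b < c)
    (ha : ¬ Between u w a) (hb : ¬ Between u w b) (hc : ¬ Between u w c)
    (ha' : ¬ Between u' w' a) (hb' : ¬ Between u' w' b)
    (h : Between u w u' ↔ Between u w w')
    (ua : u ≠ a) (wa : w ≠ a) (uc : u ≠ c) (wc : w ≠ c) (ub : u ≠ b) (wb : w ≠ b)
    (ua' : u' ≠ a) (wa' : w' ≠ a) (ub' : u' ≠ b) (wb' : w' ≠ b) :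
    Between (restack₃ a b c u) (restack₃ a b c w) (restack₃ a b c u') ↔
    Between (restack₃ a b c u) (restack₃ a b c w) (restack₃ a b c w') := by
  by_cases hu : Between u w u'
  · have hw := h.1 hu
    by_cases hs : Between a b u
    · have e : ∀ v, v < b → a < v → restack₃ a b c v = restack₁ a c v := fun v hv hv' =>
        restack₃_eq₁ hbc (by grind)
      have : (u < b ∧ a < u) ∧ (w < b ∧ a < w) ∧ (u' < b ∧ a < u') ∧ (w' < b ∧ a < w') := by
        unfold Between at *; grind
      rw [e u this.1.1 this.1.2, e w this.2.1.1 this.2.1.2, e u' this.2.2.1.1 this.2.2.1.2,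
        e w' this.2.2.2.1 this.2.2.2.2, between_map_iff (restack₁_strictMono (hab.trans hbc)),
        between_map_iff (restack₁_strictMono (hab.trans hbc)), h]
    · have e : ∀ v, v ≠ b → ¬ (a ≤ v ∧ v < b) → restack₃ a b c v = restack₂ a c v :=
        fun v hv hv' => restack₃_eq₂ hab hbc hv hv'
      have hw1 : ¬ (a ≤ w ∧ w < b) := by unfold Between at *; grind
      have hu1 : ¬ (a ≤ u ∧ u < b) := by unfold Between at *; grind
      have hw2 : ¬ (a ≤ w' ∧ w' < b) := by unfold Between at *; grind
      have hu2 : ¬ (a ≤ u' ∧ u' < b) := by unfold Between at *; grind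
      rw [e u ub hu1, e w wb hw1, e u' ub' hu2, e w' wb' hw2,
        between_map_iff (restack₂_strictMono (hab.trans hbc)),
        between_map_iff (restack₂_strictMono (hab.trans hbc)), h]
  · have hw : ¬ Between u w w' := fun h' => hu (h.2 h')
    have h1 := not_between_restack₃ hab hbc ha hb hc hu ua wa uc wc ub wb
    have h2 := not_between_restack₃ hab hbc ha hb hc hw ua wa uc wc ub wb
    exact iff_of_false h1 h2

/-- A crease whose segments are to its left, and a segment that passes across it. -/
theorem not_between_of_left {lu lw lj hj u w j : ℝ} (hxy : x < y) (hab : a < b) (hbc : b < c)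
    (Lu : Layer x y a b c lu z u) (Lw : Layer x y a b c lw z w) (Lj : Layer x y a b c lj hj j)
    (ua : u ≠ a) (wa : w ≠ a) (hj1 : lj < z) (hj2 : z < hj)
    (hn : ¬ Between u w j)
    (he : x < z → z < y → ¬ Between u w a ∧ ¬ Between u w b ∧ ¬ Between u w c)
    (hA : z = y → (Between a b u ↔ Between a b w)) :
    ¬ Between (restack x y a b c lu u) (restack x y a b c lw w) (restack x y a b c lj j) := by
  have hac := hab.trans hbc
  have := Lu.lt
  have := Lw.lt
  -- All segments meeting the position `z` are moved by one and the same form of `restack`. Only the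
  -- strip needs care: inside it the crease straddles none of `a`, `b`, `c`; at its end `z = y` the
  -- crease shares its position with the first crimped crease and is wholly in or wholly out of the
  -- pocket `(a, b)`.
  rcases le_or_gt z x with h1 | h1
  · rw [Lu.restack_eq₁ hxy (by linarith), Lw.restack_eq₁ hxy (by linarith),
      Lj.restack_eq₁ hxy (by linarith), between_map_iff (restack₁_strictMono hac)]
    exact hn
  rcases lt_trichotomy z y with h2 | h2 | h2
  · obtain ⟨ha, hb, hc⟩ := he h1 h2
    rw [Lu.restack_eq₃ (by linarith) (by linarith), Lw.restack_eq₃ (by linarith) (by linarith),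
      Lj.restack_eq₃ (by linarith) (by linarith)]
    refine not_between_restack₃ hab hbc ha hb hc hn ua wa ?_ ?_ Lu.ne Lw.ne
    · intro h; linarith [(Lu.third h).2]
    · intro h; linarith [(Lw.third h).2]
  · subst h2
    rw [Lu.restack_eq₃ (by linarith) (by linarith), Lw.restack_eq₃ (by linarith) (by linarith),
      Lj.restack_eq₃ (by linarith) (by linarith)]
    -- A segment crossing `y` is neither in the pocket closed at `y` nor the segment of height `a`,
    -- which ends there.
    have hj : ¬ (a ≤ j ∧ j < b) := by
      have := Lj.left
      have := Lj.first
      grind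
    have hA := hA rfl
    by_cases hu : Between a b u
    · have hw := hA.1 hu
      unfold Between restack₃ at *
      grind
    · have hw := fun h => hu (hA.2 h)
      rw [restack₃_eq₂ hab hbc Lu.ne (by unfold Between at hu; grind),
        restack₃_eq₂ hab hbc Lw.ne (by unfold Between at hw; grind), restack₃_eq₂ hab hbc Lj.ne hj,
        between_map_iff (restack₂_strictMono hac)]
      exact hn
  · rw [Lu.restack_eq₂ hxy hab hbc (by linarith), Lw.restack_eq₂ hxy hab hbc (by linarith),
      Lj.restack_eq₂ hxy hab hbc (by linarith), between_map_iff (restack₂_strictMono hac)]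
    exact hn

/-- The half-turn image of `not_between_of_left`: it exchanges `x` with `y`, the pocket `(a, b)`
with `(b, c)`, and `restack₁` with `restack₂`. -/
theorem not_between_of_right {hu hw lj hj u w j : ℝ} (hxy : x < y) (hab : a < b) (hbc : b < c)
    (Lu : Layer x y a b c z hu u) (Lw : Layer x y a b c z hw w) (Lj : Layer x y a b c lj hj j)
    (uc : u ≠ c) (wc : w ≠ c) (hj1 : lj < z) (hj2 : z < hj)
    (hn : ¬ Between u w j)
    (he : x < z → z < y → ¬ Between u w a ∧ ¬ Between u w b ∧ ¬ Between u w c)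
    (hB : z = x → (Between b c u ↔ Between b c w)) :
    ¬ Between (restack x y a b c z u) (restack x y a b c z w) (restack x y a b c lj j) := by
  have hac := hab.trans hbc
  have := Lu.lt
  have := Lw.lt
  rcases le_or_gt y z with h1 | h1
  · rw [Lu.restack_eq₂ hxy hab hbc (by linarith), Lw.restack_eq₂ hxy hab hbc (by linarith),
      Lj.restack_eq₂ hxy hab hbc (by linarith), between_map_iff (restack₂_strictMono hac)]
    exact hn
  rcases lt_trichotomy x z with h2 | h2 | h2
  · obtain ⟨ha, hb, hc⟩ := he h2 h1
    rw [Lu.restack_eq₃ (by linarith) (by linarith), Lw.restack_eq₃ (by linarith) (by linarith),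
      Lj.restack_eq₃ (by linarith) (by linarith)]
    refine not_between_restack₃ hab hbc ha hb hc hn ?_ ?_ uc wc Lu.ne Lw.ne
    · intro h; linarith [(Lu.first h).2]
    · intro h; linarith [(Lw.first h).2]
  · subst h2
    rw [Lu.restack_eq₃ (by linarith) (by linarith), Lw.restack_eq₃ (by linarith) (by linarith),
      Lj.restack_eq₃ (by linarith) (by linarith)]
    have hj : ¬ (b < j ∧ j ≤ c) := by
      have := Lj.right
      have := Lj.third
      grind
    have hB := hB rfl
    by_cases hu : Between b c u
    · have hw := hB.1 hu
      unfold Between restack₃ at *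
      grind
    · have hw := fun h => hu (hB.2 h)
      rw [restack₃_eq₁ hbc (by unfold Between at hu; grind),
        restack₃_eq₁ hbc (by unfold Between at hw; grind), restack₃_eq₁ hbc hj,
        between_map_iff (restack₁_strictMono hac)]
      exact hn
  · rw [Lu.restack_eq₁ hxy (by linarith), Lw.restack_eq₁ hxy (by linarith),
      Lj.restack_eq₁ hxy (by linarith), between_map_iff (restack₁_strictMono hac)]
    exact hn

/-- Two creases at the same position whose segments are to their left. -/
theorem between_congr_of_left {lu lw lu' lw' u w u' w' : ℝ} (hxy : x < y) (hab : a < b)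
    (hbc : b < c) (Lu : Layer x y a b c lu z u) (Lw : Layer x y a b c lw z w)
    (Lu' : Layer x y a b c lu' z u') (Lw' : Layer x y a b c lw' z w')
    (ua : u ≠ a) (wa : w ≠ a) (ua' : u' ≠ a) (wa' : w' ≠ a)
    (hn : Between u w u' ↔ Between u w w')
    (he : x < z → z < y → ¬ Between u w a ∧ ¬ Between u w b ∧ ¬ Between u w c)
    (he' : x < z → z < y → ¬ Between u' w' a ∧ ¬ Between u' w' b)
    (hA : z = y → (Between a b u ↔ Between a b w))
    (hA' : z = y → (Between a b u' ↔ Between a b w')) :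
    Between (restack x y a b c lu u) (restack x y a b c lw w) (restack x y a b c lu' u') ↔
    Between (restack x y a b c lu u) (restack x y a b c lw w) (restack x y a b c lw' w') := by
  have hac := hab.trans hbc
  have := Lu.lt
  have := Lw.lt
  have := Lu'.lt
  have := Lw'.lt
  rcases le_or_gt z x with h1 | h1
  · rw [Lu.restack_eq₁ hxy (by linarith), Lw.restack_eq₁ hxy (by linarith),
      Lu'.restack_eq₁ hxy (by linarith), Lw'.restack_eq₁ hxy (by linarith),
      between_map_iff (restack₁_strictMono hac), between_map_iff (restack₁_strictMono hac)]
    exact hn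
  rcases lt_trichotomy z y with h2 | h2 | h2
  · obtain ⟨ha, hb, hc⟩ := he h1 h2
    obtain ⟨ha', hb'⟩ := he' h1 h2
    rw [Lu.restack_eq₃ (by linarith) (by linarith), Lw.restack_eq₃ (by linarith) (by linarith),
      Lu'.restack_eq₃ (by linarith) (by linarith), Lw'.restack_eq₃ (by linarith) (by linarith)]
    refine between_congr_restack₃ hab hbc ha hb hc ha' hb' hn ua wa ?_ ?_ Lu.ne Lw.ne
      ua' wa' Lu'.ne Lw'.ne
    · intro h; linarith [(Lu.third h).2]
    · intro h; linarith [(Lw.third h).2]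
  · subst h2
    rw [Lu.restack_eq₃ (by linarith) (by linarith), Lw.restack_eq₃ (by linarith) (by linarith),
      Lu'.restack_eq₃ (by linarith) (by linarith), Lw'.restack_eq₃ (by linarith) (by linarith)]
    have hA := hA rfl
    have hA' := hA' rfl
    have out : ∀ v, ¬ Between a b v → v ≠ a → ¬ (a ≤ v ∧ v < b) := by
      intro v; unfold Between; grind
    have ins : ∀ v, Between a b v → ¬ (b < v ∧ v ≤ c) := by
      intro v; unfold Between; grind
    -- Each crease is in the pocket or out of it. If both are in, `restack₁` describes the move; if
    -- both are out, `restack₂` does. In the mixed cases the pocket moves as a block which no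
    -- outside layer enters, so the two creases cannot interleave.
    by_cases hu : Between a b u <;> by_cases hu' : Between a b u'
    · have hw := hA.1 hu
      have hw' := hA'.1 hu'
      rw [restack₃_eq₁ hbc (ins _ hu), restack₃_eq₁ hbc (ins _ hw), restack₃_eq₁ hbc (ins _ hu'),
        restack₃_eq₁ hbc (ins _ hw'), between_map_iff (restack₁_strictMono hac),
        between_map_iff (restack₁_strictMono hac)]
      exact hn
    · have hw := hA.1 hu
      have hw' := fun h => hu' (hA'.2 h)
      have hsep : ∀ v, ¬ Between a b v → v ≠ a → v ≠ b →
          ¬ Between (restack₃ a b c u) (restack₃ a b c w) (restack₃ a b c v) := by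
        intro v hv
        clear hA hA' hn he he' hu' hw'
        unfold Between restack₃ at *
        grind
      exact iff_of_false (hsep _ hu' ua' Lu'.ne) (hsep _ hw' wa' Lw'.ne)
    · have hw := fun h => hu (hA.2 h)
      have hw' := hA'.1 hu'
      have hsep : ∀ v, ¬ Between a b v → v ≠ b → v ≠ a →
          (restack₃ a b c v < restack₃ a b c u' ↔ restack₃ a b c v < restack₃ a b c w') ∧
          (restack₃ a b c u' < restack₃ a b c v ↔ restack₃ a b c w' < restack₃ a b c v) := by
        intro v hv
        clear hA hA' hn he he' hu hw
        unfold Between restack₃ at *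
        grind
      have h1 := hsep u hu Lu.ne ua
      have h2 := hsep w hw Lw.ne wa
      unfold Between
      rw [h1.1, h1.2, h2.1, h2.2]
    · have hw := fun h => hu (hA.2 h)
      have hw' := fun h => hu' (hA'.2 h)
      rw [restack₃_eq₂ hab hbc Lu.ne (out _ hu ua), restack₃_eq₂ hab hbc Lw.ne (out _ hw wa),
        restack₃_eq₂ hab hbc Lu'.ne (out _ hu' ua'), restack₃_eq₂ hab hbc Lw'.ne (out _ hw' wa'),
        between_map_iff (restack₂_strictMono hac), between_map_iff (restack₂_strictMono hac)]
      exact hn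
  · rw [Lu.restack_eq₂ hxy hab hbc (by linarith), Lw.restack_eq₂ hxy hab hbc (by linarith),
      Lu'.restack_eq₂ hxy hab hbc (by linarith), Lw'.restack_eq₂ hxy hab hbc (by linarith),
      between_map_iff (restack₂_strictMono hac), between_map_iff (restack₂_strictMono hac)]
    exact hn

theorem between_congr_of_right {hu hw hu' hw' u w u' w' : ℝ} (hxy : x < y) (hab : a < b)
    (hbc : b < c) (Lu : Layer x y a b c z hu u) (Lw : Layer x y a b c z hw w)
    (Lu' : Layer x y a b c z hu' u') (Lw' : Layer x y a b c z hw' w')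
    (uc : u ≠ c) (wc : w ≠ c) (uc' : u' ≠ c) (wc' : w' ≠ c)
    (hn : Between u w u' ↔ Between u w w')
    (he : x < z → z < y → ¬ Between u w a ∧ ¬ Between u w b ∧ ¬ Between u w c)
    (he' : x < z → z < y → ¬ Between u' w' a ∧ ¬ Between u' w' b)
    (hB : z = x → (Between b c u ↔ Between b c w))
    (hB' : z = x → (Between b c u' ↔ Between b c w')) :
    Between (restack x y a b c z u) (restack x y a b c z w) (restack x y a b c z u') ↔
    Between (restack x y a b c z u) (restack x y a b c z w) (restack x y a b c z w') := by
  have hac := hab.trans hbc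
  have := Lu.lt
  have := Lw.lt
  have := Lu'.lt
  have := Lw'.lt
  rcases le_or_gt y z with h1 | h1
  · rw [Lu.restack_eq₂ hxy hab hbc (by linarith), Lw.restack_eq₂ hxy hab hbc (by linarith),
      Lu'.restack_eq₂ hxy hab hbc (by linarith), Lw'.restack_eq₂ hxy hab hbc (by linarith),
      between_map_iff (restack₂_strictMono hac), between_map_iff (restack₂_strictMono hac)]
    exact hn
  rcases lt_trichotomy x z with h2 | h2 | h2
  · obtain ⟨ha, hb, hc⟩ := he h2 h1
    obtain ⟨ha', hb'⟩ := he' h2 h1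
    rw [Lu.restack_eq₃ (by linarith) (by linarith), Lw.restack_eq₃ (by linarith) (by linarith),
      Lu'.restack_eq₃ (by linarith) (by linarith), Lw'.restack_eq₃ (by linarith) (by linarith)]
    have na : ∀ {v hv : ℝ}, Layer x y a b c z hv v → v ≠ a := by
      intro v hv L h; linarith [(L.first h).2]
    exact between_congr_restack₃ hab hbc ha hb hc ha' hb' hn (na Lu) (na Lw) uc wc Lu.ne Lw.ne
      (na Lu') (na Lw') Lu'.ne Lw'.ne
  · subst h2
    rw [Lu.restack_eq₃ (by linarith) (by linarith), Lw.restack_eq₃ (by linarith) (by linarith),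
      Lu'.restack_eq₃ (by linarith) (by linarith), Lw'.restack_eq₃ (by linarith) (by linarith)]
    have hB := hB rfl
    have hB' := hB' rfl
    have out : ∀ v, ¬ Between b c v → v ≠ c → ¬ (b < v ∧ v ≤ c) := by
      intro v; unfold Between; grind
    have ins : ∀ v, Between b c v → v ≠ b ∧ ¬ (a ≤ v ∧ v < b) := by
      intro v; unfold Between; grind
    by_cases hu : Between b c u <;> by_cases hu' : Between b c u'
    · have hw := hB.1 hu
      have hw' := hB'.1 hu'
      rw [restack₃_eq₂ hab hbc Lu.ne (ins _ hu).2, restack₃_eq₂ hab hbc Lw.ne (ins _ hw).2,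
        restack₃_eq₂ hab hbc Lu'.ne (ins _ hu').2,
        restack₃_eq₂ hab hbc Lw'.ne (ins _ hw').2, between_map_iff (restack₂_strictMono hac),
        between_map_iff (restack₂_strictMono hac)]
      exact hn
    · have hw := hB.1 hu
      have hw' := fun h => hu' (hB'.2 h)
      have hsep : ∀ v, ¬ Between b c v → v ≠ c → v ≠ b →
          ¬ Between (restack₃ a b c u) (restack₃ a b c w) (restack₃ a b c v) := by
        intro v hv
        clear hB hB' hn he he' hu' hw'
        unfold Between restack₃ at *
        grind
      exact iff_of_false (hsep _ hu' uc' Lu'.ne) (hsep _ hw' wc' Lw'.ne)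
    · have hw := fun h => hu (hB.2 h)
      have hw' := hB'.1 hu'
      have hsep : ∀ v, ¬ Between b c v → v ≠ b → v ≠ c →
          (restack₃ a b c v < restack₃ a b c u' ↔ restack₃ a b c v < restack₃ a b c w') ∧
          (restack₃ a b c u' < restack₃ a b c v ↔ restack₃ a b c w' < restack₃ a b c v) := by
        intro v hv
        clear hB hB' hn he he' hu hw
        unfold Between restack₃ at *
        grind
      have h1 := hsep u hu Lu.ne uc
      have h2 := hsep w hw Lw.ne wc
      unfold Between
      rw [h1.1, h1.2, h2.1, h2.2]
    · have hw := fun h => hu (hB.2 h)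
      have hw' := fun h => hu' (hB'.2 h)
      rw [restack₃_eq₁ hbc (out _ hu uc), restack₃_eq₁ hbc (out _ hw wc),
        restack₃_eq₁ hbc (out _ hu' uc'), restack₃_eq₁ hbc (out _ hw' wc'),
        between_map_iff (restack₁_strictMono hac), between_map_iff (restack₁_strictMono hac)]
      exact hn
  · rw [Lu.restack_eq₁ hxy (by linarith), Lw.restack_eq₁ hxy (by linarith),
      Lu'.restack_eq₁ hxy (by linarith), Lw'.restack_eq₁ hxy (by linarith),
      between_map_iff (restack₁_strictMono hac), between_map_iff (restack₁_strictMono hac)]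
    exact hn

/-- Segments that meet at a crease to their right keep their order. -/
theorem restack_lt_iff_of_left {lu lw u w : ℝ} (hxy : x < y) (hab : a < b) (hbc : b < c)
    (Lu : Layer x y a b c lu z u) (Lw : Layer x y a b c lw z w) (ua : u ≠ a) (wa : w ≠ a)
    (he : x < z → z < y → ¬ Between u w b)
    (hA : z = y → (Between a b u ↔ Between a b w)) :
    restack x y a b c lu u < restack x y a b c lw w ↔ u < w := by
  have hac := hab.trans hbc
  have := Lu.lt
  have := Lw.lt
  rcases le_or_gt z x with h1 | h1
  · rw [Lu.restack_eq₁ hxy (by linarith), Lw.restack_eq₁ hxy (by linarith),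
      (restack₁_strictMono hac).lt_iff_lt]
  rcases lt_trichotomy z y with h2 | h2 | h2
  · have := Lu.third
    have := Lw.third
    have := Lu.ne
    have := Lw.ne
    have he := he h1 h2
    rw [Lu.restack_eq₃ (by linarith) (by linarith), Lw.restack_eq₃ (by linarith) (by linarith)]
    unfold restack₃ Between at *
    grind
  · have := Lu.ne
    have := Lw.ne
    have hA := hA h2
    rw [Lu.restack_eq₃ (by linarith) (by linarith), Lw.restack_eq₃ (by linarith) (by linarith)]
    unfold restack₃ Between at *
    grind
  · rw [Lu.restack_eq₂ hxy hab hbc (by linarith), Lw.restack_eq₂ hxy hab hbc (by linarith),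
      (restack₂_strictMono hac).lt_iff_lt]

theorem restack_lt_iff_of_right {hu hw u w : ℝ} (hxy : x < y) (hab : a < b) (hbc : b < c)
    (Lu : Layer x y a b c z hu u) (Lw : Layer x y a b c z hw w) (uc : u ≠ c) (wc : w ≠ c)
    (he : x < z → z < y → ¬ Between u w b)
    (hB : z = x → (Between b c u ↔ Between b c w)) :
    restack x y a b c z u < restack x y a b c z w ↔ u < w := by
  have hac := hab.trans hbc
  have := Lu.lt
  have := Lw.lt
  rcases le_or_gt y z with h1 | h1
  · rw [Lu.restack_eq₂ hxy hab hbc (by linarith), Lw.restack_eq₂ hxy hab hbc (by linarith),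
      (restack₂_strictMono hac).lt_iff_lt]
  rcases lt_trichotomy x z with h2 | h2 | h2
  · have := Lu.first
    have := Lw.first
    have := Lu.ne
    have := Lw.ne
    have he := he h2 h1
    rw [Lu.restack_eq₃ (by linarith) (by linarith), Lw.restack_eq₃ (by linarith) (by linarith)]
    unfold restack₃ Between at *
    grind
  · have := Lu.ne
    have := Lw.ne
    have hB := hB h2.symm
    rw [Lu.restack_eq₃ (by linarith) (by linarith), Lw.restack_eq₃ (by linarith) (by linarith)]
    unfold restack₃ Between at *
    grind
  · rw [Lu.restack_eq₁ hxy (by linarith), Lw.restack_eq₁ hxy (by linarith),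
      (restack₁_strictMono hac).lt_iff_lt]

end Crimp

/-! ### Layer orders of folded chains -/

/-- The heights `h` stack the segments `[f j, f (j + 1)]`, `j ≤ N`, of a folded chain without
self-crossings. Crease `k < N` joins segments `k` and `k + 1`. -/
structure LayerOrder (N : ℕ) (f h : ℕ → ℝ) : Prop where
  inj : ∀ j ≤ N, ∀ j' ≤ N, h j = h j' → j = j'
  crease_segment : ∀ k < N, ∀ j ≤ N, Between (f j) (f (j + 1)) (f (k + 1)) →
    ¬ Between (h k) (h (k + 1)) (h j)
  crease_crease : ∀ k < N, ∀ k' < N, k ≠ k' → f (k + 1) = f (k' + 1) → k % 2 = k' % 2 →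
    (Between (h k) (h (k + 1)) (h k') ↔ Between (h k) (h (k + 1)) (h (k' + 1)))

theorem between_neg (a b x : ℝ) : Between (-a) (-b) (-x) ↔ Between a b x := by
  simp [Between, and_comm, or_comm]

/-- Together with `LayerOrder.neg_right` this allows a crimp to be treated only for a zigzag that
starts to the right and ascends. -/
theorem LayerOrder.neg_left {N : ℕ} {f h : ℕ → ℝ} (H : LayerOrder N f h) :
    LayerOrder N (fun k => -f k) h where
  inj := H.inj
  crease_segment k hk j hj := by rw [between_neg]; exact H.crease_segment k hk j hj
  crease_crease k hk k' hk' hne he := H.crease_crease k hk k' hk' hne (neg_inj.1 he)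

theorem LayerOrder.neg_right {N : ℕ} {f h : ℕ → ℝ} (H : LayerOrder N f h) :
    LayerOrder N f (fun k => -h k) where
  inj j hj j' hj' he := H.inj j hj j' hj' (neg_inj.1 he)
  crease_segment k hk j hj hb := by rw [between_neg]; exact H.crease_segment k hk j hj hb
  crease_crease k hk k' hk' hne he hp := by
    simp only [between_neg]
    exact H.crease_crease k hk k' hk' hne he hp

/-! ### Straightening a crimp in a folded chain. -/

/-- The index, before the two points `i + 1`, `i + 2` are deleted, of point `k`. -/
def skipPoint (i k : ℕ) : ℕ := if k ≤ i then k else k + 2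

/-- The index, before the two creases `i`, `i + 1` are deleted, of crease `k`. -/
def skipCrease (i k : ℕ) : ℕ := if k < i then k else k + 2

theorem skipPoint_succ (i k : ℕ) : skipPoint i (k + 1) = skipCrease i k + 1 := by
  unfold skipPoint skipCrease; grind

namespace Crimp

/-- The only possible collision is between the two outer segments of the crimp, which become one
segment. -/
theorem restack_inj {x y a b c lo lo' h h' : ℝ} (hab : a < b) (hbc : b < c)
    (he : restack x y a b c lo h = restack x y a b c lo' h') :
    h = h' ∨ ((h = a ∨ h = c) ∧ (h' = a ∨ h' = c)) := by
  unfold restack at he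
  grind

theorem restack_first {x y a b c lo : ℝ} (hab : a < b) (hbc : b < c) :
    restack x y a b c lo a = a := by
  unfold restack
  grind

theorem restack_third {x y a b c lo : ℝ} (hab : a < b) (hbc : b < c) :
    restack x y a b c lo c = a := by
  unfold restack
  grind

section

variable {M i : ℕ} {f h : ℕ → ℝ}

theorem between_iff_min_max (a b x : ℝ) : Between a b x ↔ min a b < x ∧ x < max a b := by
  unfold Between
  grind

/-- The pocket conditions `left` and `right` are noncrossing at creases `i` and `i + 1`; `first` and
`third` express that the middle segment is no longer than its neighbours. -/
theorem layer_of_ne (hiM : i ≤ M)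
    (zig : ∀ j ≤ M + 2, (j % 2 = i % 2 → f j < f (j + 1)) ∧ (j % 2 ≠ i % 2 → f (j + 1) < f j))
    (h02 : f i ≤ f (i + 2)) (h13 : f (i + 1) ≤ f (i + 3))
    (H : LayerOrder (M + 2) f h) {j : ℕ} (hj : j ≤ M + 2) (hne : j ≠ i + 1) :
    Layer (f (i + 2)) (f (i + 1)) (h i) (h (i + 1)) (h (i + 2)) (min (f j) (f (j + 1)))
      (max (f j) (f (j + 1))) (h j) where
  lt := by
    have := zig j hj
    grind
  ne e := hne (H.inj j hj (i + 1) (by omega) e)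
  first e := by
    obtain rfl := H.inj j hj i (by omega) e
    have := (zig j hj).1 rfl
    grind
  third e := by
    obtain rfl := H.inj j hj (i + 2) (by omega) e
    have := (zig (i + 2) hj).1 (by omega)
    grind
  left h1 h2 := by
    by_contra hc
    exact H.crease_segment i (by omega) j hj ((between_iff_min_max _ _ _).2 (by grind))
      (Or.inl ⟨h1, h2⟩)
  right h1 h2 := by
    by_contra hc
    exact H.crease_segment (i + 1) (by omega) j hj ((between_iff_min_max _ _ _).2 (by grind))
      (Or.inl ⟨h1, h2⟩)

/-- The heights of the segments after the crimp of segments `i`, `i + 1` and `i + 2`. -/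
noncomputable def height (f h : ℕ → ℝ) (i j : ℕ) : ℝ :=
  restack (f (i + 2)) (f (i + 1)) (h i) (h (i + 1)) (h (i + 2)) (min (f j) (f (j + 1))) (h j)

/-- All three crimped segments cross every position of the open strip, so none of them lies between
the layers of a crease there. -/
theorem not_between_inner (hiM : i ≤ M) (h02 : f i ≤ f (i + 2)) (h13 : f (i + 1) ≤ f (i + 3))
    (H : LayerOrder (M + 2) f h) {k : ℕ} (hk : k < M + 2)
    (h1 : f (i + 2) < f (k + 1)) (h2 : f (k + 1) < f (i + 1)) :
    ¬ Between (h k) (h (k + 1)) (h i) ∧ ¬ Between (h k) (h (k + 1)) (h (i + 1)) ∧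
      ¬ Between (h k) (h (k + 1)) (h (i + 2)) := by
  refine ⟨H.crease_segment k hk i (by omega) (Or.inl ⟨by linarith, h2⟩),
    H.crease_segment k hk (i + 1) (by omega) (Or.inr ⟨h1, h2⟩),
    H.crease_segment k hk (i + 2) (by omega) (Or.inl ⟨h1, by linarith⟩)⟩

variable (hiM : i ≤ M)
  (zig : ∀ j ≤ M + 2, (j % 2 = i % 2 → f j < f (j + 1)) ∧ (j % 2 ≠ i % 2 → f (j + 1) < f j))
  (h02 : f i ≤ f (i + 2)) (h13 : f (i + 1) ≤ f (i + 3)) (H : LayerOrder (M + 2) f h)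
  (hab : h i < h (i + 1)) (hbc : h (i + 1) < h (i + 2))

include hiM zig h02 h13 H hab hbc

theorem not_between_height {k j : ℕ} (hk : k < M + 2) (hki : k ≠ i) (hki' : k ≠ i + 1)
    (hj : j ≤ M + 2) (hji : j ≠ i + 1) (hz : Between (f j) (f (j + 1)) (f (k + 1))) :
    ¬ Between (height f h i k) (height f h i (k + 1)) (height f h i j) := by
  have hxy : f (i + 2) < f (i + 1) := (zig (i + 1) (by omega)).2 (by omega)
  have Lu := layer_of_ne hiM zig h02 h13 H (j := k) (by omega) hki'
  have Lw := layer_of_ne hiM zig h02 h13 H (j := k + 1) (by omega) (by omega)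
  have Lj := layer_of_ne hiM zig h02 h13 H hj hji
  obtain ⟨hz1, hz2⟩ := (between_iff_min_max _ _ _).1 hz
  have zk := zig k (by omega)
  have zk' := zig (k + 1) (by omega)
  have he := not_between_inner hiM h02 h13 H hk
  have hn := H.crease_segment k hk j hj hz
  unfold height
  -- With the parity of `i`, crease `k` is the right end of both its segments; otherwise it is their
  -- left end. The last argument supplied in each case is noninterleaving with the crimped crease
  -- that faces the same side.
  by_cases hp : k % 2 = i % 2
  · have zk := zk.1 hp
    have zk' := zk'.2 (by omega)
    rw [max_eq_right zk.le] at Lu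
    rw [max_eq_left zk'.le] at Lw
    exact not_between_of_left hxy hab hbc Lu Lw Lj
      (fun e => hki (H.inj _ (by omega) _ (by omega) e))
      (fun e => by have := H.inj _ (by omega) _ (by omega) e; omega) hz1 hz2 hn he
      (fun e => H.crease_crease i (by omega) k hk hki.symm e.symm hp.symm)
  · have zk := zk.2 hp
    have zk' := zk'.1 (by omega)
    rw [min_eq_right zk.le] at Lu ⊢
    rw [min_eq_left zk'.le] at Lw ⊢
    exact not_between_of_right hxy hab hbc Lu Lw Lj
      (fun e => by have := H.inj _ (by omega) _ (by omega) e; omega)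
      (fun e => by have := H.inj _ (by omega) _ (by omega) e; omega) hz1 hz2 hn he
      (fun e => H.crease_crease (i + 1) (by omega) k hk hki'.symm e.symm (by omega))

theorem between_height_congr {k k' : ℕ} (hk : k < M + 2) (hki : k ≠ i) (hki' : k ≠ i + 1)
    (hk' : k' < M + 2) (hki₁ : k' ≠ i) (hki₁' : k' ≠ i + 1) (hne : k ≠ k')
    (hz : f (k + 1) = f (k' + 1)) (hpp : k % 2 = k' % 2) :
    Between (height f h i k) (height f h i (k + 1)) (height f h i k') ↔
    Between (height f h i k) (height f h i (k + 1)) (height f h i (k' + 1)) := by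
  have hxy : f (i + 2) < f (i + 1) := (zig (i + 1) (by omega)).2 (by omega)
  have Lu := layer_of_ne hiM zig h02 h13 H (j := k) (by omega) hki'
  have Lw := layer_of_ne hiM zig h02 h13 H (j := k + 1) (by omega) (by omega)
  have Lu' := layer_of_ne hiM zig h02 h13 H (j := k') (by omega) hki₁'
  have Lw' := layer_of_ne hiM zig h02 h13 H (j := k' + 1) (by omega) (by omega)
  have zk := zig k (by omega)
  have zk' := zig (k + 1) (by omega)
  have zl := zig k' (by omega)
  have zl' := zig (k' + 1) (by omega)
  have he := not_between_inner hiM h02 h13 H hk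
  have he' := not_between_inner hiM h02 h13 H hk'
  rw [← hz] at he'
  have hn := H.crease_crease k hk k' hk' hne hz hpp
  unfold height
  by_cases hp : k % 2 = i % 2
  · have zk := zk.1 hp
    have zk' := zk'.2 (by omega)
    have zl := zl.1 (by omega)
    have zl' := zl'.2 (by omega)
    rw [max_eq_right zk.le] at Lu
    rw [max_eq_left zk'.le] at Lw
    rw [max_eq_right zl.le, min_eq_left zl.le, ← hz] at Lu'
    rw [max_eq_left zl'.le, min_eq_right zl'.le, ← hz] at Lw'
    rw [min_eq_left zl.le, min_eq_right zl'.le]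
    have hu : ∀ l ≤ M + 2, l ≠ i → h l ≠ h i := fun l hl hli e =>
      hli (H.inj _ hl _ (by omega) e)
    exact between_congr_of_left hxy hab hbc Lu Lw Lu' Lw'
      (hu _ (by omega) (by omega)) (hu _ (by omega) (by omega))
      (hu _ (by omega) (by omega)) (hu _ (by omega) (by omega)) hn he
      (fun h1 h2 => ⟨(he' h1 h2).1, (he' h1 h2).2.1⟩)
      (fun e => H.crease_crease i (by omega) k hk hki.symm e.symm hp.symm)
      (fun e => H.crease_crease i (by omega) k' hk' hki₁.symm (by rw [← e, hz]) (by omega))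
  · have zk := zk.2 hp
    have zk' := zk'.1 (by omega)
    have zl := zl.2 (by omega)
    have zl' := zl'.1 (by omega)
    rw [min_eq_right zk.le] at Lu ⊢
    rw [min_eq_left zk'.le] at Lw ⊢
    rw [min_eq_right zl.le, max_eq_left zl.le, ← hz] at Lu'
    rw [min_eq_left zl'.le, max_eq_right zl'.le, ← hz] at Lw'
    rw [min_eq_right zl.le, min_eq_left zl'.le, ← hz]
    have hu : ∀ l ≤ M + 2, l ≠ i + 2 → h l ≠ h (i + 2) := fun l hl hli e =>
      hli (H.inj _ hl _ (by omega) e)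
    exact between_congr_of_right hxy hab hbc Lu Lw Lu' Lw'
      (hu _ (by omega) (by omega)) (hu _ (by omega) (by omega))
      (hu _ (by omega) (by omega)) (hu _ (by omega) (by omega)) hn he
      (fun h1 h2 => ⟨(he' h1 h2).1, (he' h1 h2).2.1⟩)
      (fun e => H.crease_crease (i + 1) (by omega) k hk hki'.symm e.symm (by omega))
      (fun e => H.crease_crease (i + 1) (by omega) k' hk' hki₁'.symm (by rw [← hz]; exact e.symm)
        (by omega))

theorem height_lt_iff {k : ℕ} (hk : k < M + 2) (hki : k ≠ i) (hki' : k ≠ i + 1) :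
    height f h i k < height f h i (k + 1) ↔ h k < h (k + 1) := by
  have hxy : f (i + 2) < f (i + 1) := (zig (i + 1) (by omega)).2 (by omega)
  have Lu := layer_of_ne hiM zig h02 h13 H (j := k) (by omega) hki'
  have Lw := layer_of_ne hiM zig h02 h13 H (j := k + 1) (by omega) (by omega)
  have zk := zig k (by omega)
  have zk' := zig (k + 1) (by omega)
  have he := not_between_inner hiM h02 h13 H hk
  unfold height
  by_cases hp : k % 2 = i % 2
  · have zk := zk.1 hp
    have zk' := zk'.2 (by omega)
    rw [max_eq_right zk.le] at Lu
    rw [max_eq_left zk'.le] at Lw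
    exact restack_lt_iff_of_left hxy hab hbc Lu Lw
      (fun e => hki (H.inj _ (by omega) _ (by omega) e))
      (fun e => by have := H.inj _ (by omega) _ (by omega) e; omega)
      (fun h1 h2 => (he h1 h2).2.1)
      (fun e => H.crease_crease i (by omega) k hk hki.symm e.symm hp.symm)
  · have zk := zk.2 hp
    have zk' := zk'.1 (by omega)
    rw [min_eq_right zk.le] at Lu ⊢
    rw [min_eq_left zk'.le] at Lw ⊢
    exact restack_lt_iff_of_right hxy hab hbc Lu Lw
      (fun e => by have := H.inj _ (by omega) _ (by omega) e; omega)
      (fun e => by have := H.inj _ (by omega) _ (by omega) e; omega)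
      (fun h1 h2 => (he h1 h2).2.1)
      (fun e => H.crease_crease (i + 1) (by omega) k hk hki'.symm e.symm (by omega))

-- The two indices differ only for `k = i`, where they are the outer segments `i` and `i + 2` of the
-- crimp, restacked to the same height. So the merged segment may be represented by either.
omit hiM zig h02 h13 H in
theorem height_skipPoint (k : ℕ) :
    height f h i (skipPoint i k) = height f h i (skipCrease i k) := by
  unfold skipPoint skipCrease
  rcases lt_trichotomy k i with hk | rfl | hk
  · rw [if_pos hk.le, if_pos hk]
  · rw [if_pos le_rfl, if_neg (lt_irrefl _)]
    unfold height
    rw [restack_first hab hbc, restack_third hab hbc]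
  · rw [if_neg (by omega), if_neg (by omega)]

theorem layerOrder_height :
    LayerOrder M (fun k => f (skipPoint i k)) (fun k => height f h i (skipPoint i k)) where
  inj j hj j' hj' he := by
    have := restack_inj hab hbc he
    have inj : ∀ l l', l ≤ M + 2 → l' ≤ M + 2 → h l = h l' → l = l' := fun l l' hl hl' =>
      H.inj l hl l' hl'
    have h1 : skipPoint i j ≠ i + 2 := by unfold skipPoint; grind
    have h1' : skipPoint i j' ≠ i + 2 := by unfold skipPoint; grind
    have hb : skipPoint i j ≤ M + 2 := by unfold skipPoint; grind
    have hb' : skipPoint i j' ≤ M + 2 := by unfold skipPoint; grind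
    have hs : skipPoint i j = skipPoint i j' := by
      rcases this with e | ⟨e | e, e' | e'⟩
      · exact inj _ _ hb hb' e
      · rw [inj _ _ hb (by omega) e, inj _ _ hb' (by omega) e']
      · exact absurd (inj _ _ hb' (by omega) e') h1'
      · exact absurd (inj _ _ hb (by omega) e) h1
      · exact absurd (inj _ _ hb (by omega) e) h1
    unfold skipPoint at hs
    grind
  crease_segment k hk j hj hz := by
    simp only [height_skipPoint hab hbc k]
    rw [skipPoint_succ i k] at hz ⊢
    have hk1 : skipCrease i k < M + 2 ∧ skipCrease i k ≠ i ∧ skipCrease i k ≠ i + 1 := by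
      unfold skipCrease; grind
    have key := fun j => not_between_height hiM zig h02 h13 H hab hbc (j := j) hk1.1 hk1.2.1
      hk1.2.2
    rcases lt_trichotomy j i with hji | rfl | hji
    · have e1 : skipPoint i j = j := by unfold skipPoint; grind
      have e2 : skipPoint i (j + 1) = j + 1 := by unfold skipPoint; grind
      rw [e1, e2] at hz
      rw [e1]
      exact key j (by omega) (by omega) hz
    · have e1 : skipPoint j j = j := by unfold skipPoint; grind
      have e2 : skipPoint j (j + 1) = j + 3 := by unfold skipPoint; grind
      have hxy : f (j + 2) < f (j + 1) := (zig (j + 1) (by omega)).2 (by omega)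
      have z1 : f j < f (j + 1) := (zig j (by omega)).1 rfl
      have z3 : f (j + 2) < f (j + 3) := (zig (j + 2) (by omega)).1 (by omega)
      rw [e1, e2] at hz
      have hz' : f j < f (skipCrease j k + 1) ∧ f (skipCrease j k + 1) < f (j + 3) := by
        unfold Between at hz; grind
      -- The merged segment is covered by the overlapping segments `j` and `j + 2`. A crease
      -- position inside it is interior to one of them, and both have the new height of the merged
      -- segment.
      rcases lt_or_ge (f (skipCrease j k + 1)) (f (j + 1)) with hlt | hge
      · rw [e1]
        exact key j (by omega) (by omega) (Or.inl ⟨hz'.1, hlt⟩)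
      · have := height_skipPoint (f := f) hab hbc j
        rw [this]
        have e3 : skipCrease j j = j + 2 := by unfold skipCrease; grind
        rw [e3]
        exact key (j + 2) (by omega) (by omega) (Or.inl ⟨by linarith, hz'.2⟩)
    · have e1 : skipPoint i j = j + 2 := by unfold skipPoint; grind
      have e2 : skipPoint i (j + 1) = j + 3 := by unfold skipPoint; grind
      rw [e1, e2] at hz
      rw [e1]
      exact key (j + 2) (by omega) (by omega) hz
  crease_crease k hk k' hk' hne hz hp := by
    simp only [height_skipPoint hab hbc k, height_skipPoint hab hbc k']
    rw [skipPoint_succ, skipPoint_succ] at hz ⊢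
    have hk1 : skipCrease i k < M + 2 ∧ skipCrease i k ≠ i ∧ skipCrease i k ≠ i + 1 := by
      unfold skipCrease; grind
    have hk2 : skipCrease i k' < M + 2 ∧ skipCrease i k' ≠ i ∧ skipCrease i k' ≠ i + 1 := by
      unfold skipCrease; grind
    exact between_height_congr hiM zig h02 h13 H hab hbc hk1.1 hk1.2.1 hk1.2.2 hk2.1 hk2.2.1
      hk2.2.2 (by unfold skipCrease; grind) hz (by unfold skipCrease; grind)

theorem height_skipPoint_lt_iff {k : ℕ} (hk : k < M) :
    height f h i (skipPoint i k) < height f h i (skipPoint i (k + 1)) ↔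
      h (skipCrease i k) < h (skipCrease i k + 1) := by
  rw [height_skipPoint hab hbc k, skipPoint_succ]
  exact height_lt_iff hiM zig h02 h13 H hab hbc (by unfold skipCrease; grind)
    (by unfold skipCrease; grind) (by unfold skipCrease; grind)

end

end Crimp

/-- The chain `f` first goes to the right, then alternately to the left and to the right. -/
def Zigzag (N : ℕ) (f : ℕ → ℝ) : Prop :=
  ∀ j ≤ N, (j % 2 = 0 → f j < f (j + 1)) ∧ (j % 2 = 1 → f (j + 1) < f j)

/-- Segment `i + 1` is at most as long as its two neighbours. -/
def LocallyShortest (f : ℕ → ℝ) (i : ℕ) : Prop :=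
  (i % 2 = 0 → f i ≤ f (i + 2) ∧ f (i + 1) ≤ f (i + 3)) ∧
  (i % 2 = 1 → f (i + 2) ≤ f i ∧ f (i + 3) ≤ f (i + 1))

/-- The condition `hdir` says that the three layers are monotone in height, as they are for one
mountain and one valley. The reflections reduce to the ascending zigzag starting to the right. -/
theorem LayerOrder.crimp {M i : ℕ} {f h : ℕ → ℝ} (hiM : i ≤ M) (zig : Zigzag (M + 2) f)
    (short : LocallyShortest f i) (H : LayerOrder (M + 2) f h)
    (hdir : h i < h (i + 1) ↔ h (i + 1) < h (i + 2)) :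
    ∃ g : ℕ → ℝ, LayerOrder M (fun k => f (skipPoint i k)) g ∧
      ∀ k < M, (g k < g (k + 1) ↔ h (skipCrease i k) < h (skipCrease i k + 1)) := by
  have main : ∀ h : ℕ → ℝ, LayerOrder (M + 2) f h → h i < h (i + 1) → h (i + 1) < h (i + 2) →
      ∃ g : ℕ → ℝ, LayerOrder M (fun k => f (skipPoint i k)) g ∧
        ∀ k < M, (g k < g (k + 1) ↔ h (skipCrease i k) < h (skipCrease i k + 1)) := by
    intro h H hab hbc
    rcases Nat.mod_two_eq_zero_or_one i with hi | hi
    · have z : ∀ j ≤ M + 2, (j % 2 = i % 2 → f j < f (j + 1)) ∧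
          (j % 2 ≠ i % 2 → f (j + 1) < f j) := fun j hj =>
        ⟨fun e => (zig j hj).1 (by omega), fun e => (zig j hj).2 (by omega)⟩
      obtain ⟨h1, h2⟩ := short.1 hi
      exact ⟨_, Crimp.layerOrder_height hiM z h1 h2 H hab hbc, fun k hk =>
        Crimp.height_skipPoint_lt_iff hiM z h1 h2 H hab hbc hk⟩
    · have z : ∀ j ≤ M + 2, (j % 2 = i % 2 → -f j < -f (j + 1)) ∧
          (j % 2 ≠ i % 2 → -f (j + 1) < -f j) := fun j hj =>
        ⟨fun e => neg_lt_neg ((zig j hj).2 (by omega)),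
          fun e => neg_lt_neg ((zig j hj).1 (by omega))⟩
      obtain ⟨h1, h2⟩ := short.2 hi
      have H' := H.neg_left
      refine ⟨_, ?_, fun k hk => Crimp.height_skipPoint_lt_iff hiM z (neg_le_neg h1)
        (neg_le_neg h2) H' hab hbc hk⟩
      have := (Crimp.layerOrder_height hiM z (neg_le_neg h1) (neg_le_neg h2) H' hab hbc).neg_left
      simpa using this
  by_cases hab : h i < h (i + 1)
  · exact main h H hab (hdir.1 hab)
  · have n1 : h i ≠ h (i + 1) := fun e => by
      have := H.inj _ (by omega) _ (by omega) e
      omega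
    have n2 : h (i + 1) ≠ h (i + 2) := fun e => by
      have := H.inj _ (by omega) _ (by omega) e
      omega
    have hbc := fun h' => hab (hdir.2 h')
    obtain ⟨g, hg, hgk⟩ := main _ H.neg_right (by grind) (by grind)
    refine ⟨_, hg.neg_right, fun k hk => ?_⟩
    have gn : g k ≠ g (k + 1) := fun e => by
      have := hg.inj _ (by omega) _ (by omega) e
      omega
    have hb : skipCrease i k + 1 ≤ M + 2 := by unfold skipCrease; grind
    have hn : h (skipCrease i k) ≠ h (skipCrease i k + 1) := fun e => by
      have := H.inj _ (by omega) _ (by omega) e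
      omega
    have := hgk k hk
    grind

/-! ### Undoing a crimp. -/

theorem exists_pos_lt_of_finset {α : Type*} (S : Finset α) (v : α → ℝ) (hv : ∀ p ∈ S, 0 < v p) :
    ∃ δ > 0, ∀ p ∈ S, δ < v p := by
  classical
  induction S using Finset.induction_on with
  | empty => exact ⟨1, one_pos, by simp⟩
  | insert a S ha ih =>
    obtain ⟨δ, h1, h2⟩ := ih fun p hp => hv p (Finset.mem_insert_of_mem hp)
    have := hv a (Finset.mem_insert_self a S)
    refine ⟨min δ (v a / 2), by positivity, fun p hp => ?_⟩
    rcases Finset.mem_insert.1 hp with rfl | hp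
    · exact (min_le_right _ _).trans_lt (by linarith)
    · exact (min_le_left _ _).trans_lt (h2 p hp)

/-- Room for new layers: the factor `2` lets two distinct heights each move by up to `δ` and keep
their order. -/
theorem LayerOrder.exists_gap {N : ℕ} {f h : ℕ → ℝ} (H : LayerOrder N f h) :
    ∃ δ > 0, ∀ j ≤ N, ∀ j' ≤ N, j ≠ j' → h j + 2 * δ < h j' ∨ h j' + 2 * δ < h j := by
  obtain ⟨δ, h1, h2⟩ := exists_pos_lt_of_finset
    (((Finset.range (N + 1)) ×ˢ (Finset.range (N + 1))).filter fun p => p.1 ≠ p.2)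
    (fun p => |h p.1 - h p.2| / 2) (by
      intro p hp
      simp only [Finset.mem_filter, Finset.mem_product, Finset.mem_range] at hp
      have : h p.1 - h p.2 ≠ 0 := fun e =>
        hp.2 (H.inj _ (by omega) _ (by omega) (sub_eq_zero.1 e))
      positivity)
  refine ⟨δ, h1, fun j hj j' hj' hne => ?_⟩
  have := h2 (j, j') (by
    simp only [Finset.mem_filter, Finset.mem_product, Finset.mem_range]
    exact ⟨⟨by omega, by omega⟩, hne⟩)
  simp only at this
  rcases abs_cases (h j - h j') with ⟨e, _⟩ | ⟨e, _⟩ <;> rw [e] at this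
  · right; linarith
  · left; linarith

namespace Crimp

/-- The segment, after the crimp, which contains segment `k`. -/
def merge (i k : ℕ) : ℕ := if k ≤ i then k else if k ≤ i + 2 then i else k - 2

theorem eq_or_of_merge_eq {i k m : ℕ} (e : merge i k = merge i m) :
    m = k ∨ ((i ≤ k ∧ k ≤ i + 2) ∧ (i ≤ m ∧ m ≤ i + 2)) := by
  unfold merge at e
  split_ifs at e <;> omega

/-- Every crease other than the two new ones comes from a crease `k₀` of the merged chain, at the
same position and facing the same side, since indices shift by `0` or `2`. -/
theorem exists_skipCrease {M i k : ℕ} (hiM : i ≤ M) (hk : k < M + 2) (h1 : k ≠ i)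
    (h2 : k ≠ i + 1) : ∃ k₀ < M, merge i k = k₀ ∧ merge i (k + 1) = k₀ + 1 ∧
      skipPoint i (k₀ + 1) = k + 1 ∧ k₀ % 2 = k % 2 := by
  refine ⟨merge i k, ?_, rfl, ?_, ?_, ?_⟩ <;> unfold merge <;> try unfold skipPoint
  all_goals split_ifs <;> omega

/-- Heights that split the layer of the merged segment `i` in three. -/
noncomputable def splitHeight (g : ℕ → ℝ) (δ : ℝ) (i k : ℕ) : ℝ :=
  if k = i then g i - δ else if k = i + 2 then g i + δ else g (merge i k)

section

variable {M i : ℕ} {f g : ℕ → ℝ} {δ : ℝ} (hiM : i ≤ M) (hδ : 0 < δ)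
  (hgap : ∀ j ≤ M, ∀ j' ≤ M, j ≠ j' → g j + 2 * δ < g j' ∨ g j' + 2 * δ < g j)

include hδ in
theorem splitHeight_bounds (k : ℕ) :
    g (merge i k) - δ ≤ splitHeight g δ i k ∧ splitHeight g δ i k ≤ g (merge i k) + δ := by
  unfold splitHeight
  split_ifs with h1 h2
  · have : merge i k = i := by unfold merge; split_ifs <;> omega
    rw [this]; constructor <;> linarith
  · have : merge i k = i := by unfold merge; split_ifs <;> omega
    rw [this]; constructor <;> linarith
  · constructor <;> linarith

include hiM in
theorem merge_le {k : ℕ} (hk : k ≤ M + 2) : merge i k ≤ M := by unfold merge; split_ifs <;> omega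

include hiM hδ hgap

theorem splitHeight_gap {k l : ℕ} (hk : k ≤ M + 2) (hl : l ≤ M + 2)
    (hne : merge i k ≠ merge i l) :
    (g (merge i k) < g (merge i l) ∧ splitHeight g δ i k < splitHeight g δ i l) ∨
    (g (merge i l) < g (merge i k) ∧ splitHeight g δ i l < splitHeight g δ i k) := by
  have h1 := splitHeight_bounds (g := g) (i := i) hδ k
  have h2 := splitHeight_bounds (g := g) (i := i) hδ l
  rcases hgap _ (merge_le hiM hk) _ (merge_le hiM hl) hne with h | h
  · left; constructor <;> linarith
  · right; constructor <;> linarith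

theorem between_splitHeight_iff {k l m : ℕ} (hk : k ≤ M + 2) (hl : l ≤ M + 2) (hm : m ≤ M + 2)
    (hkm : merge i k ≠ merge i m) (hlm : merge i l ≠ merge i m) :
    Between (splitHeight g δ i k) (splitHeight g δ i l) (splitHeight g δ i m) ↔
    Between (g (merge i k)) (g (merge i l)) (g (merge i m)) := by
  have h1 := splitHeight_gap hiM hδ hgap hk hm hkm
  have h2 := splitHeight_gap hiM hδ hgap hl hm hlm
  unfold Between
  grind

/-- The three new layers `g i - δ`, `g i`, `g i + δ` are consecutive in the stacking. -/
theorem not_between_splitHeight {k m : ℕ} (hk : k = i ∨ k = i + 1) (hm : m ≤ M + 2) :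
    ¬ Between (splitHeight g δ i k) (splitHeight g δ i (k + 1)) (splitHeight g δ i m) := by
  have e0 : splitHeight g δ i i = g i - δ := by unfold splitHeight; grind
  have e1 : splitHeight g δ i (i + 1) = g i := by
    have : merge i (i + 1) = i := by unfold merge; split_ifs <;> omega
    unfold splitHeight; grind
  have e2 : splitHeight g δ i (i + 2) = g i + δ := by unfold splitHeight; grind
  have hb := splitHeight_bounds (g := g) (i := i) hδ m
  have hm' : merge i m ≠ i → g (merge i m) + 2 * δ < g i ∨ g i + 2 * δ < g (merge i m) :=
    hgap _ (merge_le hiM hm) _ hiM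
  by_cases hmi : merge i m = i
  · have : m = i ∨ m = i + 1 ∨ m = i + 2 := by unfold merge at hmi; split_ifs at hmi <;> omega
    unfold Between
    rcases hk with rfl | rfl <;> rcases this with rfl | rfl | rfl <;> grind
  · have hm' := hm' hmi
    unfold Between
    rcases hk with rfl | rfl <;> grind

set_option maxHeartbeats 800000 in
theorem layerOrder_splitHeight
    (zig : ∀ j ≤ M + 2, (j % 2 = i % 2 → f j < f (j + 1)) ∧ (j % 2 ≠ i % 2 → f (j + 1) < f j))
    (h02 : f i ≤ f (i + 2)) (h13 : f (i + 1) ≤ f (i + 3))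
    (H : LayerOrder M (fun k => f (skipPoint i k)) g) :
    LayerOrder (M + 2) f (splitHeight g δ i) := by
  have hxy : f (i + 2) < f (i + 1) := (zig (i + 1) (by omega)).2 (by omega)
  have z1 : f i < f (i + 1) := (zig i (by omega)).1 rfl
  have z3 : f (i + 2) < f (i + 3) := (zig (i + 2) (by omega)).1 (by omega)
  have e0 : splitHeight g δ i i = g i - δ := by unfold splitHeight; grind
  have e1 : splitHeight g δ i (i + 1) = g i := by
    have : merge i (i + 1) = i := by unfold merge; split_ifs <;> omega
    unfold splitHeight; grind
  have e2 : splitHeight g δ i (i + 2) = g i + δ := by unfold splitHeight; grind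
  constructor
  · intro j hj j' hj' he
    have hm : merge i j = merge i j' := by
      by_contra hne
      have := splitHeight_gap hiM hδ hgap hj hj' hne
      grind
    by_cases h1 : merge i j = i
    · have h2 : j = i ∨ j = i + 1 ∨ j = i + 2 := by unfold merge at h1; split_ifs at h1 <;> omega
      have h3 : j' = i ∨ j' = i + 1 ∨ j' = i + 2 := by rw [hm] at h1; unfold merge at h1; split_ifs at h1 <;> omega
      rcases h2 with rfl | rfl | rfl <;> rcases h3 with rfl | rfl | rfl <;> grind
    · have := eq_or_of_merge_eq hm
      unfold merge at h1; split_ifs at h1 <;> omega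
  · intro k hk j hj hz hb
    by_cases hk0 : k = i ∨ k = i + 1
    · exact not_between_splitHeight hiM hδ hgap hk0 hj hb
    push Not at hk0
    obtain ⟨k₀, hk₀, m1, m2, m3, -⟩ := exists_skipCrease hiM hk hk0.1 hk0.2
    -- If `j` and `k` belong to the same merged segment, then `j = k`, which is not strictly
    -- between, or `k` is the last of the three and its crease is at `f (i + 3)`, which the other
    -- two do not pass. The left end `f i` is symmetric.
    have hne1 : merge i k ≠ merge i j := by
      intro e
      have : j = k ∨ (k = i + 2 ∧ (j = i ∨ j = i + 1)) := by have := eq_or_of_merge_eq e; omega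
      clear hgap zig
      rcases this with rfl | ⟨rfl, rfl | rfl⟩
      · rcases hb with hb | hb <;> linarith
      · rcases hz with hz | hz <;> linarith
      · rcases hz with hz | hz <;> linarith
    have hne2 : merge i (k + 1) ≠ merge i j := by
      intro e
      have : j = k + 1 ∨ (k + 1 = i ∧ (j = i + 1 ∨ j = i + 2)) := by
        have := eq_or_of_merge_eq e; omega
      clear hgap zig
      rcases this with rfl | ⟨e', rfl | rfl⟩
      · rcases hb with hb | hb <;> linarith
      · rw [e'] at hz
        rcases hz with hz | hz <;> linarith
      · rw [e'] at hz
        rcases hz with hz | hz <;> linarith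
    rw [between_splitHeight_iff hiM hδ hgap (by omega) (by omega) hj hne1 hne2, m1, m2] at hb
    refine H.crease_segment k₀ hk₀ _ (merge_le hiM hj) ?_ hb
    simp only [m3]
    rcases lt_or_ge j i with hji | hji
    · have : skipPoint i (merge i j) = j ∧ skipPoint i (merge i j + 1) = j + 1 := by
        unfold merge skipPoint; split_ifs <;> omega
      rwa [this.1, this.2]
    · rcases lt_or_ge (i + 2) j with hji' | hji'
      · have : skipPoint i (merge i j) = j ∧ skipPoint i (merge i j + 1) = j + 1 := by
          unfold merge skipPoint; split_ifs <;> omega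
        rwa [this.1, this.2]
      -- Each of the three segments is contained in the merged one, so what crosses it also crosses
      -- the merged segment.
      · have : skipPoint i (merge i j) = i ∧ skipPoint i (merge i j + 1) = i + 3 := by
          unfold merge skipPoint; split_ifs <;> omega
        rw [this.1, this.2]
        have h3 : j = i ∨ j = i + 1 ∨ j = i + 2 := by omega
        clear hgap zig
        left
        rcases h3 with rfl | rfl | rfl <;> rcases hz with hz | hz <;>
          constructor <;> linarith
  · intro k hk k' hk' hne hz hp
    by_cases hk0 : k = i ∨ k = i + 1
    · exact iff_of_false (not_between_splitHeight hiM hδ hgap hk0 (by omega))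
        (not_between_splitHeight hiM hδ hgap hk0 (by omega))
    push Not at hk0
    obtain ⟨k₀, hk₀, m1, m2, m3, m4⟩ := exists_skipCrease hiM hk hk0.1 hk0.2
    have key : ∀ m ≤ M + 2, m ≠ k → m ≠ k + 1 →
        ¬ (k = i + 2 ∧ (m = i ∨ m = i + 1)) → ¬ (k + 1 = i ∧ (m = i + 1 ∨ m = i + 2)) →
        (Between (splitHeight g δ i k) (splitHeight g δ i (k + 1)) (splitHeight g δ i m) ↔
        Between (g k₀) (g (k₀ + 1)) (g (merge i m))) := by
      intro m hm h1 h2 h3 h4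
      have hne1 : merge i k ≠ merge i m := by
        intro e; have := eq_or_of_merge_eq e; omega
      have hne2 : merge i (k + 1) ≠ merge i m := by
        intro e; have := eq_or_of_merge_eq e; omega
      rw [between_splitHeight_iff hiM hδ hgap (by omega) (by omega) hm hne1 hne2, m1, m2]
    by_cases hk1 : k' = i ∨ k' = i + 1
    -- Here crease `k` uses one of the outer new layers, and parity forces `k'` to be the new crease
    -- between the other two. These two layers lie on the same side of the outer one, within `2 * δ`
    -- of it, so they are both between the layers of `k` or both not.
    · by_cases hs : k = i + 2
      · have hk1 : k' = i := by omega
        subst hs hk1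
        have := hgap (k' + 1) (by omega) k' (by omega) (by omega)
        have e3 : merge k' (k' + 2 + 1) = k' + 1 := by unfold merge; split_ifs <;> omega
        have hb := splitHeight_bounds (g := g) (i := k') hδ (k' + 2 + 1)
        rw [e3] at hb
        unfold Between
        grind
      by_cases hs' : k + 1 = i
      · have hk1 : k' = i + 1 := by omega
        subst hs' hk1
        have := hgap k (by omega) (k + 1) (by omega) (by omega)
        have e3 : merge (k + 1) k = k := by unfold merge; split_ifs <;> omega
        have hb := splitHeight_bounds (g := g) (i := k + 1) hδ k
        rw [e3] at hb
        unfold Between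
        grind
      rw [key k' (by omega) (by omega) (by omega) (by omega) (by omega),
        key (k' + 1) (by omega) (by omega) (by omega) (by omega) (by omega)]
      have : merge i k' = i ∧ merge i (k' + 1) = i := by unfold merge; split_ifs <;> omega
      rw [this.1, this.2]
    · push Not at hk1
      obtain ⟨k₁, hk₁, n1, n2, n3, n4⟩ := exists_skipCrease hiM hk' hk1.1 hk1.2
      have hk01 : k₀ ≠ k₁ := by intro e; rw [e] at m3; omega
      -- The creases at the two ends of the merged segment are at distinct positions, because `f i <
      -- f (i + 3)`.
      have hex : ¬ (k + 1 = i ∧ k' = i + 2) := by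
        rintro ⟨h1, h2⟩
        subst h2
        rw [h1] at hz
        have : f i < f (i + 2 + 1) := by linarith
        linarith
      have hex' : ¬ (k = i + 2 ∧ k' + 1 = i) := by
        rintro ⟨h1, h2⟩
        subst h1
        rw [h2] at hz
        have : f i < f (i + 2 + 1) := by linarith
        linarith
      rw [key k' (by omega) (by omega) (by omega) (by omega) (by omega),
        key (k' + 1) (by omega) (by omega) (by omega) (by omega) (by omega), n1, n2]
      exact H.crease_crease k₀ hk₀ k₁ hk₁ hk01 (by simp only [m3, n3]; exact hz) (by omega)

theorem splitHeight_lt_iff {k : ℕ} (hk : k < M) :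
    splitHeight g δ i (skipCrease i k) < splitHeight g δ i (skipCrease i k + 1) ↔
      g k < g (k + 1) := by
  have h1 : merge i (skipCrease i k) = k := by unfold merge skipCrease; split_ifs <;> omega
  have h2 : merge i (skipCrease i k + 1) = k + 1 := by unfold merge skipCrease; split_ifs <;> omega
  have := splitHeight_gap hiM hδ hgap (k := skipCrease i k) (l := skipCrease i k + 1)
    (by unfold skipCrease; grind) (by unfold skipCrease; grind) (by omega)
  rw [h1, h2] at this
  grind

end

end Crimp

/-- The proposition `D` prescribes whether the three new layers ascend or descend, so either order
of mountain and valley can be restored. Descent is obtained by turning the stacking upside down. -/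
theorem LayerOrder.uncrimp {M i : ℕ} {f g : ℕ → ℝ} (hiM : i ≤ M) (zig : Zigzag (M + 2) f)
    (short : LocallyShortest f i) (H : LayerOrder M (fun k => f (skipPoint i k)) g) (D : Prop) :
    ∃ h : ℕ → ℝ, LayerOrder (M + 2) f h ∧ (h i < h (i + 1) ↔ D) ∧ (h (i + 1) < h (i + 2) ↔ D) ∧
      ∀ k < M, (g k < g (k + 1) ↔ h (skipCrease i k) < h (skipCrease i k + 1)) := by
  have main : ∀ g : ℕ → ℝ, LayerOrder M (fun k => f (skipPoint i k)) g →
      ∃ h : ℕ → ℝ, LayerOrder (M + 2) f h ∧ h i < h (i + 1) ∧ h (i + 1) < h (i + 2) ∧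
      ∀ k < M, (g k < g (k + 1) ↔ h (skipCrease i k) < h (skipCrease i k + 1)) := by
    intro g H
    obtain ⟨δ, hδ, hgap⟩ := H.exists_gap
    have e0 : Crimp.splitHeight g δ i i = g i - δ := by unfold Crimp.splitHeight; grind
    have e1 : Crimp.splitHeight g δ i (i + 1) = g i := by
      have : Crimp.merge i (i + 1) = i := by unfold Crimp.merge; grind
      unfold Crimp.splitHeight; grind
    have e2 : Crimp.splitHeight g δ i (i + 2) = g i + δ := by unfold Crimp.splitHeight; grind
    refine ⟨Crimp.splitHeight g δ i, ?_, by linarith, by linarith,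
      fun k hk => (Crimp.splitHeight_lt_iff hiM hδ hgap hk).symm⟩
    rcases Nat.mod_two_eq_zero_or_one i with hi | hi
    · obtain ⟨h1, h2⟩ := short.1 hi
      exact Crimp.layerOrder_splitHeight hiM hδ hgap (fun j hj =>
        ⟨fun e => (zig j hj).1 (by omega), fun e => (zig j hj).2 (by omega)⟩) h1 h2 H
    · obtain ⟨h1, h2⟩ := short.2 hi
      have := (Crimp.layerOrder_splitHeight (f := fun k => -f k) hiM hδ hgap (fun j hj =>
        ⟨fun e => neg_lt_neg ((zig j hj).2 (by omega)),
          fun e => neg_lt_neg ((zig j hj).1 (by omega))⟩)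
        (neg_le_neg h1) (neg_le_neg h2) H.neg_left).neg_left
      simpa using this
  by_cases hD : D
  · obtain ⟨h, h1, h2, h3, h4⟩ := main g H
    exact ⟨h, h1, iff_of_true h2 hD, iff_of_true h3 hD, h4⟩
  · obtain ⟨h, h1, h2, h3, h4⟩ := main _ H.neg_right
    refine ⟨_, h1.neg_right, iff_of_false (by linarith) hD, iff_of_false (by linarith) hD,
      fun k hk => ?_⟩
    have := h4 k hk
    have gn : g k ≠ g (k + 1) := fun e => by
      have := H.inj _ (by omega) _ (by omega) e
      omega
    have hb : skipCrease i k + 1 ≤ M + 2 := by unfold skipCrease; grind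
    have hn : h (skipCrease i k) ≠ h (skipCrease i k + 1) := fun e => by
      have := h1.inj _ (by omega) _ (by omega) e
      omega
    grind

/-! ### End folds -/

theorem LayerOrder.tail {N : ℕ} {f h : ℕ → ℝ} (H : LayerOrder (N + 1) f h) :
    LayerOrder N (fun k => f (k + 1)) (fun k => h (k + 1)) where
  inj j hj j' hj' e := by
    have := H.inj (j + 1) (by omega) (j' + 1) (by omega) e
    omega
  crease_segment k hk j hj hz := H.crease_segment (k + 1) (by omega) (j + 1) (by omega) hz
  crease_crease k hk k' hk' hne hz hp :=
    H.crease_crease (k + 1) (by omega) (k' + 1) (by omega) (by omega) hz (by omega)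

/-- The new first segment is no longer than the next, so it fits directly above or below it:
whatever crosses it crosses its neighbour too, and the crease at the far end of the neighbour is not
in its interior. -/
theorem LayerOrder.cons {N : ℕ} {f h : ℕ → ℝ} (H : LayerOrder N (fun k => f (k + 1)) h)
    (zig : Zigzag (N + 1) f) (hle : f 2 ≤ f 0) (D : Prop) :
    ∃ g : ℕ → ℝ, LayerOrder (N + 1) f g ∧ (g 0 < g 1 ↔ D) ∧ ∀ k, g (k + 1) = h k := by
  classical
  obtain ⟨δ, hδ, hgap⟩ := H.exists_gap
  set v : ℝ := if D then h 0 - δ else h 0 + δ with hv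
  let g : ℕ → ℝ := fun k => if k = 0 then v else h (k - 1)
  have g0 : g 0 = v := rfl
  have gs : ∀ k, g (k + 1) = h k := fun k => rfl
  have z01 : f 0 < f 1 := (zig 0 (by omega)).1 rfl
  have z12 : f 2 < f 1 := (zig 1 (by omega)).2 rfl
  have hv' : (v = h 0 - δ ∨ v = h 0 + δ) := by by_cases hD : D <;> simp [hv, hD]
  have far : ∀ j ≤ N, j ≠ 0 → (h j < h 0 ∧ h j < v) ∨ (h 0 < h j ∧ v < h j) := by
    intro j hj hj0
    have := hgap j hj 0 (by omega) hj0
    grind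
  -- For every pair not using layer `0`, the new height `v` is indistinguishable from `h 0`.
  have hbt : ∀ a b, a ≤ N → b ≤ N → a ≠ 0 → b ≠ 0 →
      (Between (h a) (h b) v ↔ Between (h a) (h b) (h 0)) := by
    intro a b ha hb ha0 hb0
    have := far a ha ha0
    have := far b hb hb0
    unfold Between
    grind
  have hnb : ∀ j ≤ N, ¬ Between v (h 0) (h j) := by
    intro j hj
    by_cases hj0 : j = 0
    · subst hj0; unfold Between; grind
    · have := far j hj hj0
      unfold Between; grind
  refine ⟨g, ⟨?_, ?_, ?_⟩, ?_, gs⟩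
  · have hvn : ∀ j ≤ N, v ≠ h j := by
      intro j hj e
      by_cases hj0 : j = 0
      · subst hj0; grind
      · have := far j hj hj0; grind
    intro j hj j' hj' e
    rcases j with _ | j <;> rcases j' with _ | j'
    · rfl
    · exact absurd e (hvn j' (by omega))
    · exact absurd e.symm (hvn j (by omega))
    · rw [gs, gs] at e
      rw [H.inj _ (by omega) _ (by omega) e]
  · intro k hk j hj hz
    rcases k with _ | k
    · rw [gs, g0]
      rcases j with _ | j
      · rw [g0]; unfold Between; grind
      · rw [gs]; exact hnb j (by omega)
    · rw [gs, gs]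
      rcases j with _ | j
      · rw [g0]
        rcases k with _ | k
        · unfold Between at hz; grind
        · rw [hbt _ _ (by omega) (by omega) (by omega) (by omega)]
          refine H.crease_segment (k + 1) (by omega) 0 (by omega) ?_
          unfold Between at hz ⊢
          grind
      · rw [gs]; exact H.crease_segment k (by omega) j (by omega) hz
  · intro k hk k' hk' hne hz hp
    rcases k with _ | k
    · rw [gs, g0]
      rcases k' with _ | k'
      · omega
      · rw [gs, gs]; exact iff_of_false (hnb _ (by omega)) (hnb _ (by omega))
    · rw [gs, gs]
      rcases k' with _ | k'
      · rw [gs, g0]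
        exact hbt _ _ (by omega) (by omega) (by omega) (by omega)
      · rw [gs, gs]
        exact H.crease_crease k (by omega) k' (by omega) (by omega) hz (by omega)
  · rw [g0, show g 1 = h 0 from gs 0]
    by_cases hD : D
    · simp [hv, hD, hδ]
    · simp [hv, hD, hδ.le]

/-- The counterpart of `LayerOrder.cons` at the other end; the two alternatives in `hle` are the two
directions of the last fold. -/
theorem LayerOrder.concat {N : ℕ} {f h : ℕ → ℝ} (H : LayerOrder N f h)
    (hle : (f N ≤ f (N + 2) ∧ f (N + 2) < f (N + 1)) ∨
      (f (N + 2) ≤ f N ∧ f (N + 1) < f (N + 2))) (D : Prop) :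
    ∃ g : ℕ → ℝ, LayerOrder (N + 1) f g ∧ (g N < g (N + 1) ↔ D) ∧ ∀ k ≤ N, g k = h k := by
  classical
  obtain ⟨δ, hδ, hgap⟩ := H.exists_gap
  set v : ℝ := if D then h N + δ else h N - δ with hv
  let g : ℕ → ℝ := fun k => if k = N + 1 then v else h k
  have g0 : g (N + 1) = v := if_pos rfl
  have gs : ∀ k ≤ N, g k = h k := fun k hk => if_neg (by omega)
  have hv' : (v = h N - δ ∨ v = h N + δ) := by by_cases hD : D <;> simp [hv, hD]
  have far : ∀ j ≤ N, j ≠ N → (h j < h N ∧ h j < v) ∨ (h N < h j ∧ v < h j) := by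
    intro j hj hj0
    have := hgap j hj N (by omega) hj0
    grind
  have hbt : ∀ a b, a ≤ N → b ≤ N → a ≠ N → b ≠ N →
      (Between (h a) (h b) v ↔ Between (h a) (h b) (h N)) := by
    intro a b ha hb ha0 hb0
    have := far a ha ha0
    have := far b hb hb0
    unfold Between
    grind
  have hnb : ∀ j ≤ N, ¬ Between (h N) v (h j) := by
    intro j hj
    by_cases hj0 : j = N
    · subst hj0; unfold Between; grind
    · have := far j hj hj0
      unfold Between; grind
  refine ⟨g, ⟨?_, ?_, ?_⟩, ?_, gs⟩
  · have hvn : ∀ j ≤ N, v ≠ h j := by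
      intro j hj e
      by_cases hj0 : j = N
      · subst hj0; grind
      · have := far j hj hj0; grind
    intro j hj j' hj' e
    by_cases h1 : j = N + 1 <;> by_cases h2 : j' = N + 1
    · omega
    · subst h1; rw [g0, gs _ (by omega)] at e
      exact absurd e (hvn j' (by omega))
    · subst h2; rw [g0, gs _ (by omega)] at e
      exact absurd e.symm (hvn j (by omega))
    · rw [gs _ (by omega), gs _ (by omega)] at e
      exact H.inj _ (by omega) _ (by omega) e
  · intro k hk j hj hz
    by_cases h1 : k = N
    · subst h1
      rw [g0, gs _ le_rfl]
      by_cases h2 : j = k + 1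
      · subst h2; rw [g0]; unfold Between; grind
      · rw [gs _ (by omega)]; exact hnb j (by omega)
    · rw [gs k (by omega), gs (k + 1) (by omega)]
      by_cases h2 : j = N + 1
      · subst h2
        rw [g0]
        by_cases h3 : k + 1 = N
        · rw [h3] at hz
          unfold Between at hz; grind
        · rw [hbt _ _ (by omega) (by omega) (by omega) (by omega)]
          refine H.crease_segment k (by omega) N (by omega) ?_
          unfold Between at hz ⊢
          grind
      · rw [gs j (by omega)]; exact H.crease_segment k (by omega) j (by omega) hz
  · intro k hk k' hk' hne hz hp
    by_cases h1 : k = N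
    · subst h1
      rw [g0, gs _ le_rfl, gs k' (by omega), gs (k' + 1) (by omega)]
      exact iff_of_false (hnb _ (by omega)) (hnb _ (by omega))
    · rw [gs k (by omega), gs (k + 1) (by omega)]
      by_cases h2 : k' = N
      · subst h2
        rw [g0, gs _ le_rfl]
        refine (hbt _ _ (by omega) (by omega) (by omega) ?_).symm
        intro e
        omega
      · rw [gs k' (by omega), gs (k' + 1) (by omega)]
        exact H.crease_crease k (by omega) k' (by omega) (by omega) hz (by omega)
  · rw [g0, gs _ le_rfl]
    by_cases hD : D
    · simp [hv, hD, hδ]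
    · simp [hv, hD, hδ.le]

/-! ### A run of equal segments between longer ones -/

/-- The creases of a run of `m - 1` equal segments between longer ones do not all spiral. -/
theorem LayerOrder.not_spiral {N i m : ℕ} {f h : ℕ → ℝ} (H : LayerOrder N f h) (hm : 2 ≤ m)
    (him : i + m ≤ N)
    (hrun : ∀ j, j + 3 ≤ m → f (i + j + 3) = f (i + j + 1))
    (hfirst : Between (f i) (f (i + 1)) (f (i + 2)))
    (hlast : Between (f (i + m)) (f (i + m + 1)) (f (i + m - 1)))
    (hdir : ∀ j, j + 2 ≤ m →
      (h (i + j) < h (i + j + 1) ↔ ¬ h (i + j + 1) < h (i + j + 2))) : False := by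
  have hne : ∀ k, k < N → h k ≠ h (k + 1) := fun k hk e => by
    have := H.inj _ (by omega) _ (by omega) e
    omega
  -- Equal labels alternate up and down. The longer segment `i` forces the first turn inwards;
  -- creases at equal positions facing the same side do not interleave, so each further turn lies
  -- inside the previous one.
  have nested : ∀ j, j + 2 ≤ m → Between (h (i + j)) (h (i + j + 1)) (h (i + j + 2)) := by
    intro j
    induction j with
    | zero =>
      intro hj
      have h1 := H.crease_segment (i + 1) (by omega) i (by omega) hfirst
      have h2 := hdir 0 hj
      have h3 := hne (i + 1) (by omega)
      have h4 : h i ≠ h (i + 2) := fun e => by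
        have := H.inj _ (by omega) _ (by omega) e
        omega
      have h5 := hne i (by omega)
      simp only [add_zero] at h2 ⊢
      unfold Between at *
      grind
    | succ j ih =>
      intro hj
      have h1 := ih (by omega)
      have h2 := H.crease_crease (i + j) (by omega) (i + j + 2) (by omega) (by omega)
        (hrun j (by omega)).symm (by omega)
      have h3 := h2.1 h1
      have h4 := hdir j (by omega)
      have h5 := hdir (j + 1) (by omega)
      have h6 := hne (i + j + 2) (by omega)
      rw [show i + (j + 1) = i + j + 1 by omega] at h5 ⊢
      rw [show i + j + 1 + 1 = i + j + 2 by omega, show i + j + 1 + 2 = i + j + 3 by omega] at h5 ⊢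
      rw [show i + j + 2 + 1 = i + j + 3 by omega] at h3 h6
      unfold Between at *
      grind
  -- The innermost segment `i + m` lies between the layers of crease `i + m - 2` but, being longer
  -- than the run, passes across its position.
  have h1 := nested (m - 2) (by omega)
  rw [show i + (m - 2) + 1 = i + m - 1 by omega, show i + (m - 2) + 2 = i + m by omega] at h1
  refine H.crease_segment (i + (m - 2)) (by omega) (i + m) him ?_ ?_
  · rwa [show i + (m - 2) + 1 = i + m - 1 by omega]
  · rwa [show i + (m - 2) + 1 = i + m - 1 by omega]

/-! ### Chains as lists -/

theorem between_const_sub (t a b x : ℝ) : Between (t - a) (t - b) (t - x) ↔ Between a b x := by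
  simp [Between, and_comm, or_comm]

/-- Matches the recursion of `foldPos`: removing the first segment reflects the positions of the
rest. -/
theorem LayerOrder.of_sub {N : ℕ} {f f' h : ℕ → ℝ} (t : ℝ) (H : LayerOrder N f h)
    (hf : ∀ k ≤ N + 1, f k = t - f' k) : LayerOrder N f' h where
  inj := H.inj
  crease_segment k hk j hj hz := by
    refine H.crease_segment k hk j hj ?_
    rwa [hf j (by omega), hf (j + 1) (by omega), hf (k + 1) (by omega), between_const_sub]
  crease_crease k hk k' hk' hne hz :=
    H.crease_crease k hk k' hk' hne (by rw [hf _ (by omega), hf _ (by omega), hz])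

theorem LayerOrder.congr {N : ℕ} {f f' h h' : ℕ → ℝ} (H : LayerOrder N f h)
    (hf : ∀ k ≤ N + 1, f k = f' k) (hh : ∀ k ≤ N, h k = h' k) : LayerOrder N f' h' where
  inj j hj j' hj' e := H.inj j hj j' hj' (by rw [hh j hj, hh j' hj', e])
  crease_segment k hk j hj hz := by
    rw [← hh k (by omega), ← hh (k + 1) (by omega), ← hh j hj]
    refine H.crease_segment k hk j hj ?_
    rwa [hf j (by omega), hf (j + 1) (by omega), hf (k + 1) (by omega)]
  crease_crease k hk k' hk' hne hz hp := by
    rw [← hh k (by omega), ← hh (k + 1) (by omega), ← hh k' (by omega), ← hh (k' + 1) (by omega)]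
    exact H.crease_crease k hk k' hk' hne (by rw [hf _ (by omega), hf _ (by omega), hz]) hp

/-- The position of the `k`-th vertex of a folded chain with the given segment lengths. -/
def foldPos : List ℝ → ℕ → ℝ
  | [], _ => 0
  | _ :: _, 0 => 0
  | x :: l, k + 1 => x - foldPos l k

@[simp] theorem foldPos_zero (l : List ℝ) : foldPos l 0 = 0 := by cases l <;> rfl

@[simp] theorem foldPos_cons_succ (x : ℝ) (l : List ℝ) (k : ℕ) :
    foldPos (x :: l) (k + 1) = x - foldPos l k := rfl

theorem foldPos_succ (l : List ℝ) (k : ℕ) :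
    foldPos l (k + 1) = foldPos l k + (-1) ^ k * l.getD k 0 := by
  induction l generalizing k with
  | nil => simp [foldPos]
  | cons x l ih =>
    cases k with
    | zero => simp
    | succ k => rw [foldPos_cons_succ, ih, foldPos_cons_succ, List.getD_cons_succ]; ring

theorem foldPos_succ_even (l : List ℝ) {k : ℕ} (hk : k % 2 = 0) :
    foldPos l (k + 1) = foldPos l k + l.getD k 0 := by
  rw [foldPos_succ, (Nat.even_iff.2 hk).neg_one_pow, one_mul]

theorem foldPos_succ_odd (l : List ℝ) {k : ℕ} (hk : k % 2 = 1) :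
    foldPos l (k + 1) = foldPos l k - l.getD k 0 := by
  rw [foldPos_succ, (Nat.odd_iff.2 hk).neg_one_pow]; ring

theorem foldPos_append (l l' : List ℝ) {k : ℕ} (hk : k ≤ l.length) :
    foldPos (l ++ l') k = foldPos l k := by
  induction l generalizing k with
  | nil => simp at hk; subst hk; simp
  | cons x l ih =>
    cases k with
    | zero => simp
    | succ k => simp [ih (k := k) (by simpa using hk)]

theorem foldPos_skipPoint (l l' : List ℝ) (p q r : ℝ) (k : ℕ) :
    foldPos (l ++ p :: q :: r :: l') (skipPoint l.length k) =
      foldPos (l ++ (p - q + r) :: l') k := by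
  induction l generalizing k with
  | nil =>
    cases k with
    | zero => simp [skipPoint]
    | succ k => simp [skipPoint]; ring
  | cons x l ih =>
    cases k with
    | zero => simp [skipPoint]
    | succ k =>
      have : skipPoint (x :: l).length (k + 1) = skipPoint l.length k + 1 := by
        simp only [skipPoint, List.length_cons]; split_ifs <;> omega
      rw [this]
      simp [ih]

theorem getD_skipPoint {α : Type*} (l l' : List α) (p q r d : α) (k : ℕ) :
    (l ++ p :: q :: r :: l').getD (skipPoint l.length k) d = (l ++ p :: l').getD k d := by
  induction l generalizing k with
  | nil =>
    cases k with
    | zero => simp [skipPoint]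
    | succ k => simp [skipPoint]
  | cons x l ih =>
    cases k with
    | zero => simp [skipPoint]
    | succ k =>
      have : skipPoint (x :: l).length (k + 1) = skipPoint l.length k + 1 := by
        simp only [skipPoint, List.length_cons]; split_ifs <;> omega
      rw [this, List.cons_append, List.cons_append, List.getD_cons_succ, List.getD_cons_succ]
      exact ih k

theorem zigzag_foldPos {l : List ℝ} {N : ℕ} (hN : N < l.length) (hl : ∀ x ∈ l, 0 < x) :
    Zigzag N (foldPos l) := by
  intro j hj
  have h0 : 0 < l.getD j 0 := by
    rw [List.getD_eq_getElem _ _ (by omega)]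
    exact hl _ (List.getElem_mem _)
  constructor <;> intro h
  · rw [foldPos_succ_even l h]; linarith
  · rw [foldPos_succ_odd l h]; linarith

/-- A chain of segments, given by their lengths and the labels of the creases before them
(`true` for valley, `false` for mountain; the first label is ignored), can be folded flat. -/
def Foldable (c : List (Bool × ℝ)) : Prop :=
  ∃ h : ℕ → ℝ, LayerOrder (c.length - 1) (foldPos (c.map Prod.snd)) h ∧
    ∀ k, k + 1 < c.length →
      (h k < h (k + 1) ↔ ((c.map Prod.fst).getD (k + 1) false = true ↔ k % 2 = 0))

/-- All segments of a chain have positive length. -/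
def PosLengths {α : Type*} (c : List (α × ℝ)) : Prop := ∀ x ∈ c, 0 < x.2

theorem PosLengths.map_snd {α : Type*} {c : List (α × ℝ)} (hc : PosLengths c) :
    ∀ x ∈ c.map Prod.snd, 0 < x := by
  intro x hx
  obtain ⟨y, hy, rfl⟩ := List.mem_map.1 hx
  exact hc y hy

/-- Opposite labels at consecutive creases mean the same vertical direction, so `LayerOrder.crimp`
and `LayerOrder.uncrimp` give the two implications. All other labels keep their meaning, because
parities are preserved. -/
theorem foldable_crimp {pre suf : List (Bool × ℝ)} {u s : Bool} {p q r : ℝ}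
    (hc : PosLengths (pre ++ (u, p) :: (s, q) :: (!s, r) :: suf)) (hp : q ≤ p) (hr : q ≤ r) :
    Foldable (pre ++ (u, p) :: (s, q) :: (!s, r) :: suf) ↔
      Foldable (pre ++ (u, p - q + r) :: suf) := by
  set c := pre ++ (u, p) :: (s, q) :: (!s, r) :: suf with hcdef
  set c' := pre ++ (u, p - q + r) :: suf with hcdef'
  set M := pre.length + suf.length with hM
  have hlen : c.length = M + 3 := by simp [hcdef, hM]; omega
  have hlen' : c'.length = M + 1 := by simp [hcdef', hM]; omega
  have hiM : pre.length ≤ M := by omega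
  have zig : Zigzag (M + 2) (foldPos (c.map Prod.snd)) :=
    zigzag_foldPos (by simp [hlen]) hc.map_snd
  have hpos : (fun k => foldPos (c.map Prod.snd) (skipPoint pre.length k)) =
      foldPos (c'.map Prod.snd) := by
    funext k
    have := foldPos_skipPoint (pre.map Prod.snd) (suf.map Prod.snd) p q r k
    simpa [hcdef, hcdef'] using this
  have hlab : ∀ k, (c'.map Prod.fst).getD (k + 1) false =
      (c.map Prod.fst).getD (skipCrease pre.length k + 1) false := by
    intro k
    rw [← skipPoint_succ]
    have := getD_skipPoint (pre.map Prod.fst) (suf.map Prod.fst) u s (!s) false (k + 1)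
    simp only [List.length_map] at this
    simp only [hcdef, hcdef', List.map_append, List.map_cons]
    exact this.symm
  have l1 : (c.map Prod.fst).getD (pre.length + 1) false = s := by
    simp [hcdef]
  have l2 : (c.map Prod.fst).getD (pre.length + 2) false = !s := by
    simp [hcdef]
  have d0 : (c.map Prod.snd).getD pre.length 0 = p := by simp [hcdef]
  have d1 : (c.map Prod.snd).getD (pre.length + 1) 0 = q := by simp [hcdef]
  have d2 : (c.map Prod.snd).getD (pre.length + 2) 0 = r := by simp [hcdef]
  have short : LocallyShortest (foldPos (c.map Prod.snd)) pre.length := by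
    constructor <;> intro h
    · have e1 := foldPos_succ_even (c.map Prod.snd) h
      have e2 := foldPos_succ_odd (c.map Prod.snd) (k := pre.length + 1) (by omega)
      have e3 := foldPos_succ_even (c.map Prod.snd) (k := pre.length + 2) (by omega)
      rw [d0] at e1; rw [d1] at e2; rw [d2] at e3
      constructor <;> linarith
    · have e1 := foldPos_succ_odd (c.map Prod.snd) h
      have e2 := foldPos_succ_even (c.map Prod.snd) (k := pre.length + 1) (by omega)
      have e3 := foldPos_succ_odd (c.map Prod.snd) (k := pre.length + 2) (by omega)
      rw [d0] at e1; rw [d1] at e2; rw [d2] at e3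
      constructor <;> linarith
  have hs : ∀ k < M, skipCrease pre.length k + 1 < M + 3 := by
    intro k hk; unfold skipCrease; split_ifs <;> omega
  have hpar : ∀ k, skipCrease pre.length k % 2 = k % 2 := by
    intro k; unfold skipCrease; split_ifs <;> omega
  -- Label and parity both flip from one crease to the next, so the direction of the step in height
  -- does not change.
  have hD : ((!s) = true ↔ (pre.length + 1) % 2 = 0) ↔ (s = true ↔ pre.length % 2 = 0) := by
    have : (pre.length + 1) % 2 = 0 ↔ ¬ pre.length % 2 = 0 := by omega
    rw [this]
    cases s <;> simp
  unfold Foldable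
  rw [hlen, hlen', show M + 3 - 1 = M + 2 by omega, show M + 1 - 1 = M by omega]
  constructor
  · rintro ⟨h, H, hd⟩
    have h1 := hd pre.length (by omega)
    have h2 := hd (pre.length + 1) (by omega)
    rw [l1] at h1
    rw [l2, hD] at h2
    obtain ⟨g, G, hg⟩ := H.crimp hiM zig short (h1.trans h2.symm)
    rw [hpos] at G
    refine ⟨g, G, fun k hk => ?_⟩
    rw [hg k (by omega), hd _ (hs k (by omega)), hlab, hpar]
  · rintro ⟨g, G, hg⟩
    rw [← hpos] at G
    obtain ⟨h, H, h1, h2, h3⟩ := G.uncrimp hiM zig short (s = true ↔ pre.length % 2 = 0)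
    refine ⟨h, H, fun k hk => ?_⟩
    by_cases hk1 : k = pre.length
    · rw [hk1, l1]; exact h1
    by_cases hk2 : k = pre.length + 1
    · rw [hk2, l2, hD]; exact h2
    obtain ⟨k₀, hk₀, e⟩ : ∃ k₀ < M, skipCrease pre.length k₀ = k := by
      rcases lt_or_ge k pre.length with h | h
      · exact ⟨k, by omega, by unfold skipCrease; split_ifs <;> omega⟩
      · exact ⟨k - 2, by omega, by unfold skipCrease; split_ifs <;> omega⟩
    rw [← e, ← h3 k₀ hk₀, hg k₀ (by omega), hlab, hpar]

/-- An end fold. A short first segment can be tucked next to the second in either direction, so the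
label `w` is irrelevant; `d` and `d'` are the ignored first labels. -/
theorem foldable_cons_iff {d d' w : Bool} {l L : ℝ} {rest : List (Bool × ℝ)}
    (hc : PosLengths ((d, l) :: (w, L) :: rest)) (hlL : l ≤ L) :
    Foldable ((d, l) :: (w, L) :: rest) ↔ Foldable ((d', L) :: rest) := by
  have zig : Zigzag (rest.length + 1)
      (foldPos (((d, l) :: (w, L) :: rest).map Prod.snd)) :=
    zigzag_foldPos (by simp) hc.map_snd
  have hn : ∀ {N : ℕ} {f h : ℕ → ℝ}, LayerOrder N f h → ∀ k < N, h k ≠ h (k + 1) :=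
    fun H k hk e => by
      have := H.inj _ (by omega) _ (by omega) e
      omega
  unfold Foldable
  simp only [List.length_cons, Nat.add_sub_cancel]
  constructor
  · rintro ⟨h, H, hd⟩
    -- Without the first segment every parity changes; negating the heights restores the meaning of
    -- the labels.
    have T := (H.tail.of_sub (f' := foldPos (((d', L) :: rest).map Prod.snd)) l
      (fun k _ => rfl)).neg_right
    refine ⟨_, T, fun k hk => ?_⟩
    have h1 := hd (k + 1) (by omega)
    have h2 := hn H (k + 1) (by omega)
    have h3 : (k + 1) % 2 = 0 ↔ ¬ k % 2 = 0 := by omega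
    rw [h3] at h1
    simp only [List.map_cons, List.getD_cons_succ] at h1 ⊢
    grind
  · rintro ⟨g, G, hg⟩
    have T : LayerOrder rest.length
        (fun k => foldPos (((d, l) :: (w, L) :: rest).map Prod.snd) (k + 1)) (fun k => -g k) := by
      refine (G.of_sub l fun k _ => ?_).neg_right
      simp
    obtain ⟨h, H, h1, h2⟩ := T.cons zig (by simpa using hlL) (w = true)
    refine ⟨h, H, fun k hk => ?_⟩
    cases k with
    | zero => simpa using h1
    | succ k =>
      have h3 := hg k (by omega)
      have h4 := hn G k (by omega)
      have h5 : (k + 1) % 2 = 0 ↔ ¬ k % 2 = 0 := by omega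
      rw [h2, h2, h5]
      simp only [List.map_cons, List.getD_cons_succ] at h3 ⊢
      grind

theorem foldable_singleton (x : Bool × ℝ) : Foldable [x] := by
  refine ⟨fun _ => 0, ⟨?_, ?_, ?_⟩, ?_⟩
  · intro j hj j' hj' _
    simp at hj hj'
    omega
  · intro k hk; simp at hk
  · intro k hk; simp at hk
  · intro k hk; simp at hk

theorem Foldable.concat {c : List (Bool × ℝ)} {u s : Bool} {p q : ℝ} (hq : 0 < q) (hqp : q ≤ p)
    (H : Foldable (c ++ [(u, p)])) : Foldable (c ++ [(u, p), (s, q)]) := by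
  obtain ⟨h, H, hd⟩ := H
  simp only [List.length_append, List.length_cons, List.length_nil] at H hd
  set l := (c ++ [(u, p), (s, q)]).map Prod.snd with hl
  have hl' : l = (c ++ [(u, p)]).map Prod.snd ++ [q] := by simp [hl]
  have d0 : l.getD c.length 0 = p := by simp [hl]
  have d1 : l.getD (c.length + 1) 0 = q := by simp [hl]
  have H' : LayerOrder c.length (foldPos l) h := by
    refine H.congr (fun k hk => ?_) fun _ _ => rfl
    rw [hl', foldPos_append]
    simpa using hk
  obtain ⟨g, G, h1, h2⟩ := H'.concat (by
    rcases Nat.mod_two_eq_zero_or_one c.length with h | h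
    · have e1 := foldPos_succ_even l h
      have e2 := foldPos_succ_odd l (k := c.length + 1) (by omega)
      left
      constructor <;> linarith
    · have e1 := foldPos_succ_odd l h
      have e2 := foldPos_succ_even l (k := c.length + 1) (by omega)
      right
      constructor <;> linarith) (s = true ↔ c.length % 2 = 0)
  have hlen : (c ++ [(u, p), (s, q)]).length - 1 = c.length + 1 := by simp
  refine ⟨g, by rw [hlen]; exact G, fun k hk => ?_⟩
  simp only [List.length_append, List.length_cons, List.length_nil] at hk
  by_cases hkc : k = c.length
  · subst hkc
    simpa using h1
  · rw [h2 k (by omega), h2 (k + 1) (by omega), hd k (by omega)]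
    have : (List.map Prod.fst (c ++ [(u, p), (s, q)])) =
        List.map Prod.fst (c ++ [(u, p)]) ++ [s] := by simp
    rw [this, List.getD_append _ _ _ _ (by simp; omega)]

/-- There are `m + 1 ≥ 2` creases of the same label around the `m` short segments, which is the
spiral excluded by `LayerOrder.not_spiral`. -/
theorem not_foldable_replicate {pre suf : List (Bool × ℝ)} {u s : Bool} {p q r : ℝ} {m : ℕ}
    (hm : 1 ≤ m) (hq : 0 < q) (hp : q < p) (hr : q < r) :
    ¬ Foldable (pre ++ (u, p) :: (List.replicate m (s, q) ++ (s, r) :: suf)) := by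
  rintro ⟨h, H, hd⟩
  set c := pre ++ (u, p) :: (List.replicate m (s, q) ++ (s, r) :: suf) with hc
  have hlen : c.length = pre.length + m + 2 + suf.length := by simp [hc]; omega
  set i := pre.length with hi
  set l := c.map Prod.snd with hl
  have d0 : l.getD i 0 = p := by simp [hl, hc, hi]
  have d1 : ∀ j, 1 ≤ j → j ≤ m → l.getD (i + j) 0 = q := by
    intro j h1 h2
    obtain ⟨j, rfl⟩ := Nat.exists_eq_add_of_le' h1
    have : l = (pre.map Prod.snd ++ [p]) ++ (List.replicate m q ++ r :: suf.map Prod.snd) := by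
      simp [hl, hc]
    rw [this, List.getD_append_right _ _ _ _ (by simp [hi])]
    simp only [List.length_append, List.length_map, List.length_cons, List.length_nil]
    rw [show i + (j + 1) - (pre.length + (0 + 1)) = j by omega,
      List.getD_append _ _ _ _ (by simp; omega), List.getD_replicate _ (by omega)]
  have d2 : l.getD (i + m + 1) 0 = r := by
    have : l = (pre.map Prod.snd ++ p :: List.replicate m q) ++ r :: suf.map Prod.snd := by
      simp [hl, hc]
    rw [this, List.getD_append_right _ _ _ _ (by simp [hi]; omega)]
    simp only [List.length_append, List.length_map, List.length_cons, List.length_replicate]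
    rw [show i + m + 1 - (pre.length + (m + 1)) = 0 by omega]
    simp
  have hs : ∀ j, 1 ≤ j → j ≤ m + 1 → (c.map Prod.fst).getD (i + j) false = s := by
    intro j h1 h2
    obtain ⟨j, rfl⟩ := Nat.exists_eq_add_of_le' h1
    have : c.map Prod.fst = (pre.map Prod.fst ++ [u]) ++
        (List.replicate (m + 1) s ++ suf.map Prod.fst) := by
      simp [hc, List.replicate_succ']
    rw [this, List.getD_append_right _ _ _ _ (by simp [hi])]
    simp only [List.length_append, List.length_map, List.length_cons, List.length_nil]
    rw [show i + (j + 1) - (pre.length + (0 + 1)) = j by omega,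
      List.getD_append _ _ _ _ (by simp; omega), List.getD_replicate _ (by omega)]
  have step := fun k => foldPos_succ_even l (k := k)
  have step' := fun k => foldPos_succ_odd l (k := k)
  refine H.not_spiral (i := i) (m := m + 1) (by omega) (by omega) ?_ ?_ ?_ ?_
  · intro j hj
    have e1 := d1 (j + 1) (by omega) (by omega)
    have e2 := d1 (j + 2) (by omega) (by omega)
    rw [← add_assoc] at e1 e2
    rcases Nat.mod_two_eq_zero_or_one (i + j) with h | h
    · have h1 := step' (i + j + 1) (by omega)
      have h2 := step (i + j + 2) (by omega)
      linarith
    · have h1 := step (i + j + 1) (by omega)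
      have h2 := step' (i + j + 2) (by omega)
      linarith
  · have e1 := d1 1 le_rfl hm
    rcases Nat.mod_two_eq_zero_or_one i with h | h
    · have h1 := step i h
      have h2 := step' (i + 1) (by omega)
      left; constructor <;> linarith
    · have h1 := step' i h
      have h2 := step (i + 1) (by omega)
      right; constructor <;> linarith
  · have e1 := d1 m hm le_rfl
    rw [show i + (m + 1) - 1 = i + m by omega, ← add_assoc]
    rcases Nat.mod_two_eq_zero_or_one (i + m) with h | h
    · have h1 := step (i + m) h
      have h2 := step' (i + m + 1) (by omega)
      right; constructor <;> linarith
    · have h1 := step' (i + m) h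
      have h2 := step (i + m + 1) (by omega)
      left; constructor <;> linarith
  · intro j hj
    have h1 := hd (i + j) (by omega)
    have h2 := hd (i + j + 1) (by omega)
    have e1 := hs (j + 1) (by omega) (by omega)
    have e2 := hs (j + 2) (by omega) (by omega)
    rw [← add_assoc] at e1 e2
    rw [e1] at h1
    rw [show i + j + 1 + 1 = i + j + 2 by omega, e2] at h2
    have h3 : (i + j + 1) % 2 = 0 ↔ ¬ (i + j) % 2 = 0 := by omega
    rw [h3] at h2
    rw [h1, h2]
    tauto

/-! ### Runs of equal segments -/

/-- Creases with labels `C`, followed by segments of length `q`, the last one by a segment of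
length `r`. -/
def crun {α : Type*} (q : ℝ) (C : List α) (r : ℝ) : List (α × ℝ) :=
  C.dropLast.map (·, q) ++ C.getLast?.toList.map (·, r)

@[simp] theorem crun_nil {α : Type*} (q r : ℝ) : crun q ([] : List α) r = [] := rfl

@[simp] theorem crun_concat {α : Type*} (q r : ℝ) (C : List α) (w : α) :
    crun q (C ++ [w]) r = C.map (·, q) ++ [(w, r)] := by
  simp [crun]

@[simp] theorem crun_singleton {α : Type*} (q r : ℝ) (w : α) : crun q [w] r = [(w, r)] := rfl

@[simp] theorem crun_length {α : Type*} (q r : ℝ) (C : List α) : (crun q C r).length = C.length := by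
  rcases List.eq_nil_or_concat' C with rfl | ⟨D, w, rfl⟩ <;> simp

theorem eq_replicate_or_exists_adjacent (C : List Bool) :
    (∃ m s, C = List.replicate m s) ∨ ∃ D b E, C = D ++ b :: (!b) :: E := by
  induction C with
  | nil => exact Or.inl ⟨0, true, rfl⟩
  | cons x C ih =>
    rcases ih with ⟨m, s, rfl⟩ | ⟨D, b, E, rfl⟩
    · cases m with
      | zero => exact Or.inl ⟨1, x, rfl⟩
      | succ m =>
        by_cases h : s = x
        · subst h; exact Or.inl ⟨m + 2, s, rfl⟩
        · refine Or.inr ⟨[], x, List.replicate m s, ?_⟩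
          have : s = !x := by cases s <;> cases x <;> simp_all
          simp [List.replicate_succ, this]
    · exact Or.inr ⟨x :: D, b, E, rfl⟩

theorem PosLengths.append {α : Type*} {c c' : List (α × ℝ)} :
    PosLengths (c ++ c') ↔ PosLengths c ∧ PosLengths c' := by
  simp [PosLengths, or_imp, forall_and]

theorem PosLengths.cons {α : Type*} {x : α × ℝ} {c : List (α × ℝ)} :
    PosLengths (x :: c) ↔ 0 < x.2 ∧ PosLengths c := by
  simp [PosLengths]

theorem posLengths_map {α : Type*} {q : ℝ} {C : List α} (hq : 0 < q) :
    PosLengths (C.map (·, q)) := by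
  intro x hx
  obtain ⟨y, _, rfl⟩ := List.mem_map.1 hx
  exact hq

/-- One crimp of a segment of length `q` that has a segment of length `q` beside it: the merged
segment has the length of the other neighbour. A remaining crease guarantees such a neighbour; the
cases are whether the pair is last, first or in the interior of the run. -/
theorem foldable_crun_adjacent {pre suf : List (Bool × ℝ)} {D' E' : List Bool} {u b : Bool}
    {p q r : ℝ} (hpre : PosLengths pre)
    (hsuf : PosLengths suf) (hq : 0 < q) (hp : q < p) (hr : q < r) (hne : D' ++ E' ≠ []) :
    Foldable (pre ++ (u, p) :: (crun q (D' ++ b :: (!b) :: E') r ++ suf)) ↔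
      Foldable (pre ++ (u, p) :: (crun q (D' ++ E') r ++ suf)) := by
  have hp0 : 0 < p := hq.trans hp
  have hr0 : 0 < r := hq.trans hr
  rcases List.eq_nil_or_concat' E' with rfl | ⟨F, y, rfl⟩
  · rcases List.eq_nil_or_concat' D' with rfl | ⟨G, x, rfl⟩
    · simp at hne
    have h1 : pre ++ (u, p) :: (crun q ((G ++ [x]) ++ [b, !b]) r ++ suf) =
        (pre ++ (u, p) :: G.map (·, q)) ++ (x, q) :: (b, q) :: (!b, r) :: suf := by
      rw [show (G ++ [x]) ++ [b, !b] = (G ++ [x, b]) ++ [!b] by simp, crun_concat]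
      simp
    have h2 : pre ++ (u, p) :: (crun q ((G ++ [x]) ++ []) r ++ suf) =
        (pre ++ (u, p) :: G.map (·, q)) ++ (x, q - q + r) :: suf := by
      rw [List.append_nil, crun_concat]
      simp
    rw [h1, h2]
    refine foldable_crimp ?_ le_rfl hr.le
    simp only [PosLengths.append, PosLengths.cons]
    exact ⟨⟨hpre, hp0, posLengths_map hq⟩, hq, hq, hr0, hsuf⟩
  · have hS : PosLengths (F.map (·, q) ++ (y, r) :: suf) := by
      simp only [PosLengths.append, PosLengths.cons]
      exact ⟨posLengths_map hq, hr0, hsuf⟩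
    rcases List.eq_nil_or_concat' D' with rfl | ⟨G, x, rfl⟩
    · have h1 : pre ++ (u, p) :: (crun q ([] ++ b :: (!b) :: (F ++ [y])) r ++ suf) =
          pre ++ (u, p) :: (b, q) :: (!b, q) :: (F.map (·, q) ++ (y, r) :: suf) := by
        rw [show [] ++ b :: (!b) :: (F ++ [y]) = (b :: (!b) :: F) ++ [y] by simp, crun_concat]
        simp
      have h2 : pre ++ (u, p) :: (crun q ([] ++ (F ++ [y])) r ++ suf) =
          pre ++ (u, p - q + q) :: (F.map (·, q) ++ (y, r) :: suf) := by
        rw [List.nil_append, crun_concat]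
        simp
      rw [h1, h2]
      refine foldable_crimp ?_ hp.le le_rfl
      simp only [PosLengths.append, PosLengths.cons] at hS ⊢
      exact ⟨hpre, hp0, hq, hq, hS⟩
    · have h1 : pre ++ (u, p) :: (crun q ((G ++ [x]) ++ b :: (!b) :: (F ++ [y])) r ++ suf) =
          (pre ++ (u, p) :: G.map (·, q)) ++ (x, q) :: (b, q) :: (!b, q) ::
            (F.map (·, q) ++ (y, r) :: suf) := by
        rw [show (G ++ [x]) ++ b :: (!b) :: (F ++ [y]) = (G ++ x :: b :: (!b) :: F) ++ [y] by simp,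
          crun_concat]
        simp
      have h2 : pre ++ (u, p) :: (crun q ((G ++ [x]) ++ (F ++ [y])) r ++ suf) =
          (pre ++ (u, p) :: G.map (·, q)) ++ (x, q - q + q) ::
            (F.map (·, q) ++ (y, r) :: suf) := by
        rw [show (G ++ [x]) ++ (F ++ [y]) = (G ++ x :: F) ++ [y] by simp, crun_concat]
        simp
      rw [h1, h2]
      refine foldable_crimp ?_ le_rfl le_rfl
      simp only [PosLengths.append, PosLengths.cons] at hS ⊢
      exact ⟨⟨hpre, hp0, posLengths_map hq⟩, hq, hq, hq, hS⟩

/-- Cancelling an adjacent pair of opposite labels lowers both counts by one, so induction on the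
number of creases ends with a constant word or with a last opposite pair. A constant word of two or
more creases cannot fold, and its counts differ by at least two. -/
theorem foldable_crun_iff {pre suf : List (Bool × ℝ)} {u : Bool} {p q r : ℝ}
    (hpre : PosLengths pre) (hsuf : PosLengths suf) (hq : 0 < q) (hp : q < p) (hr : q < r)
    (C : List Bool) (hC : C ≠ []) :
    Foldable (pre ++ (u, p) :: (crun q C r ++ suf)) ↔
      (∃ w, C.count w = C.count (!w) + 1 ∧ Foldable (pre ++ (u, p) :: (w, r) :: suf)) ∨
      (C.count true = C.count false ∧ Foldable (pre ++ (u, p - q + r) :: suf)) := by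
  induction hn : C.length using Nat.strong_induction_on generalizing C with
  | _ n ih =>
    rcases eq_replicate_or_exists_adjacent C with ⟨m, s, rfl⟩ | ⟨D, b, E, rfl⟩
    · have hm : m ≠ 0 := by rintro rfl; simp at hC
      have hcount : ∀ w, (List.replicate m s).count w = if s = w then m else 0 := by
        intro w; rw [List.count_replicate]; simp
      by_cases hm1 : m = 1
      · subst hm1
        simp only [List.replicate_one, crun_singleton, List.singleton_append]
        constructor
        · intro h; exact Or.inl ⟨s, by cases s <;> simp, h⟩
        · rintro (⟨w, h1, h2⟩ | ⟨h1, h2⟩)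
          · have : s = w := by revert h1; cases s <;> cases w <;> simp
            rwa [this]
          · revert h1; cases s <;> simp
      · obtain ⟨k, rfl⟩ : ∃ k, m = k + 2 := ⟨m - 2, by omega⟩
        refine iff_of_false ?_ ?_
        · rw [List.replicate_succ', crun_concat, List.map_replicate, List.append_assoc]
          exact not_foldable_replicate (by omega) hq hp hr
        · rintro (⟨w, h1, -⟩ | ⟨h1, -⟩)
          · rw [hcount, hcount] at h1
            revert h1; cases s <;> cases w <;> simp
          · rw [hcount, hcount] at h1
            revert h1; cases s <;> simp
    · by_cases hne : D ++ E = []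
      · obtain ⟨rfl, rfl⟩ := List.append_eq_nil_iff.1 hne
        have h1 : crun q ([] ++ [b, !b]) r = [(b, q), (!b, r)] := rfl
        have h2 : Foldable (pre ++ (u, p) :: (b, q) :: (!b, r) :: suf) ↔
            Foldable (pre ++ (u, p - q + r) :: suf) := by
          refine foldable_crimp ?_ hp.le hr.le
          simp only [PosLengths.append, PosLengths.cons]
          exact ⟨hpre, hq.trans hp, hq, hq.trans hr, hsuf⟩
        rw [h1]
        simp only [List.cons_append, List.nil_append]
        rw [h2]
        constructor
        · intro h; exact Or.inr ⟨by cases b <;> simp, h⟩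
        · rintro (⟨w, h1, -⟩ | ⟨-, h⟩)
          · revert h1; cases b <;> cases w <;> simp
          · exact h
      · rw [foldable_crun_adjacent hpre hsuf hq hp hr hne,
          ih (D ++ E).length (by rw [← hn]; simp) (D ++ E) hne rfl]
        have hcount : ∀ w, (D ++ b :: (!b) :: E).count w = (D ++ E).count w + 1 := by
          intro w; cases b <;> cases w <;> simp [List.count_append] <;> omega
        simp only [hcount, Nat.add_right_cancel_iff]

/-! ### Mixed chains -/

/-- The orientation `b` agrees with the label `o`. -/
def Agrees (o : Option Bool) (b : Bool) : Prop := ∀ z, o = some z → b = z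

/-- The chain `c` with its labels replaced by `B`. -/
def relabel (c : List (Option Bool × ℝ)) (B : List Bool) : List (Bool × ℝ) :=
  List.zipWith (fun x b => (b, x.2)) c B

/-- Some completion of the labels can be folded flat. -/
def MixedFoldable (c : List (Option Bool × ℝ)) : Prop :=
  ∃ B : List Bool, List.Forall₂ (fun x b => Agrees x.1 b) c B ∧ Foldable (relabel c B)

theorem forall₂_append_left_iff {α β : Type*} {R : α → β → Prop} {l₁ l₂ : List α} {m : List β} :
    List.Forall₂ R (l₁ ++ l₂) m ↔
      ∃ m₁ m₂, m = m₁ ++ m₂ ∧ List.Forall₂ R l₁ m₁ ∧ List.Forall₂ R l₂ m₂ := by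
  constructor
  · intro h
    induction l₁ generalizing m with
    | nil => exact ⟨[], m, rfl, .nil, h⟩
    | cons x l ih =>
      rw [List.cons_append] at h
      obtain ⟨b, m', hb, hm, rfl⟩ := List.forall₂_cons_left_iff.1 h
      obtain ⟨m₁, m₂, rfl, h1, h2⟩ := ih hm
      exact ⟨b :: m₁, m₂, rfl, .cons hb h1, h2⟩
  · rintro ⟨m₁, m₂, rfl, h1, h2⟩
    exact List.rel_append h1 h2

theorem relabel_append {c c' : List (Option Bool × ℝ)} {B B' : List Bool}
    (h : c.length = B.length) : relabel (c ++ c') (B ++ B') = relabel c B ++ relabel c' B' :=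
  List.zipWith_append h

theorem relabel_map {q : ℝ} {C : List (Option Bool)} {B : List Bool} (h : C.length = B.length) :
    relabel (C.map (·, q)) B = B.map (·, q) := by
  induction C generalizing B with
  | nil => cases B <;> simp_all [relabel]
  | cons x C ih =>
    cases B with
    | nil => simp at h
    | cons b B =>
      have := ih (B := B) (by simpa using h)
      simp only [relabel, List.map_cons, List.zipWith_cons_cons] at this ⊢
      rw [this]

theorem relabel_crun {q r : ℝ} {C : List (Option Bool)} {B : List Bool}
    (h : C.length = B.length) : relabel (crun q C r) B = crun q B r := by
  rcases List.eq_nil_or_concat' C with rfl | ⟨D, w, rfl⟩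
  · cases B <;> simp_all [relabel]
  · rcases List.eq_nil_or_concat' B with rfl | ⟨B, b, rfl⟩
    · simp at h
    · have h : D.length = B.length := by simpa using h
      rw [crun_concat, crun_concat, relabel_append (by simpa using h), relabel_map h]
      rfl

theorem forall₂_crun_iff {q r : ℝ} {C : List (Option Bool)} {B : List Bool} :
    List.Forall₂ (fun x b => Agrees x.1 b) (crun q C r) B ↔ List.Forall₂ Agrees C B := by
  have key : ∀ C : List (Option Bool), ∀ B, List.Forall₂ (fun x b => Agrees x.1 b)
      (C.map (·, q)) B ↔ List.Forall₂ Agrees C B := by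
    intro C B
    rw [List.forall₂_map_left_iff]
  rcases List.eq_nil_or_concat' C with rfl | ⟨D, w, rfl⟩
  · simp
  · rw [crun_concat, forall₂_append_left_iff, forall₂_append_left_iff]
    simp only [key, List.forall₂_cons_left_iff, List.forall₂_nil_left_iff]

theorem posLengths_relabel {c : List (Option Bool × ℝ)} {B : List Bool} (hc : PosLengths c) :
    PosLengths (relabel c B) := by
  intro x hx
  rw [relabel, List.mem_iff_getElem] at hx
  obtain ⟨k, hk, rfl⟩ := hx
  rw [List.getElem_zipWith]
  exact hc _ (List.getElem_mem _)

theorem count_true_add_count_false (B : List Bool) : B.count true + B.count false = B.length := by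
  induction B with
  | nil => rfl
  | cons b B ih => cases b <;> simp <;> omega

theorem count_some_add_le (C : List (Option Bool)) :
    C.count (some true) + C.count (some false) ≤ C.length := by
  induction C with
  | nil => simp
  | cons o C ih => rcases o with _ | _ | _ <;> simp <;> omega

/-- Unassigned creases contribute independently, so the valley counts of the completions fill an
interval. -/
theorem exists_completion_count_iff (C : List (Option Bool)) (j : ℕ) :
    (∃ B, List.Forall₂ Agrees C B ∧ B.count true = j) ↔
      C.count (some true) ≤ j ∧ j + C.count (some false) ≤ C.length := by
  induction C generalizing j with
  | nil => simp [eq_comm]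
  | cons o C ih =>
    have hs := count_some_add_le C
    have step : (∃ B, List.Forall₂ Agrees (o :: C) B ∧ B.count true = j) ↔
        (Agrees o true ∧ ∃ i, j = i + 1 ∧ ∃ B, List.Forall₂ Agrees C B ∧ B.count true = i) ∨
        (Agrees o false ∧ ∃ B, List.Forall₂ Agrees C B ∧ B.count true = j) := by
      constructor
      · rintro ⟨B, hB, rfl⟩
        obtain ⟨b, B, hb, hB', rfl⟩ := List.forall₂_cons_left_iff.1 hB
        cases b
        · exact Or.inr ⟨hb, B, hB', by simp⟩
        · exact Or.inl ⟨hb, _, by simp, B, hB', rfl⟩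
      · rintro (⟨hb, i, rfl, B, hB, rfl⟩ | ⟨hb, B, hB, rfl⟩)
        · exact ⟨true :: B, .cons hb hB, by simp⟩
        · exact ⟨false :: B, .cons hb hB, by simp⟩
    rw [step]
    simp only [ih]
    have a1 : Agrees none true ∧ Agrees none false := by simp [Agrees]
    have a2 : Agrees (some true) true ∧ ¬ Agrees (some true) false := by simp [Agrees]
    have a3 : ¬ Agrees (some false) true ∧ Agrees (some false) false := by simp [Agrees]
    have hj : ∀ P : ℕ → Prop, (∃ i, j = i + 1 ∧ P i) ↔ 1 ≤ j ∧ P (j - 1) := by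
      intro P
      constructor
      · rintro ⟨i, rfl, h⟩; simpa using h
      · rintro ⟨h1, h2⟩; exact ⟨j - 1, by omega, h2⟩
    rw [hj]
    rcases o with _ | _ | _
    · simp [a1]; omega
    · simp [a3]; omega
    · simp [a2]; omega

/-- The label of the crease that remains of a run of `m` creases, `m` odd, of which `a` are
labelled valley and `b` mountain. -/
def clip (a b m : ℕ) : Option Bool :=
  if m < 2 * a then some true else if m < 2 * b then some false else none

/-- The conditional is the number of valleys for which an odd run reduces to the label `w`. Hence
`clip` leaves exactly the labels that some completion produces. -/
theorem agrees_clip_iff {a b m : ℕ} (hm : m % 2 = 1) (hab : a + b ≤ m) (ha : 2 * a ≤ m + 1)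
    (hb : 2 * b ≤ m + 1) (w : Bool) :
    Agrees (clip a b m) w ↔
      a ≤ (if w then m / 2 + 1 else m / 2) ∧ (if w then m / 2 + 1 else m / 2) + b ≤ m := by
  unfold clip Agrees
  have h0 : ∀ w : Bool, ((∀ z : Bool, False → w = z) ↔ True) := by simp
  have h1 : ∀ w x : Bool, (∀ z, some x = some z → w = z) ↔ w = x := by simp
  cases w <;> simp only [Bool.false_eq_true, if_false, if_true] <;> split_ifs
  all_goals first | rw [h0] | rw [h1]
  all_goals first | omega | (simp only [reduceCtorEq, false_iff, true_iff]; omega)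

theorem mixedFoldable_append_iff {pre suf : List (Option Bool × ℝ)} {u : Option Bool} {p : ℝ} :
    MixedFoldable (pre ++ (u, p) :: suf) ↔
      ∃ B b B', List.Forall₂ (fun x b => Agrees x.1 b) pre B ∧ Agrees u b ∧
        List.Forall₂ (fun x b => Agrees x.1 b) suf B' ∧
        Foldable (relabel pre B ++ (b, p) :: relabel suf B') := by
  unfold MixedFoldable
  constructor
  · rintro ⟨B, hB, h⟩
    obtain ⟨B, B', rfl, h1, h2⟩ := forall₂_append_left_iff.1 hB
    obtain ⟨b, B', hb, h3, rfl⟩ := List.forall₂_cons_left_iff.1 h2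
    rw [relabel_append h1.length_eq] at h
    exact ⟨B, b, B', h1, hb, h3, h⟩
  · rintro ⟨B, b, B', h1, hb, h2, h⟩
    refine ⟨B ++ b :: B', List.rel_append h1 (.cons hb h2), ?_⟩
    rw [relabel_append h1.length_eq]
    exact h

theorem mixedFoldable_crun_iff {pre suf : List (Option Bool × ℝ)} {u : Option Bool} {p q r : ℝ}
    {C : List (Option Bool)} :
    MixedFoldable (pre ++ (u, p) :: (crun q C r ++ suf)) ↔
      ∃ B b C' B', List.Forall₂ (fun x b => Agrees x.1 b) pre B ∧ Agrees u b ∧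
        List.Forall₂ Agrees C C' ∧ List.Forall₂ (fun x b => Agrees x.1 b) suf B' ∧
        Foldable (relabel pre B ++ (b, p) :: (crun q C' r ++ relabel suf B')) := by
  rw [mixedFoldable_append_iff]
  constructor
  · rintro ⟨B, b, B', h1, hb, h2, h⟩
    obtain ⟨C', B', rfl, h2, h3⟩ := forall₂_append_left_iff.1 h2
    have hlen := h2.length_eq
    rw [relabel_append hlen, relabel_crun (by simpa using hlen)] at h
    exact ⟨B, b, C', B', h1, hb, forall₂_crun_iff.1 h2, h3, h⟩
  · rintro ⟨B, b, C', B', h1, hb, h2, h3, h⟩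
    refine ⟨B, b, C' ++ B', h1, hb, List.rel_append (forall₂_crun_iff.2 h2) h3, ?_⟩
    have hlen := h2.length_eq
    rw [relabel_append (by simpa using hlen), relabel_crun hlen]
    exact h

section

variable {pre suf : List (Option Bool × ℝ)} {u : Option Bool} {p q r : ℝ}
    (hpre : PosLengths pre) (hsuf : PosLengths suf) (hq : 0 < q) (hp : q < p) (hr : q < r)
    {C : List (Option Bool)}

include hpre hsuf hq hp hr

/-- An even number of creases excludes a surplus of one, so exactly `C.length / 2` of them must be
valleys. -/
theorem mixedFoldable_crun_iff_of_even (hC : C ≠ []) (hm : C.length % 2 = 0) :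
    MixedFoldable (pre ++ (u, p) :: (crun q C r ++ suf)) ↔
      (2 * C.count (some true) ≤ C.length ∧ 2 * C.count (some false) ≤ C.length) ∧
        MixedFoldable (pre ++ (u, p - q + r) :: suf) := by
  rw [mixedFoldable_crun_iff, mixedFoldable_append_iff]
  constructor
  · rintro ⟨B, b, C', B', h1, hb, h2, h3, h⟩
    have hlen := h2.length_eq
    have hcount := count_true_add_count_false C'
    have hC' : C' ≠ [] := by rintro rfl; exact hC (List.length_eq_zero_iff.1 hlen)
    rcases (foldable_crun_iff (posLengths_relabel hpre) (posLengths_relabel hsuf) hq hp hr C' hC').1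
      h with ⟨w, hw, -⟩ | ⟨hw, h⟩
    · cases w <;> simp at hw <;> omega
    · have := (exists_completion_count_iff C (C'.count true)).1 ⟨C', h2, rfl⟩
      exact ⟨by omega, B, b, B', h1, hb, h3, h⟩
  · rintro ⟨hab, B, b, B', h1, hb, h3, h⟩
    obtain ⟨C', h2, hj⟩ := (exists_completion_count_iff C (C.length / 2)).2 (by omega)
    have hlen := h2.length_eq
    have hcount := count_true_add_count_false C'
    have hC' : C' ≠ [] := by rintro rfl; exact hC (List.length_eq_zero_iff.1 hlen)
    refine ⟨B, b, C', B', h1, hb, h2, h3, ?_⟩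
    exact (foldable_crun_iff (posLengths_relabel hpre) (posLengths_relabel hsuf) hq hp hr C' hC').2
      (Or.inr ⟨by omega, h⟩)

/-- An odd number of creases must have a majority of one, and the majority label is that of the
remaining crease. -/
theorem mixedFoldable_crun_iff_of_odd (hm : C.length % 2 = 1) :
    MixedFoldable (pre ++ (u, p) :: (crun q C r ++ suf)) ↔
      (2 * C.count (some true) ≤ C.length + 1 ∧ 2 * C.count (some false) ≤ C.length + 1) ∧
        MixedFoldable (pre ++ (u, p) ::
          (clip (C.count (some true)) (C.count (some false)) C.length, r) :: suf) := by
  have hC : C ≠ [] := by rintro rfl; simp at hm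
  have hs := count_some_add_le C
  rw [mixedFoldable_crun_iff, mixedFoldable_append_iff]
  constructor
  · rintro ⟨B, b, C', B', h1, hb, h2, h3, h⟩
    have hlen := h2.length_eq
    have hcount := count_true_add_count_false C'
    have hC' : C' ≠ [] := by rintro rfl; exact hC (List.length_eq_zero_iff.1 hlen)
    have := (exists_completion_count_iff C (C'.count true)).1 ⟨C', h2, rfl⟩
    rcases (foldable_crun_iff (posLengths_relabel hpre) (posLengths_relabel hsuf) hq hp hr C' hC').1
      h with ⟨w, hw, h⟩ | ⟨hw, -⟩
    · have hw' : C'.count true = if w then C.length / 2 + 1 else C.length / 2 := by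
        cases w <;> simp at hw ⊢ <;> omega
      have hab : 2 * C.count (some true) ≤ C.length + 1 ∧
          2 * C.count (some false) ≤ C.length + 1 := by
        cases w <;> simp at hw' <;> omega
      refine ⟨hab, B, b, w :: B', h1, hb, .cons ?_ h3, h⟩
      rw [agrees_clip_iff hm hs hab.1 hab.2, ← hw']
      exact this
    · omega
  · rintro ⟨hab, B, b, B', h1, hb, h3, h⟩
    obtain ⟨w, B', hw, h4, rfl⟩ := List.forall₂_cons_left_iff.1 h3
    rw [agrees_clip_iff hm hs hab.1 hab.2] at hw
    obtain ⟨C', h2, hj⟩ := (exists_completion_count_iff C _).2 hw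
    have hlen := h2.length_eq
    have hcount := count_true_add_count_false C'
    have hC' : C' ≠ [] := by rintro rfl; exact hC (List.length_eq_zero_iff.1 hlen)
    refine ⟨B, b, C', B', h1, hb, h2, h4, ?_⟩
    exact (foldable_crun_iff (posLengths_relabel hpre) (posLengths_relabel hsuf) hq hp hr C' hC').2
      (Or.inl ⟨w, by cases w <;> simp at hj ⊢ <;> omega, h⟩)

end

theorem mixedFoldable_cons_iff {d d' w : Option Bool} {l L : ℝ} {rest : List (Option Bool × ℝ)}
    (hl : 0 < l) (hrest : PosLengths rest) (hlL : l ≤ L) :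
    MixedFoldable ((d, l) :: (w, L) :: rest) ↔ MixedFoldable ((d', L) :: rest) := by
  have hag : ∀ o, ∃ b, Agrees o b := by
    intro o
    rcases o with _ | b
    · exact ⟨true, by simp [Agrees]⟩
    · exact ⟨b, by simp [Agrees]⟩
  have pos : ∀ {b b' : Bool} {B : List Bool},
      PosLengths ((b, l) :: (b', L) :: relabel rest B) := by
    intro b b' B
    simp only [PosLengths.cons]
    exact ⟨hl, hl.trans_le hlL, posLengths_relabel hrest⟩
  constructor
  · rintro ⟨B, hB, h⟩
    obtain ⟨b, B₁, hb, hB₁, rfl⟩ := List.forall₂_cons_left_iff.1 hB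
    obtain ⟨b', B₂, hb', hB₂, rfl⟩ := List.forall₂_cons_left_iff.1 hB₁
    obtain ⟨e, he⟩ := hag d'
    exact ⟨e :: B₂, .cons he hB₂, (foldable_cons_iff pos hlL).1 h⟩
  · rintro ⟨B, hB, h⟩
    obtain ⟨b, B₁, hb, hB₁, rfl⟩ := List.forall₂_cons_left_iff.1 hB
    obtain ⟨e, he⟩ := hag d
    obtain ⟨e', he'⟩ := hag w
    exact ⟨e :: e' :: B₁, .cons he (.cons he' hB₁), (foldable_cons_iff pos hlL).2 h⟩

/-- A chain of segments of weakly decreasing lengths can be folded flat. -/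
theorem mixedFoldable_of_sorted {c : List (Option Bool × ℝ)} (hne : c ≠ []) (hc : PosLengths c)
    (hs : c.Pairwise fun x y => y.2 ≤ x.2) : MixedFoldable c := by
  have hag : ∀ o, ∃ b, Agrees o b := by
    intro o
    rcases o with _ | b
    · exact ⟨true, by simp [Agrees]⟩
    · exact ⟨b, by simp [Agrees]⟩
  induction c using List.reverseRecOn with
  | nil => exact absurd rfl hne
  | append_singleton c x ih =>
    obtain ⟨s, q⟩ := x
    obtain ⟨b, hb⟩ := hag s
    rcases List.eq_nil_or_concat' c with rfl | ⟨c, ⟨u, p⟩, rfl⟩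
    · exact ⟨[b], .cons hb .nil, foldable_singleton _⟩
    · rw [PosLengths.append] at hc
      rw [List.pairwise_append] at hs
      obtain ⟨B, hB, h⟩ := ih (by simp) hc.1 hs.1
      obtain ⟨B, B', rfl, h1, h2⟩ := forall₂_append_left_iff.1 hB
      obtain ⟨b', B', hb', h3, rfl⟩ := List.forall₂_cons_left_iff.1 h2
      rw [List.forall₂_nil_left_iff] at h3
      subst h3
      refine ⟨B ++ [b'] ++ [b], List.rel_append hB (.cons hb .nil), ?_⟩
      have e1 : relabel (c ++ [(u, p)]) (B ++ [b']) = relabel c B ++ [(b', p)] := by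
        rw [relabel_append h1.length_eq]; rfl
      have e2 : relabel (c ++ [(u, p)] ++ [(s, q)]) (B ++ [b'] ++ [b]) =
          relabel c B ++ [(b', p), (b, q)] := by
        rw [relabel_append hB.length_eq, e1]
        simp [relabel]
      rw [e1] at h
      rw [e2]
      refine h.concat (by simpa [PosLengths] using hc.2) ?_
      exact hs.2.2 (u, p) (by simp) (s, q) (by simp)

/-! ### The reduction of a mixed chain with a stack of runs -/

/-- The stack, top first, consists of runs of segments of equal length, each given by this length
and the labels of the creases before its segments. It is followed by creases `C`, separated by
segments of length `q`, a segment of length `r`, and the part of the chain not yet read. -/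
structure Config where
  stack : List (ℝ × List (Option Bool))
  C : List (Option Bool)
  q : ℝ
  r : ℝ
  rest : List (Option Bool × ℝ)

def stackChain : List (ℝ × List (Option Bool)) → List (Option Bool × ℝ)
  | [] => []
  | (l, P) :: S => stackChain S ++ P.map (·, l)

/-- Lengths grow strictly downwards, so the part already read is a weakly decreasing chain. The
bottom run is a single segment, the first of the chain: anything at least as long that meets it
absorbs it by an end fold. -/
def StackOk : List (ℝ × List (Option Bool)) → Prop
  | [] => False
  | [(l, P)] => 0 < l ∧ P.length = 1
  | (l, P) :: (l', P') :: S => 0 < l ∧ l < l' ∧ P ≠ [] ∧ StackOk ((l', P') :: S)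

namespace Config

def chain (c : Config) : List (Option Bool × ℝ) :=
  stackChain c.stack ++ (crun c.q c.C c.r ++ c.rest)

structure Ok (c : Config) : Prop where
  stack : StackOk c.stack
  rest : PosLengths c.rest
  -- With no crease in `C` both `q` and `r` are leftovers, and with one crease `q` is; hence the two
  -- premises.
  r_pos : c.C ≠ [] → 0 < c.r
  run : 2 ≤ c.C.length → 0 < c.q ∧ c.q < c.r ∧ ∀ l P S, c.stack = (l, P) :: S → c.q < l

/-- A bound for the number of steps still to be made. -/
def potential (c : Config) : ℕ :=
  -- Reading changes the sum by `-4 + 3`, pushing by `+2 - 3`, popping a run by `-2`, and discarding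
  -- the creases without pushing by `-3`.
  4 * c.rest.length + 2 * c.stack.length + if c.C = [] then 0 else 3

def label (C : List (Option Bool)) : Option Bool :=
  clip (C.count (some true)) (C.count (some false)) C.length

open Classical in
/-- One step of the reduction: a new configuration, or the answer. -/
noncomputable def step (c : Config) : Config ⊕ Bool :=
  match c.stack with
  | [] => .inr false
  | (l, P) :: S =>
    if c.C.length = 0 then
      match c.rest with
      | [] => .inr true
      | (o, x) :: rest => .inl ⟨(l, P) :: S, [o], c.q, x, rest⟩
    else if c.C.length % 2 = 0 then
      if c.C.length < 2 * c.C.count (some true) ∨ c.C.length < 2 * c.C.count (some false) then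
        .inr false
      else if S = [] then .inl ⟨[(l - c.q + c.r, P)], [], c.q, c.r, c.rest⟩
      -- The last segment of the top run has grown beyond `l`, so the creases `P` are now those of a
      -- run flanked by longer segments, ready to be reduced in turn.
      else .inl ⟨S, P, l, l - c.q + c.r, c.rest⟩
    else if c.C.length + 1 < 2 * c.C.count (some true) ∨
        c.C.length + 1 < 2 * c.C.count (some false) then .inr false
    -- One crease remains, followed by length `r`. A shorter segment starts a new run; at the bottom
    -- of the stack one at least as long as `l` allows an end fold; elsewhere a longer one closes
    -- the top run, and an equal one extends it.
    else if c.r < l then .inl ⟨(c.r, [label c.C]) :: (l, P) :: S, [], c.q, c.r, c.rest⟩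
    else if S = [] then .inl ⟨[(c.r, P)], [], c.q, c.r, c.rest⟩
    else if l < c.r then .inl ⟨S, P ++ [label c.C], l, c.r, c.rest⟩
    else .inl ⟨(l, P ++ [label c.C]) :: S, [], c.q, c.r, c.rest⟩

end Config

theorem StackOk.pos {l : ℝ} {P : List (Option Bool)} {S : List (ℝ × List (Option Bool))}
    (h : StackOk ((l, P) :: S)) : 0 < l := by
  cases S with
  | nil => exact h.1
  | cons _ _ => exact h.1

theorem StackOk.ne_nil {l : ℝ} {P : List (Option Bool)} {S : List (ℝ × List (Option Bool))}
    (h : StackOk ((l, P) :: S)) : P ≠ [] := by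
  cases S with
  | nil => rintro rfl; exact absurd h.2 (by simp)
  | cons _ _ => exact h.2.2.1

theorem StackOk.tail {x y : ℝ × List (Option Bool)} {S : List (ℝ × List (Option Bool))}
    (h : StackOk (x :: y :: S)) : StackOk (y :: S) := h.2.2.2

theorem StackOk.posLengths {S : List (ℝ × List (Option Bool))} (h : StackOk S) :
    PosLengths (stackChain S) := by
  induction S with
  | nil => exact h.elim
  | cons x S ih =>
    obtain ⟨l, P⟩ := x
    rw [stackChain, PosLengths.append]
    refine ⟨?_, posLengths_map h.pos⟩
    cases S with
    | nil => simp [stackChain, PosLengths]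
    | cons y S => exact ih h.tail

theorem StackOk.chain_ne_nil {S : List (ℝ × List (Option Bool))} (h : StackOk S) :
    stackChain S ≠ [] := by
  cases S with
  | nil => exact h.elim
  | cons x S =>
    obtain ⟨l, P⟩ := x
    simp [stackChain, h.ne_nil]

theorem StackOk.sorted {S : List (ℝ × List (Option Bool))} (h : StackOk S) :
    (stackChain S).Pairwise (fun x y => y.2 ≤ x.2) ∧
      ∀ l P S', S = (l, P) :: S' → ∀ x ∈ stackChain S, l ≤ x.2 := by
  induction S with
  | nil => exact h.elim
  | cons x S ih =>
    obtain ⟨l, P⟩ := x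
    have hmap : ∀ x ∈ P.map (·, l), x.2 = l := by
      intro x hx
      obtain ⟨y, _, rfl⟩ := List.mem_map.1 hx
      rfl
    have hmap' : (P.map (·, l)).Pairwise (fun x y => y.2 ≤ x.2) := by
      rw [List.pairwise_map]
      exact List.pairwise_of_forall fun _ _ => le_rfl
    cases S with
    | nil =>
      simp only [stackChain, List.nil_append]
      refine ⟨hmap', ?_⟩
      rintro l' P' S' e x hx
      obtain ⟨⟨rfl, rfl⟩, -⟩ := by simpa using e
      exact (hmap x hx).ge
    | cons y S =>
      obtain ⟨l', P'⟩ := y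
      obtain ⟨h1, h2⟩ := ih h.tail
      have h2 := h2 l' P' S rfl
      have hl : l < l' := h.2.1
      rw [stackChain]
      constructor
      · rw [List.pairwise_append]
        exact ⟨h1, hmap', fun x hx y hy => by rw [hmap y hy]; exact hl.le.trans (h2 x hx)⟩
      · rintro l'' P'' S' e x hx
        obtain ⟨⟨rfl, rfl⟩, -⟩ := by simpa using e
        rcases List.mem_append.1 hx with hx | hx
        · exact hl.le.trans (h2 x hx)
        · exact (hmap x hx).ge

/-- The last segment of the stack, split off. -/
theorem stackChain_cons_eq {l : ℝ} {P : List (Option Bool)} {S : List (ℝ × List (Option Bool))}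
    (h : StackOk ((l, P) :: S)) :
    ∃ D u, P = D ++ [u] ∧ stackChain ((l, P) :: S) = (stackChain S ++ D.map (·, l)) ++ [(u, l)] ∧
      PosLengths (stackChain S ++ D.map (·, l)) ∧
      ∀ r, stackChain S ++ crun l P r = (stackChain S ++ D.map (·, l)) ++ [(u, r)] := by
  rcases List.eq_nil_or_concat' P with rfl | ⟨D, u, rfl⟩
  · exact absurd rfl h.ne_nil
  · refine ⟨D, u, rfl, by simp [stackChain], ?_, by simp⟩
    have := h.posLengths
    rw [stackChain, List.map_append, ← List.append_assoc] at this
    exact (PosLengths.append.1 this).1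

/-- For a single crease there is nothing to crimp: the count conditions hold automatically and
`Config.label` returns the label itself. -/
theorem Config.mixedFoldable_chain_iff_of_odd {c : Config} (h : c.Ok)
    (hm : c.C.length % 2 = 1) :
    MixedFoldable c.chain ↔
      (2 * c.C.count (some true) ≤ c.C.length + 1 ∧ 2 * c.C.count (some false) ≤ c.C.length + 1) ∧
      MixedFoldable (stackChain c.stack ++ (Config.label c.C, c.r) :: c.rest) := by
  obtain ⟨stack, C, q, r, rest⟩ := c
  simp only [Config.chain] at *
  have hstack := h.stack
  cases stack with
  | nil => exact hstack.elim
  | cons x S =>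
    obtain ⟨l, P⟩ := x
    obtain ⟨D, u, -, e, hpos, -⟩ := stackChain_cons_eq hstack
    by_cases h2 : 2 ≤ C.length
    · obtain ⟨h1, h2, h3⟩ := h.run h2
      simp only [e, List.append_assoc, List.singleton_append]
      rw [← List.append_assoc, ← List.append_assoc]
      exact mixedFoldable_crun_iff_of_odd hpos h.rest h1 (h3 l P S rfl) h2 hm
    · obtain ⟨w, rfl⟩ := List.length_eq_one_iff.1 (show C.length = 1 by omega)
      have hw : Config.label [w] = w := by
        rcases w with _ | _ | _ <;> simp [Config.label, clip]
      have hcount : ∀ o, List.count o [w] ≤ 1 := fun o => List.count_le_length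
      rw [hw]
      simp only [crun_singleton, List.singleton_append, List.length_singleton]
      refine (and_iff_right ⟨?_, ?_⟩).symm
      · have := hcount (some true); omega
      · have := hcount (some false); omega

/-- The crimps merge the last segment of the top run with the segment of length `r`; written with
`crun`, the top run already has the form it takes when popped. -/
theorem Config.mixedFoldable_chain_iff_of_even {c : Config} (h : c.Ok) (hC : c.C ≠ [])
    (hm : c.C.length % 2 = 0) {l : ℝ} {P : List (Option Bool)}
    {S : List (ℝ × List (Option Bool))} (hS : c.stack = (l, P) :: S) :
    MixedFoldable c.chain ↔
      (2 * c.C.count (some true) ≤ c.C.length ∧ 2 * c.C.count (some false) ≤ c.C.length) ∧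
      MixedFoldable (stackChain S ++ (crun l P (l - c.q + c.r) ++ c.rest)) := by
  obtain ⟨stack, C, q, r, rest⟩ := c
  simp only at hS
  subst hS
  simp only [Config.chain] at *
  have hstack := h.stack
  obtain ⟨D, u, -, e, hpos, e'⟩ := stackChain_cons_eq hstack
  have h0 : C.length ≠ 0 := by simpa using hC
  obtain ⟨h1, h2, h3⟩ := h.run (show 2 ≤ C.length by omega)
  rw [← List.append_assoc (stackChain S), e', e]
  simp only [List.append_assoc, List.singleton_append]
  rw [← List.append_assoc, ← List.append_assoc]
  exact mixedFoldable_crun_iff_of_even hpos h.rest h1 (h3 l P S rfl) h2 hC hm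

/-- A step keeps the invariant and foldability and lowers the potential, or gives the right
answer. -/
theorem Config.step_spec {c : Config} (h : c.Ok) :
    (∀ c', c.step = .inl c' → c'.Ok ∧ (MixedFoldable c.chain ↔ MixedFoldable c'.chain) ∧
      c'.potential < c.potential) ∧
    (∀ b, c.step = .inr b → (b = true ↔ MixedFoldable c.chain)) := by
  have hodd := Config.mixedFoldable_chain_iff_of_odd h
  have heven := Config.mixedFoldable_chain_iff_of_even h
  obtain ⟨stack, C, q, r, rest⟩ := c
  have hstack := h.stack
  have hrest := h.rest
  have hr := h.r_pos
  have hrun := h.run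
  simp only at hstack hrest hr hrun hodd heven
  unfold step
  cases stack with
  | nil => exact hstack.elim
  | cons x S =>
    obtain ⟨l, P⟩ := x
    have hl := hstack.pos
    simp only
    by_cases h0 : C.length = 0
    · obtain rfl := List.length_eq_zero_iff.1 h0
      simp only [List.length_nil, if_true]
      cases rest with
      | nil =>
        refine ⟨by simp, ?_⟩
        rintro b ⟨⟩
        simp only [true_iff]
        have := mixedFoldable_of_sorted hstack.chain_ne_nil hstack.posLengths hstack.sorted.1
        simpa [Config.chain] using this
      | cons y rest =>
        obtain ⟨o, x⟩ := y
        refine ⟨?_, by simp⟩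
        rintro c' ⟨⟩
        rw [PosLengths.cons] at hrest
        refine ⟨⟨hstack, hrest.2, fun _ => hrest.1, by simp⟩, ?_, ?_⟩
        · simp [Config.chain]
        · simp [Config.potential]; omega
    have hC : C ≠ [] := by rintro rfl; simp at h0
    have hr := hr hC
    rw [if_neg h0]
    by_cases hm : C.length % 2 = 0
    · rw [if_pos hm]
      have heven := heven hC hm rfl
      have hrun := hrun (by omega)
      have hql := hrun.2.2 l P S rfl
      by_cases hab : C.length < 2 * C.count (some true) ∨ C.length < 2 * C.count (some false)
      · rw [if_pos hab]
        refine ⟨by simp, ?_⟩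
        rintro b ⟨⟩
        rw [heven]
        simp only [Bool.false_eq_true, false_iff, not_and]
        omega
      rw [if_neg hab]
      rw [and_iff_right (by omega)] at heven
      by_cases hS : S = []
      · rw [if_pos hS]
        subst hS
        refine ⟨?_, by simp⟩
        rintro c' ⟨⟩
        refine ⟨⟨⟨by linarith, hstack.2⟩, hrest, by simp, by simp⟩, ?_, ?_⟩
        · rw [heven]
          obtain ⟨w, rfl⟩ := List.length_eq_one_iff.1 hstack.2
          simp [Config.chain, stackChain]
        · simp [Config.potential, hC]
      · rw [if_neg hS]
        refine ⟨?_, by simp⟩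
        rintro c' ⟨⟩
        obtain ⟨⟨l', P'⟩, S, rfl⟩ := List.exists_cons_of_ne_nil hS
        have hll : l < l' := hstack.2.1
        refine ⟨⟨hstack.tail, hrest, fun _ => by simp only; linarith, fun _ => ⟨hl, ?_, ?_⟩⟩, ?_, ?_⟩
        · simp only; linarith
        · rintro l'' P'' S'' e
          obtain ⟨⟨rfl, rfl⟩, -⟩ := by simpa using e
          exact hll
        · rw [heven]
          rfl
        · simp [Config.potential, hC, hstack.ne_nil]
    · rw [if_neg hm]
      have hodd := hodd (by omega)
      by_cases hab : C.length + 1 < 2 * C.count (some true) ∨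
          C.length + 1 < 2 * C.count (some false)
      · rw [if_pos hab]
        refine ⟨by simp, ?_⟩
        rintro b ⟨⟩
        rw [hodd]
        simp only [Bool.false_eq_true, false_iff, not_and]
        omega
      rw [if_neg hab]
      rw [and_iff_right (by omega)] at hodd
      by_cases hrl : r < l
      · rw [if_pos hrl]
        refine ⟨?_, by simp⟩
        rintro c' ⟨⟩
        refine ⟨⟨⟨hr, hrl, by simp, hstack⟩, hrest, by simp, by simp⟩, ?_, ?_⟩
        · rw [hodd]
          simp [Config.chain, stackChain]
        · simp [Config.potential, hC]; omega
      rw [if_neg hrl]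
      by_cases hS : S = []
      · rw [if_pos hS]
        subst hS
        refine ⟨?_, by simp⟩
        rintro c' ⟨⟩
        refine ⟨⟨⟨hr, hstack.2⟩, hrest, by simp, by simp⟩, ?_, ?_⟩
        · rw [hodd]
          obtain ⟨w, rfl⟩ := List.length_eq_one_iff.1 hstack.2
          simpa [Config.chain, stackChain] using
            mixedFoldable_cons_iff hl hrest (not_lt.1 hrl)
        · simp [Config.potential, hC]
      rw [if_neg hS]
      obtain ⟨⟨l', P'⟩, S, rfl⟩ := List.exists_cons_of_ne_nil hS
      have hll : l < l' := hstack.2.1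
      by_cases hlr : l < r
      · rw [if_pos hlr]
        refine ⟨?_, by simp⟩
        rintro c' ⟨⟩
        refine ⟨⟨hstack.tail, hrest, fun _ => hr, fun _ => ⟨hl, hlr, ?_⟩⟩, ?_, ?_⟩
        · rintro l'' P'' S'' e
          obtain ⟨⟨rfl, rfl⟩, -⟩ := by simpa using e
          exact hll
        · rw [hodd]
          simp [Config.chain, stackChain]
        · simp [Config.potential, hC]
      · rw [if_neg hlr]
        have hlr : l = r := le_antisymm (not_lt.1 hrl) (not_lt.1 hlr)
        refine ⟨?_, by simp⟩
        rintro c' ⟨⟩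
        refine ⟨⟨⟨hl, hll, by simp, hstack.tail⟩, hrest, by simp, by simp⟩, ?_, ?_⟩
        · rw [hodd]
          simp [Config.chain, stackChain, hlr]
        · simp [Config.potential, hC]

/-! ### Running programs -/

namespace RealRAM

@[simp] theorem State.nat_writeNat (s : State) (a i v a' j : ℕ) :
    (s.writeNat a i v).nat a' j = if a' = a ∧ j = i then v else s.nat a' j := by
  unfold State.writeNat
  by_cases h : a' = a
  · subst h
    by_cases h' : j = i <;> simp [h']
  · simp [h]

theorem State.nat_writeNat_of_ne (s : State) {a i v a' : ℕ} (h : a' ≠ a) :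
    (s.writeNat a i v).nat a' = s.nat a' := by
  simp [State.writeNat, h]

@[simp] theorem State.real_writeNat (s : State) (a i v : ℕ) :
    (s.writeNat a i v).real = s.real := rfl

@[simp] theorem State.nat_writeReal (s : State) (a i : ℕ) (v : ℝ) :
    (s.writeReal a i v).nat = s.nat := rfl

@[simp] theorem State.real_writeReal (s : State) (a i : ℕ) (v : ℝ) (a' j : ℕ) :
    (s.writeReal a i v).real a' j = if a' = a ∧ j = i then v else s.real a' j := by
  unfold State.writeReal
  by_cases h : a' = a
  · subst h
    by_cases h' : j = i <;> simp [h']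
  · simp [h]

theorem State.real_writeReal_of_ne (s : State) {a i a' : ℕ} {v : ℝ} (h : a' ≠ a) :
    (s.writeReal a i v).real a' = s.real a' := by
  simp [State.writeReal, h]

/-- A program without loops. -/
def Program.LoopFree : Program → Prop
  | .skip => True
  | .setNat _ _ _ => True
  | .setReal _ _ _ => True
  | .seq p q => p.LoopFree ∧ q.LoopFree
  | .ite _ p q => p.LoopFree ∧ q.LoopFree
  | .loop _ _ => False

open Classical in
/-- The state after running a program without loops. -/
noncomputable def Program.after : Program → State → State
  | .skip, s => s
  | .setNat a i e, s => s.writeNat a (i.eval s) (e.eval s)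
  | .setReal a i e, s => s.writeReal a (i.eval s) (e.eval s)
  | .seq p q, s => q.after (p.after s)
  | .ite b p q, s => if b.Holds s then p.after s else q.after s
  | .loop _ _, s => s

theorem Program.after_seq (p q : Program) (s : State) :
    (Program.seq p q).after s = q.after (p.after s) := rfl

theorem Program.after_setNat (a : ℕ) (i e : NatExpr) (s : State) :
    (Program.setNat a i e).after s = s.writeNat a (i.eval s) (e.eval s) := rfl

theorem Program.after_setReal (a : ℕ) (i : NatExpr) (e : RealExpr) (s : State) :
    (Program.setReal a i e).after s = s.writeReal a (i.eval s) (e.eval s) := rfl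

theorem Program.after_ite_setNat (b : Test) (a : ℕ) (i e e' : NatExpr) (s : State) :
    (Program.ite b (.setNat a i e) (.setNat a i e')).after s =
      s.writeNat a (i.eval s) (open Classical in if b.Holds s then e.eval s else e'.eval s) := by
  simp only [Program.after]
  split_ifs <;> rfl

/-- The natural-number arrays that a program writes to. -/
def Program.writesNat : Program → List ℕ
  | .skip => []
  | .setNat a _ _ => [a]
  | .setReal _ _ _ => []
  | .seq p q => p.writesNat ++ q.writesNat
  | .ite _ p q => p.writesNat ++ q.writesNat
  | .loop _ p => p.writesNat

/-- The real-number arrays that a program writes to. -/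
def Program.writesReal : Program → List ℕ
  | .skip => []
  | .setNat _ _ _ => []
  | .setReal a _ _ => [a]
  | .seq p q => p.writesReal ++ q.writesReal
  | .ite _ p q => p.writesReal ++ q.writesReal
  | .loop _ p => p.writesReal

/-- Reduces the claim that an array is untouched to a membership check, without evaluating the
program. -/
theorem Program.nat_after {p : Program} {a : ℕ} (h : a ∉ p.writesNat) (s : State) :
    (p.after s).nat a = s.nat a := by
  induction p generalizing s with
  | skip => rfl
  | setNat b i e => exact State.nat_writeNat_of_ne s (by simpa [Program.writesNat] using h)
  | setReal b i e => rfl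
  | seq p q ihp ihq =>
    simp only [Program.writesNat, List.mem_append, not_or] at h
    exact (ihq h.2 _).trans (ihp h.1 s)
  | ite b p q ihp ihq =>
    simp only [Program.writesNat, List.mem_append, not_or] at h
    simp only [Program.after]
    split_ifs
    · exact ihp h.1 s
    · exact ihq h.2 s
  | loop b p => rfl

theorem Program.real_after {p : Program} {a : ℕ} (h : a ∉ p.writesReal) (s : State) :
    (p.after s).real a = s.real a := by
  induction p generalizing s with
  | skip => rfl
  | setNat b i e => rfl
  | setReal b i e => exact State.real_writeReal_of_ne s (by simpa [Program.writesReal] using h)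
  | seq p q ihp ihq =>
    simp only [Program.writesReal, List.mem_append, not_or] at h
    exact (ihq h.2 _).trans (ihp h.1 s)
  | ite b p q ihp ihq =>
    simp only [Program.writesReal, List.mem_append, not_or] at h
    simp only [Program.after]
    split_ifs
    · exact ihp h.1 s
    · exact ihq h.2 s
  | loop b p => rfl

/-- A bound for the number of steps of a program without loops. -/
def Program.maxCost : Program → ℕ
  | .skip => 1
  | .setNat _ i e => i.cost + e.cost + 1
  | .setReal _ i e => i.cost + e.cost + 1
  | .seq p q => p.maxCost + q.maxCost
  | .ite b p q => b.cost + 1 + (p.maxCost + q.maxCost)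
  | .loop _ _ => 0

/-- Started in `s`, the program `p` halts within `T` steps in a state which satisfies `Q`. -/
def Reaches (p : Program) (s : State) (T : ℕ) (Q : State → Prop) : Prop :=
  ∃ t ≤ T, ∃ s', Runs p s t s' ∧ Q s'

theorem Program.LoopFree.reaches {p : Program} (hp : p.LoopFree) (s : State) :
    Reaches p s p.maxCost (fun s' => s' = p.after s) := by
  induction p generalizing s with
  | skip => exact ⟨_, le_rfl, _, .skip s, rfl⟩
  | setNat a i e => exact ⟨_, le_rfl, _, .setNat a i e s, rfl⟩
  | setReal a i e => exact ⟨_, le_rfl, _, .setReal a i e s, rfl⟩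
  | seq p q ihp ihq =>
    obtain ⟨t₁, h₁, _, hr₁, rfl⟩ := ihp hp.1 s
    obtain ⟨t₂, h₂, _, hr₂, rfl⟩ := ihq hp.2 (p.after s)
    exact ⟨_, Nat.add_le_add h₁ h₂, _, .seq hr₁ hr₂, rfl⟩
  | ite b p q ihp ihq =>
    by_cases hb : b.Holds s
    · obtain ⟨t₁, h₁, _, hr₁, rfl⟩ := ihp hp.1 s
      exact ⟨_, by simp only [Program.maxCost]; omega, _, .ite_true hb hr₁,
        by simp [Program.after, hb]⟩
    · obtain ⟨t₁, h₁, _, hr₁, rfl⟩ := ihq hp.2 s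
      exact ⟨_, by simp only [Program.maxCost]; omega, _, .ite_false hb hr₁,
        by simp [Program.after, hb]⟩
  | loop b p => exact hp.elim

theorem Program.LoopFree.reaches_of_after {p : Program} (hp : p.LoopFree) {s : State} {T : ℕ}
    {Q : State → Prop} (hT : p.maxCost ≤ T) (hQ : Q (p.after s)) : Reaches p s T Q := by
  obtain ⟨t, ht, _, hr, rfl⟩ := hp.reaches s
  exact ⟨t, ht.trans hT, _, hr, hQ⟩

theorem Reaches.seq {p q : Program} {s : State} {T₁ T₂ : ℕ} {Q R : State → Prop}
    (hp : Reaches p s T₁ Q) (hq : ∀ s', Q s' → Reaches q s' T₂ R) :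
    Reaches (.seq p q) s (T₁ + T₂) R := by
  obtain ⟨t₁, h₁, s₁, hr₁, hs₁⟩ := hp
  obtain ⟨t₂, h₂, s₂, hr₂, hs₂⟩ := hq s₁ hs₁
  exact ⟨_, Nat.add_le_add h₁ h₂, _, .seq hr₁ hr₂, hs₂⟩

theorem Reaches.ite {b : Test} {p q : Program} {s : State} {T : ℕ} {R : State → Prop}
    (hp : b.Holds s → Reaches p s T R) (hq : ¬ b.Holds s → Reaches q s T R) :
    Reaches (.ite b p q) s (b.cost + 1 + T) R := by
  by_cases hb : b.Holds s
  · obtain ⟨t, h, s', hr, hs⟩ := hp hb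
    exact ⟨_, Nat.add_le_add_left h _, _, .ite_true hb hr, hs⟩
  · obtain ⟨t, h, s', hr, hs⟩ := hq hb
    exact ⟨_, Nat.add_le_add_left h _, _, .ite_false hb hr, hs⟩

theorem Reaches.mono {p : Program} {s : State} {T T' : ℕ} {Q R : State → Prop}
    (h : Reaches p s T Q) (hT : T ≤ T') (hQ : ∀ s', Q s' → R s') : Reaches p s T' R := by
  obtain ⟨t, ht, s', hr, hs⟩ := h
  exact ⟨t, ht.trans hT, s', hr, hQ s' hs⟩

/-- A loop whose body lowers the bound `k` of an invariant. -/
theorem Reaches.loop {b : Test} {p : Program} {T : ℕ} {I : ℕ → State → Prop}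
    (hstep : ∀ k s, I k s → b.Holds s → Reaches p s T (fun s' => ∃ k' < k, I k' s'))
    {k : ℕ} {s : State} (hI : I k s) :
    Reaches (.loop b p) s ((k + 1) * (b.cost + 1 + T))
      (fun s' => ¬ b.Holds s' ∧ ∃ k', I k' s') := by
  induction k using Nat.strong_induction_on generalizing s with
  | _ k ih =>
    by_cases hb : b.Holds s
    · obtain ⟨t₁, h₁, s₁, hr₁, k', hk', hI'⟩ := hstep k s hI hb
      obtain ⟨t₂, h₂, s₂, hr₂, hs₂⟩ := ih k' hk' hI'
      refine ⟨_, ?_, _, .loop_true hb hr₁ hr₂, hs₂⟩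
      have : (k' + 1) * (b.cost + 1 + T) ≤ k * (b.cost + 1 + T) := Nat.mul_le_mul_right _ hk'
      rw [Nat.add_mul k]
      omega
    · refine ⟨_, ?_, _, .loop_false hb, hb, k, hI⟩
      rw [Nat.add_mul k]
      omega

/-! ### The decision program -/

/-- The value of a natural-number variable. -/
def nvar (a : ℕ) : NatExpr := .get a (.const 0)

/-- Assignment to a natural-number variable. -/
def nset (a : ℕ) (e : NatExpr) : Program := .setNat a (.const 0) e

/-- The index of the top of the stack. -/
def topIdx : NatExpr := .minus (nvar 11) (.const 1)

/-- Disjunction of tests. -/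
def Test.or (b b' : Test) : Test := .neg (.conj (.neg b) (.neg b'))

/-- Reads the next crease and segment. -/
def readItem : Program :=
  -- Natural registers: `10` next crease, `11` stack size, `12` to `15` number, valleys, mountains
  -- and parity of `C`, `16` running flag, `17` verdict; arrays `20` to `23` hold the same four
  -- numbers for each run, `24` and `25` mark a computed label as valley or mountain. Real arrays:
  -- `1` run lengths, `2` the value `q`, `3` the value `r`. Label lists are stored only through
  -- their counts, which is all that a step uses; parity is kept because there is no division.
  .seq (nset 12 (.const 1)) <|
  .seq (nset 15 (.const 1)) <|
  .seq (.ite (.natLt (.const 1) (.get 3 (nvar 10))) (nset 13 (.const 1)) (nset 13 (.const 0))) <|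
  .seq (.ite (.natLt (.get 3 (nvar 10)) (.const 1)) (nset 14 (.const 0))
    (nset 14 (.minus (.const 1) (nvar 13)))) <|
  .seq (.setReal 3 (.const 0) (.minus (.get 0 (.plus (nvar 10) (.const 2)))
    (.get 0 (.plus (nvar 10) (.const 1))))) <|
  nset 10 (.plus (nvar 10) (.const 1))

/-- Stops with answer `b`. -/
def answer (b : ℕ) : Program := .seq (nset 16 (.const 0)) (nset 17 (.const b))

/-- Turns the top run of the stack into creases between equal segments, to be crimped away. -/
def popRun : Program :=
  .seq (.setReal 2 (.const 0) (.get 1 topIdx)) <|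
  .seq (nset 12 (.get 20 topIdx)) <|
  .seq (nset 13 (.get 21 topIdx)) <|
  .seq (nset 14 (.get 22 topIdx)) <|
  .seq (nset 15 (.get 23 topIdx)) <|
  nset 11 topIdx

/-- The length of the segment that results from crimping an even number of creases. -/
def mergedLength : RealExpr :=
  .plus (.minus (.get 1 topIdx) (.get 2 (.const 0))) (.get 3 (.const 0))

/-- Crimps away an even number of creases between equal segments. -/
def evenCase : Program :=
  .ite (.natLt (.const 1) (nvar 11))
    -- The merged length must be computed before `popRun` overwrites `q` and lowers the stack.
    (.seq (.setReal 3 (.const 0) mergedLength) popRun)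
    (.seq (.setReal 1 topIdx mergedLength) (nset 12 (.const 0)))

/-- Computes the label of the crease that remains of an odd number of creases. -/
def setLabel : Program :=
  .seq (.ite (.natLt (nvar 12) (.plus (nvar 13) (nvar 13))) (nset 24 (.const 1))
    (nset 24 (.const 0))) <|
  .ite (.natLt (nvar 12) (.plus (nvar 14) (nvar 14))) (nset 25 (.minus (.const 1) (nvar 24)))
    (nset 25 (.const 0))

/-- Pushes a new run, of a single segment. -/
def pushRun : Program :=
  .seq (.setReal 1 (nvar 11) (.get 3 (.const 0))) <|
  .seq (.setNat 20 (nvar 11) (.const 1)) <|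
  .seq (.setNat 21 (nvar 11) (nvar 24)) <|
  .seq (.setNat 22 (nvar 11) (nvar 25)) <|
  .seq (.setNat 23 (nvar 11) (.const 1)) <|
  .seq (nset 11 (.plus (nvar 11) (.const 1))) (nset 12 (.const 0))

/-- Appends a segment to the top run. -/
def extendRun : Program :=
  .seq (.setNat 20 topIdx (.plus (.get 20 topIdx) (.const 1))) <|
  .seq (.setNat 21 topIdx (.plus (.get 21 topIdx) (nvar 24))) <|
  .seq (.setNat 22 topIdx (.plus (.get 22 topIdx) (nvar 25))) <|
  .setNat 23 topIdx (.minus (.const 1) (.get 23 topIdx))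

/-- Crimps an odd number of creases between equal segments to one crease. -/
def oddCase : Program :=
  .seq setLabel <|
  .ite (.realLt (.get 3 (.const 0)) (.get 1 topIdx)) pushRun <|
  .ite (.natLt (nvar 11) (.const 2))
    (.seq (.setReal 1 topIdx (.get 3 (.const 0))) (nset 12 (.const 0))) <|
  -- The crease joins the top run in both remaining cases; whether the run is then popped depends on
  -- the comparison.
  .seq extendRun <|
  .ite (.realLt (.get 1 topIdx) (.get 3 (.const 0))) popRun (nset 12 (.const 0))

/-- Performs one step of the reduction. -/
def stepProgram : Program :=
  .ite (.natLt (nvar 12) (.const 1))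
    (.ite (.natLt (nvar 10) (nvar 0)) readItem (answer 1))
    (.ite (.natLt (nvar 15) (.const 1))
      (.ite (.or (.natLt (nvar 12) (.plus (nvar 13) (nvar 13)))
          (.natLt (nvar 12) (.plus (nvar 14) (nvar 14)))) (answer 0) evenCase)
      (.ite (.or (.natLt (.plus (nvar 12) (.const 1)) (.plus (nvar 13) (nvar 13)))
          (.natLt (.plus (nvar 12) (.const 1)) (.plus (nvar 14) (nvar 14)))) (answer 0) oddCase))

theorem stepProgram_loopFree : stepProgram.LoopFree := by
  simp [stepProgram, readItem, answer, evenCase, oddCase, popRun, pushRun, extendRun, setLabel,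
    nset, Program.LoopFree]

theorem stepProgram_maxCost : stepProgram.maxCost ≤ 500 := by
  decide

/-! ### Configurations in memory and correctness of one step. -/

/-- The label with a given code. -/
def decodeLabel (x : ℕ) : Option Bool :=
  if x = 0 then none else if x = 1 then some false else some true

/-- The part of the chain after crease `i`, for vertices `v` and labels with codes `lab`. -/
def restChain (v : ℕ → ℝ) (lab : ℕ → ℕ) (n i : ℕ) : List (Option Bool × ℝ) :=
  (List.range' i (n - i)).map fun j => (decodeLabel (lab j), v (j + 2) - v (j + 1))

theorem restChain_of_lt (v : ℕ → ℝ) (lab : ℕ → ℕ) {n i : ℕ} (h : i < n) :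
    restChain v lab n i =
      (decodeLabel (lab i), v (i + 2) - v (i + 1)) :: restChain v lab n (i + 1) := by
  unfold restChain
  rw [show n - i = (n - (i + 1)) + 1 by omega, List.range'_succ, List.map_cons]

theorem restChain_of_le (v : ℕ → ℝ) (lab : ℕ → ℕ) {n i : ℕ} (h : n ≤ i) :
    restChain v lab n i = [] := by
  unfold restChain
  rw [show n - i = 0 by omega]
  rfl

/-- What the decision program does not change. -/
structure Frame (v : ℕ → ℝ) (lab : ℕ → ℕ) (n z c : ℕ) (s : State) : Prop where
  size : s.nat 0 0 = n
  vertex : s.real 0 = v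
  label : s.nat 3 = lab
  out : s.nat 2 0 = z
  counter : s.nat 19 0 = c

/-- Memory holds a stack of runs. -/
def EncStack (s : State) : List (ℝ × List (Option Bool)) → Prop
  | [] => True
  | (l, P) :: S => s.real 1 S.length = l ∧ s.nat 20 S.length = P.length ∧
      s.nat 21 S.length = P.count (some true) ∧ s.nat 22 S.length = P.count (some false) ∧
      s.nat 23 S.length = P.length % 2 ∧ EncStack s S

/-- Only cells below the stack size matter, so popping may leave old entries and pushing may
overwrite them. -/
theorem EncStack.congr {s s' : State} {S : List (ℝ × List (Option Bool))} (h : EncStack s S)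
    (hs : ∀ j < S.length, s'.real 1 j = s.real 1 j ∧ s'.nat 20 j = s.nat 20 j ∧
      s'.nat 21 j = s.nat 21 j ∧ s'.nat 22 j = s.nat 22 j ∧ s'.nat 23 j = s.nat 23 j) :
    EncStack s' S := by
  induction S with
  | nil => trivial
  | cons x S ih =>
    obtain ⟨l, P⟩ := x
    obtain ⟨h1, h2, h3, h4, h5, h6⟩ := h
    obtain ⟨g1, g2, g3, g4, g5⟩ := hs S.length (by simp)
    refine ⟨g1.trans h1, g2.trans h2, g3.trans h3, g4.trans h4, g5.trans h5, ih h6 fun j hj => ?_⟩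
    exact hs j (by simp; omega)

/-- Memory holds a configuration. -/
structure Enc (v : ℕ → ℝ) (lab : ℕ → ℕ) (n : ℕ) (s : State) (c : Config) : Prop where
  rest : c.rest = restChain v lab n (s.nat 10 0)
  size : s.nat 11 0 = c.stack.length
  stack : EncStack s c.stack
  len : s.nat 12 0 = c.C.length
  -- Emptying `C` resets only register `12`; the other three become stale.
  counts : c.C ≠ [] → s.nat 13 0 = c.C.count (some true) ∧ s.nat 14 0 = c.C.count (some false) ∧
    s.nat 15 0 = c.C.length % 2
  q : s.real 2 0 = c.q
  r : s.real 3 0 = c.r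

/-- The outcome of a step is in memory. -/
def EncStep (v : ℕ → ℝ) (lab : ℕ → ℕ) (n : ℕ) (s : State) : Config ⊕ Bool → Prop
  | .inl c => s.nat 16 0 = 1 ∧ Enc v lab n s c
  | .inr b => s.nat 16 0 = 0 ∧ s.nat 17 0 = if b then 1 else 0

section

variable {v : ℕ → ℝ} {lab : ℕ → ℕ} {n z k : ℕ} {s : State} {c : Config}

theorem after_answer (b : Bool) (x : ℕ) (hx : x = if b then 1 else 0) :
    EncStep v lab n ((answer x).after s) (.inr b) := by
  simp [EncStep, answer, nset, Program.after, NatExpr.eval, hx]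

theorem after_readItem (hrun : s.nat 16 0 = 1) (F : Frame v lab n z k s) (E : Enc v lab n s c) :
    EncStep v lab n (readItem.after s) (.inl ⟨c.stack, [decodeLabel (lab (s.nat 10 0))], c.q,
      v (s.nat 10 0 + 2) - v (s.nat 10 0 + 1), restChain v lab n (s.nat 10 0 + 1)⟩) := by
  have hl : ∀ j, s.nat 3 j = lab j := fun j => by rw [F.label]
  have hv : ∀ j, s.real 0 j = v j := fun j => by rw [F.vertex]
  have hcount : ∀ x, (if 1 < x then 1 else 0) = [decodeLabel x].count (some true) ∧
      (if x < 1 then 0 else 1 - if 1 < x then 1 else 0) = [decodeLabel x].count (some false) := by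
    intro x
    unfold decodeLabel
    rcases Nat.lt_trichotomy x 1 with h | h | h
    · obtain rfl : x = 0 := by omega
      simp
    · subst h; simp
    · have h0 : x ≠ 0 := by omega
      have h1 : x ≠ 1 := by omega
      have h2 : ¬ x < 1 := by omega
      simp [h0, h1, h2, h]
  simp only [readItem, nset, nvar, Program.after_ite_setNat, Program.after_seq,
    Program.after_setNat, Program.after_setReal, NatExpr.eval, RealExpr.eval, Test.Holds]
  refine ⟨by simpa using hrun, ⟨?_, ?_, ?_, ?_, ?_, ?_, ?_⟩⟩
  · simp
  · simpa using E.size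
  · exact E.stack.congr fun j _ => by simp
  · simp
  · intro _
    have := hcount (lab (s.nat 10 0))
    simp [hl, ← this.1, ← this.2]
  · simpa using E.q
  · simp [hv]

theorem after_popRun {l : ℝ} {P : List (Option Bool)} {S : List (ℝ × List (Option Bool))} {r : ℝ}
    (hrun : s.nat 16 0 = 1) (hrest : c.rest = restChain v lab n (s.nat 10 0))
    (hk : s.nat 11 0 = S.length + 1) (hS : EncStack s ((l, P) :: S)) (hr : s.real 3 0 = r) :
    EncStep v lab n (popRun.after s) (.inl ⟨S, P, l, r, c.rest⟩) := by
  obtain ⟨h1, h2, h3, h4, h5, h6⟩ := hS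
  simp only [popRun, topIdx, nset, nvar, Program.after, NatExpr.eval, RealExpr.eval]
  refine ⟨by simpa using hrun, ⟨?_, ?_, ?_, ?_, ?_, ?_, ?_⟩⟩
  · simpa using hrest
  · simp [hk]
  · exact h6.congr fun j _ => by simp
  · simp [hk, h2]
  · intro _
    simp [hk, h3, h4, h5]
  · simp [hk, h1]
  · simpa using hr

theorem after_evenCase {l : ℝ} {P : List (Option Bool)} {S : List (ℝ × List (Option Bool))}
    (hrun : s.nat 16 0 = 1) (E : Enc v lab n s c) (hS : c.stack = (l, P) :: S) :
    EncStep v lab n (evenCase.after s) (.inl (if S = [] then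
      ⟨[(l - c.q + c.r, P)], [], c.q, c.r, c.rest⟩ else ⟨S, P, l, l - c.q + c.r, c.rest⟩)) := by
  have hk := E.size
  have hst := E.stack
  rw [hS] at hk hst
  rw [List.length_cons] at hk
  by_cases hS0 : S = []
  · subst hS0
    rw [if_pos rfl]
    have hk : s.nat 11 0 = 1 := hk
    have h0 : ¬ (Test.natLt (.const 1) (nvar 11)).Holds s := by
      simp [Test.Holds, NatExpr.eval, nvar, hk]
    obtain ⟨h1, h2, h3, h4, h5, -⟩ := hst
    simp only [List.length_nil] at h1 h2 h3 h4 h5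
    simp only [evenCase, Program.after]
    rw [if_neg h0]
    simp only [Program.after, mergedLength, topIdx, nset, nvar, NatExpr.eval, RealExpr.eval]
    refine ⟨by simpa using hrun, ⟨?_, ?_, ?_, ?_, ?_, ?_, ?_⟩⟩
    · simpa using E.rest
    · simpa using hk
    · simp [EncStack, hk, h1, h2, h3, h4, h5, E.q, E.r]
    · simp
    · simp
    · simpa using E.q
    · simpa using E.r
  · rw [if_neg hS0]
    have h1 : (Test.natLt (.const 1) (nvar 11)).Holds s := by
      have := List.length_pos_iff.2 hS0
      simp only [Test.Holds, NatExpr.eval, nvar, hk]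
      omega
    simp only [evenCase, Program.after, if_pos h1]
    refine after_popRun (by simpa using hrun) (by simpa using E.rest) (by simpa using hk)
      (hst.congr fun j _ => by simp) ?_
    simp [mergedLength, topIdx, nvar, NatExpr.eval, RealExpr.eval, hk, hst.1, E.q, E.r]

theorem after_setLabel (hrun : s.nat 16 0 = 1) (E : Enc v lab n s c) (hC : c.C ≠ []) :
    (setLabel.after s).nat 16 0 = 1 ∧ Enc v lab n (setLabel.after s) c ∧
      (setLabel.after s).nat 24 0 = [Config.label c.C].count (some true) ∧
      (setLabel.after s).nat 25 0 = [Config.label c.C].count (some false) := by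
  obtain ⟨e1, e2, -⟩ := E.counts hC
  have key : (setLabel.after s).nat 24 0 = [Config.label c.C].count (some true) ∧
      (setLabel.after s).nat 25 0 = [Config.label c.C].count (some false) := by
    unfold Config.label clip
    simp only [setLabel, nset, nvar, Program.after_ite_setNat, Program.after_seq, NatExpr.eval,
      Test.Holds]
    simp [E.len, e1, e2, ← two_mul]
    split_ifs <;> simp
  have hn : ∀ a, a ≠ 24 → a ≠ 25 → (setLabel.after s).nat a = s.nat a := fun a h1 h2 =>
    Program.nat_after (by simp [setLabel, nset, Program.writesNat, h1, h2]) s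
  have hr : (setLabel.after s).real = s.real := by
    funext a
    exact Program.real_after (by simp [setLabel, nset, Program.writesReal]) s
  refine ⟨by rw [hn _ (by simp) (by simp), hrun], ⟨?_, ?_, ?_, ?_, ?_, ?_, ?_⟩, key⟩
  · rw [hn _ (by simp) (by simp)]; exact E.rest
  · rw [hn _ (by simp) (by simp)]; exact E.size
  · exact E.stack.congr fun j _ => by simp [hn, hr]
  · rw [hn _ (by simp) (by simp)]; exact E.len
  · simp only [hn 13 (by simp) (by simp), hn 14 (by simp) (by simp), hn 15 (by simp) (by simp)]
    exact E.counts
  · rw [hr]; exact E.q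
  · rw [hr]; exact E.r

theorem after_pushRun {w : Option Bool} (hrun : s.nat 16 0 = 1) (E : Enc v lab n s c)
    (h1 : s.nat 24 0 = [w].count (some true)) (h2 : s.nat 25 0 = [w].count (some false)) :
    EncStep v lab n (pushRun.after s)
      (.inl ⟨(c.r, [w]) :: c.stack, [], c.q, c.r, c.rest⟩) := by
  simp only [pushRun, nset, nvar, Program.after, NatExpr.eval, RealExpr.eval]
  refine ⟨by simpa using hrun, ⟨?_, ?_, ⟨?_, ?_, ?_, ?_, ?_, ?_⟩, ?_, ?_, ?_, ?_⟩⟩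
  · simpa using E.rest
  · simp [E.size]
  · simp [E.size, E.r]
  · simp [E.size]
  · simp [E.size, h1]
  · simp [E.size, h2]
  · simp [E.size]
  · refine E.stack.congr fun j hj => ?_
    have hj' : j ≠ c.stack.length := hj.ne
    simp [E.size, hj']
  · simp
  · simp
  · simpa using E.q
  · simpa using E.r

theorem after_extendRun {w : Option Bool} {l : ℝ} {P : List (Option Bool)}
    {S : List (ℝ × List (Option Bool))} (hk : s.nat 11 0 = S.length + 1)
    (hS : EncStack s ((l, P) :: S)) (h1 : s.nat 24 0 = [w].count (some true))
    (h2 : s.nat 25 0 = [w].count (some false)) :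
    EncStack (extendRun.after s) ((l, P ++ [w]) :: S) := by
  obtain ⟨g1, g2, g3, g4, g5, g6⟩ := hS
  simp only [extendRun, topIdx, nvar, Program.after, NatExpr.eval]
  refine ⟨?_, ?_, ?_, ?_, ?_, ?_⟩
  · simpa using g1
  · simp [hk, g2]
  · simp [hk, g3, h1, List.count_append]
  · simp [hk, g4, h2, List.count_append]
  · simp [hk, g5]; omega
  · refine g6.congr fun j hj => ?_
    have hj' : j ≠ S.length := hj.ne
    simp [hk, hj']

theorem after_oddCase {l : ℝ} {P : List (Option Bool)} {S : List (ℝ × List (Option Bool))}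
    (hrun : s.nat 16 0 = 1) (E : Enc v lab n s c) (hS : c.stack = (l, P) :: S) (hC : c.C ≠ []) :
    EncStep v lab n (oddCase.after s) (.inl (
      open Classical in
      if c.r < l then ⟨(c.r, [Config.label c.C]) :: c.stack, [], c.q, c.r, c.rest⟩
      else if S = [] then ⟨[(c.r, P)], [], c.q, c.r, c.rest⟩
      else if l < c.r then ⟨S, P ++ [Config.label c.C], l, c.r, c.rest⟩
      else ⟨(l, P ++ [Config.label c.C]) :: S, [], c.q, c.r, c.rest⟩)) := by
  simp only [oddCase, Program.after]
  obtain ⟨hrun, E, w1, w2⟩ := after_setLabel hrun E hC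
  generalize setLabel.after s = s at *
  have hk := E.size
  have hst := E.stack
  rw [hS] at hk hst
  rw [List.length_cons] at hk
  obtain ⟨g1, g2, g3, g4, g5, g6⟩ := id hst
  have t1 : (Test.realLt (.get 3 (.const 0)) (.get 1 topIdx)).Holds s ↔ c.r < l := by
    simp [Test.Holds, RealExpr.eval, NatExpr.eval, topIdx, nvar, hk, E.r, g1]
  have t2 : (Test.natLt (nvar 11) (.const 2)).Holds s ↔ S = [] := by
    simp only [Test.Holds, NatExpr.eval, nvar, hk, ← List.length_eq_zero_iff]
    omega
  simp only [t1, t2]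
  by_cases h1 : c.r < l
  · rw [if_pos h1, if_pos h1]
    exact after_pushRun hrun E w1 w2
  rw [if_neg h1, if_neg h1]
  by_cases h2 : S = []
  · rw [if_pos h2, if_pos h2]
    subst h2
    have hk : s.nat 11 0 = 1 := hk
    simp only [List.length_nil] at g1 g2 g3 g4 g5
    simp only [Program.after, topIdx, nset, nvar, NatExpr.eval, RealExpr.eval]
    refine ⟨by simpa using hrun, ⟨?_, ?_, ?_, ?_, ?_, ?_, ?_⟩⟩
    · simpa using E.rest
    · simpa using hk
    · simp [EncStack, hk, g2, g3, g4, g5, E.r]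
    · simp
    · simp
    · simpa using E.q
    · simpa using E.r
  rw [if_neg h2, if_neg h2]
  have hst' := after_extendRun hk hst w1 w2
  have hn : ∀ a, a ≠ 20 → a ≠ 21 → a ≠ 22 → a ≠ 23 → (extendRun.after s).nat a = s.nat a :=
    fun a _ _ _ _ => Program.nat_after (by simp [extendRun, Program.writesNat, *]) s
  have hr : (extendRun.after s).real = s.real := by
    funext a
    exact Program.real_after (by simp [extendRun, Program.writesReal]) s
  have n10 := hn 10 (by simp) (by simp) (by simp) (by simp)
  have n11 := hn 11 (by simp) (by simp) (by simp) (by simp)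
  have n16 := hn 16 (by simp) (by simp) (by simp) (by simp)
  generalize extendRun.after s = s' at *
  have t3 : (Test.realLt (.get 1 topIdx) (.get 3 (.const 0))).Holds s' ↔ l < c.r := by
    simp [Test.Holds, RealExpr.eval, NatExpr.eval, topIdx, nvar, n11, hr, hk, E.r, g1]
  simp only [t3]
  by_cases h3 : l < c.r
  · rw [if_pos h3, if_pos h3]
    exact after_popRun (by rw [n16, hrun]) (by rw [n10]; exact E.rest) (by rw [n11, hk]) hst'
      (by rw [hr, E.r])
  · rw [if_neg h3, if_neg h3]
    simp only [nset, Program.after, NatExpr.eval]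
    refine ⟨by simpa [n16] using hrun, ⟨?_, ?_, ?_, ?_, ?_, ?_, ?_⟩⟩
    · simpa [n10] using E.rest
    · simp [n11, hk]
    · exact hst'.congr fun j _ => by simp
    · simp
    · simp
    · simp [hr, E.q]
    · simp [hr, E.r]

theorem Frame.after_stepProgram (F : Frame v lab n z k s) :
    Frame v lab n z k (stepProgram.after s) := by
  have hn : ∀ a, a ∉ stepProgram.writesNat → (stepProgram.after s).nat a = s.nat a :=
    fun a h => Program.nat_after h s
  constructor
  · rw [hn 0 (by decide), F.size]
  · rw [Program.real_after (by decide), F.vertex]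
  · rw [hn 3 (by decide), F.label]
  · rw [hn 2 (by decide), F.out]
  · rw [hn 19 (by decide), F.counter]

theorem after_stepProgram (hrun : s.nat 16 0 = 1) (F : Frame v lab n z k s)
    (E : Enc v lab n s c) (hc : c.stack ≠ []) :
    EncStep v lab n (stepProgram.after s) c.step := by
  obtain ⟨⟨l, P⟩, S, hS⟩ := List.exists_cons_of_ne_nil hc
  have t1 : (Test.natLt (nvar 12) (.const 1)).Holds s ↔ c.C.length = 0 := by
    simp only [Test.Holds, NatExpr.eval, nvar, E.len]
    omega
  simp only [stepProgram, Program.after]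
  unfold Config.step
  rw [hS]
  simp only
  by_cases h0 : c.C.length = 0
  · rw [if_pos (t1.2 h0), if_pos h0]
    have t2 : (Test.natLt (nvar 10) (nvar 0)).Holds s ↔ s.nat 10 0 < n := by
      simp [Test.Holds, NatExpr.eval, nvar, F.size]
    by_cases hi : s.nat 10 0 < n
    · rw [if_pos (t2.2 hi), E.rest, restChain_of_lt v lab hi]
      simp only
      rw [← hS]
      exact after_readItem hrun F E
    · rw [if_neg (fun h => hi (t2.1 h)), E.rest, restChain_of_le v lab (not_lt.1 hi)]
      exact after_answer true 1 rfl
  rw [if_neg (fun h => h0 (t1.1 h)), if_neg h0]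
  have hC : c.C ≠ [] := by rintro h; simp [h] at h0
  obtain ⟨e1, e2, e3⟩ := E.counts hC
  have t2 : (Test.natLt (nvar 15) (.const 1)).Holds s ↔ c.C.length % 2 = 0 := by
    simp only [Test.Holds, NatExpr.eval, nvar, e3]
    omega
  by_cases hm : c.C.length % 2 = 0
  · rw [if_pos (t2.2 hm), if_pos hm]
    have t3 : (Test.or (.natLt (nvar 12) (.plus (nvar 13) (nvar 13)))
          (.natLt (nvar 12) (.plus (nvar 14) (nvar 14)))).Holds s ↔
        (c.C.length < 2 * c.C.count (some true) ∨ c.C.length < 2 * c.C.count (some false)) := by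
      simp only [Test.or, Test.Holds, NatExpr.eval, nvar, E.len, e1, e2]
      omega
    by_cases hab : c.C.length < 2 * c.C.count (some true) ∨ c.C.length < 2 * c.C.count (some false)
    · rw [if_pos (t3.2 hab), if_pos hab]
      exact after_answer false 0 rfl
    · rw [if_neg (fun h => hab (t3.1 h)), if_neg hab]
      have := after_evenCase hrun E hS
      split_ifs at this ⊢ <;> exact this
  · rw [if_neg (fun h => hm (t2.1 h)), if_neg hm]
    have t3 : (Test.or (.natLt (.plus (nvar 12) (.const 1)) (.plus (nvar 13) (nvar 13)))
          (.natLt (.plus (nvar 12) (.const 1)) (.plus (nvar 14) (nvar 14)))).Holds s ↔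
        (c.C.length + 1 < 2 * c.C.count (some true) ∨
          c.C.length + 1 < 2 * c.C.count (some false)) := by
      simp only [Test.or, Test.Holds, NatExpr.eval, nvar, E.len, e1, e2]
      omega
    by_cases hab : c.C.length + 1 < 2 * c.C.count (some true) ∨
        c.C.length + 1 < 2 * c.C.count (some false)
    · rw [if_pos (t3.2 hab), if_pos hab]
      exact after_answer false 0 rfl
    · rw [if_neg (fun h => hab (t3.1 h)), if_neg hab]
      have := after_oddCase hrun E hS hC
      rw [hS] at this
      split_ifs at this ⊢ <;> exact this

end

end RealRAM

/-! ### Assignments of a crease pattern -/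

theorem map_snd_relabel {c : List (Option Bool × ℝ)} {B : List Bool} (h : c.length = B.length) :
    (relabel c B).map Prod.snd = c.map Prod.snd := by
  induction c generalizing B with
  | nil => rfl
  | cons x c ih =>
    cases B with
    | nil => simp at h
    | cons b B => simpa [relabel] using ih (B := B) (by simpa using h)

theorem map_fst_relabel {c : List (Option Bool × ℝ)} {B : List Bool} (h : c.length = B.length) :
    (relabel c B).map Prod.fst = B := by
  induction c generalizing B with
  | nil => exact (List.length_eq_zero_iff.1 h.symm).symm
  | cons x c ih =>
    cases B with
    | nil => simp at h
    | cons b B => simpa [relabel] using ih (B := B) (by simpa using h)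

theorem mixedFoldable_iff_exists {l : List (Option Bool × ℝ)} :
    MixedFoldable l ↔ ∃ b : ℕ → Bool, (∀ k (hk : k < l.length), Agrees l[k].1 (b k)) ∧
      ∃ h : ℕ → ℝ, LayerOrder (l.length - 1) (foldPos (l.map Prod.snd)) h ∧
        ∀ k, k + 1 < l.length → (h k < h (k + 1) ↔ (b (k + 1) = true ↔ k % 2 = 0)) := by
  constructor
  · rintro ⟨B, hB, h, H, hlt⟩
    obtain ⟨hlen, hB⟩ := List.forall₂_iff_get.1 hB
    have hlen' : (relabel l B).length = l.length := by simp [relabel, hlen]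
    rw [map_snd_relabel hlen, hlen'] at H
    rw [map_fst_relabel hlen, hlen'] at hlt
    refine ⟨fun k => B.getD k false, fun k hk => ?_, h, H, hlt⟩
    have := hB k hk (hlen ▸ hk)
    simp only [List.getD_eq_getElem _ _ (hlen ▸ hk)]
    simpa using this
  · rintro ⟨b, hb, h, H, hlt⟩
    have hlen : l.length = ((List.range l.length).map b).length := by simp
    have hlen' : (relabel l ((List.range l.length).map b)).length = l.length := by simp [relabel]
    refine ⟨(List.range l.length).map b, List.forall₂_iff_get.2 ⟨hlen, fun k hk hk' => ?_⟩,
      h, ?_, ?_⟩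
    · simpa using hb k hk
    · rw [map_snd_relabel hlen, hlen']; exact H
    · rw [map_fst_relabel hlen, hlen']
      intro k hk
      rw [hlt k hk, List.getD_eq_getElem _ _ (by simpa using hk)]
      simp

/-- The position of vertex `k` in the folded state, relative to the position of vertex `0`. -/
noncomputable def foldedDist (v : ℕ → ℝ) (k : ℕ) : ℝ :=
  ∑ j ∈ Finset.range k, (-1) ^ j * (v (j + 1) - v j)

/-- The crease pattern with vertices `v 0 < ⋯ < v (n + 1)` can be folded flat when the creases `i`
with `b i` are the valleys. -/
def FoldsWith (v : ℕ → ℝ) (n : ℕ) (b : ℕ → Bool) : Prop :=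
  ∃ h : ℕ → ℝ, LayerOrder n (foldedDist v) h ∧
    ∀ i < n, (h i < h (i + 1) ↔ (b i = true ↔ i % 2 = 0))

namespace RealRAM

/-- The chain of all segments, for vertices `v` and labels with codes `lab`. -/
def fullChain (v : ℕ → ℝ) (lab : ℕ → ℕ) (n : ℕ) : List (Option Bool × ℝ) :=
  (none, v 1 - v 0) :: restChain v lab n 0

/-- The labels with codes `lab` can be completed to a flat-foldable assignment. -/
def Satisfiable (v : ℕ → ℝ) (lab : ℕ → ℕ) (n : ℕ) : Prop :=
  ∃ b : ℕ → Bool, (∀ i < n, Agrees (decodeLabel (lab i)) (b i)) ∧ FoldsWith v n b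

theorem length_fullChain (v : ℕ → ℝ) (lab : ℕ → ℕ) (n : ℕ) :
    (fullChain v lab n).length = n + 1 := by
  simp [fullChain, restChain]

theorem fullChain_getElem_succ (v : ℕ → ℝ) (lab : ℕ → ℕ) (n i : ℕ)
    (hi : i + 1 < (fullChain v lab n).length) :
    (fullChain v lab n)[i + 1] = (decodeLabel (lab i), v (i + 2) - v (i + 1)) := by
  simp [fullChain, restChain]

theorem foldPos_fullChain (v : ℕ → ℝ) (lab : ℕ → ℕ) {n k : ℕ} (hk : k ≤ n + 1) :
    foldPos ((fullChain v lab n).map Prod.snd) k = foldedDist v k := by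
  induction k with
  | zero => simp [foldedDist]
  | succ k ih =>
    have hlen : k < ((fullChain v lab n).map Prod.snd).length := by
      rw [List.length_map, length_fullChain]; omega
    rw [foldPos_succ, ih (by omega), foldedDist, foldedDist, Finset.sum_range_succ,
      List.getD_eq_getElem _ _ hlen, List.getElem_map]
    cases k with
    | zero => simp [fullChain]
    | succ k => rw [fullChain_getElem_succ]

theorem mixedFoldable_fullChain_iff (v : ℕ → ℝ) (lab : ℕ → ℕ) (n : ℕ) :
    MixedFoldable (fullChain v lab n) ↔ Satisfiable v lab n := by
  rw [mixedFoldable_iff_exists]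
  simp only [length_fullChain, Nat.add_sub_cancel]
  constructor
  · rintro ⟨b, hb, h, H, hlt⟩
    refine ⟨fun i => b (i + 1), fun i hi => ?_, h, ?_, fun i hi => hlt i (by omega)⟩
    · have := hb (i + 1) (by omega)
      rwa [fullChain_getElem_succ] at this
    · exact H.congr (fun k hk => foldPos_fullChain v lab hk) fun _ _ => rfl
  · rintro ⟨b, hb, h, H, hlt⟩
    -- Crease `i` carries its label on segment `i + 1` of the chain. Entry `0`, where subtraction
    -- truncates, is unlabelled and does not affect the folding.
    refine ⟨fun i => b (i - 1), fun i hi => ?_, h, ?_, fun i hi => hlt i (by omega)⟩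
    · cases i with
      | zero => exact fun z hz => nomatch hz
      | succ i =>
        rw [fullChain_getElem_succ]
        exact hb i (by omega)
    · exact H.congr (fun k hk => (foldPos_fullChain v lab hk).symm) fun _ _ => rfl

theorem posLengths_restChain {v : ℕ → ℝ} {n : ℕ} (hv : ∀ i ≤ n, v i < v (i + 1))
    (lab : ℕ → ℕ) (i : ℕ) : PosLengths (restChain v lab n i) := by
  intro x hx
  obtain ⟨j, hj, rfl⟩ := List.mem_map.1 hx
  have := List.mem_range'_1.1 hj
  have := hv (j + 1) (by omega)
  simpa using this

/-- An unassigned crease can be made a mountain or a valley. -/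
theorem Satisfiable.assign {v : ℕ → ℝ} {lab : ℕ → ℕ} {n i : ℕ} (h : Satisfiable v lab n)
    (hi : i < n) :
    Satisfiable v (Function.update lab i 1) n ∨ Satisfiable v (Function.update lab i 2) n := by
  obtain ⟨b, hb, hf⟩ := h
  have key : ∀ x, Agrees (decodeLabel x) (b i) → Satisfiable v (Function.update lab i x) n := by
    refine fun x hx => ⟨b, fun j hj => ?_, hf⟩
    rcases eq_or_ne j i with rfl | hji
    · simpa using hx
    · simpa [hji] using hb j hj
  rcases hbi : b i with _ | _
  · exact .inl (key 1 (by simp [hbi, decodeLabel, Agrees]))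
  · exact .inr (key 2 (by simp [hbi, decodeLabel, Agrees]))

end RealRAM

/-- The label of an assigned crease in a chain. -/
def CreaseOrientation.isValley : CreaseOrientation → Bool
  | mountain => false
  | valley => true

def CreaseOrientation.ofBool : Bool → CreaseOrientation
  | false => mountain
  | true => valley

@[simp] theorem CreaseOrientation.isValley_ofBool (b : Bool) : (ofBool b).isValley = b := by
  cases b <;> rfl

theorem CreaseOrientation.isValley_injective : Function.Injective isValley := by
  rintro (_ | _) (_ | _) h <;> simp_all [isValley]

theorem agrees_decodeLabel_labelCode {o : Option CreaseOrientation} {b : Bool} :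
    Agrees (RealRAM.decodeLabel (labelCode o)) b ↔
      ∀ x, o = some x → CreaseOrientation.ofBool b = x := by
  rcases o with _ | _ | _ <;> cases b <;>
    simp [Agrees, RealRAM.decodeLabel, labelCode, CreaseOrientation.ofBool]

namespace CreasePattern

variable {n : ℕ} (P : CreasePattern n)

/-- The vertices as a sequence. -/
noncomputable def vertexSeq (i : ℕ) : ℝ := if hi : i < n + 2 then P.vertex ⟨i, hi⟩ else 0

theorem vertexSeq_lt {i : ℕ} (hi : i ≤ n) : P.vertexSeq i < P.vertexSeq (i + 1) := by
  rw [vertexSeq, vertexSeq, dif_pos (by omega), dif_pos (by omega)]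
  exact P.strictMono (by simp)

theorem foldedVertex_eq (k : Fin (n + 2)) :
    P.foldedVertex k = P.vertex 0 + foldedDist P.vertexSeq k := by
  unfold foldedVertex foldedDist
  have : ∀ j : Fin (n + 1),
      (if j.val < k.val then (-1) ^ j.val * (P.vertex j.succ - P.vertex j.castSucc) else 0) =
        if j.val < k.val then
          (-1) ^ j.val * (P.vertexSeq (j.val + 1) - P.vertexSeq j.val) else 0 := by
    intro j
    rw [vertexSeq, vertexSeq, dif_pos (by omega), dif_pos (by omega)]
    rfl
  rw [Finset.sum_congr rfl fun j _ => this j, Fin.sum_univ_eq_sum_range (fun j =>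
    if j < k.val then (-1) ^ j * (P.vertexSeq (j + 1) - P.vertexSeq j) else 0) (n + 1),
    ← Finset.sum_filter]
  congr 2
  ext j
  simp only [Finset.mem_filter, Finset.mem_range]
  omega

theorem mem_segmentImage_iff (i : Fin n) (j : Fin (n + 1)) :
    P.foldedCrease i ∈ P.segmentImage j ↔
      Between (foldedDist P.vertexSeq j) (foldedDist P.vertexSeq (j + 1))
        (foldedDist P.vertexSeq (i + 1)) := by
  unfold segmentImage foldedCrease Between
  simp only [foldedVertex_eq, Set.mem_Ioo, min_lt_iff, lt_max_iff, Fin.val_succ, Fin.val_castSucc,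
    add_lt_add_iff_left]
  constructor
  · rintro ⟨h | h, h' | h'⟩
    · exact absurd (h.trans h') (lt_irrefl _)
    · exact .inl ⟨h, h'⟩
    · exact .inr ⟨h, h'⟩
    · exact absurd (h.trans h') (lt_irrefl _)
  · rintro (⟨h, h'⟩ | ⟨h, h'⟩)
    · exact ⟨.inl h, .inr h'⟩
    · exact ⟨.inr h, .inl h'⟩

/-- The valley and mountain clauses combine into one: the next layer is higher exactly when being a
valley and having an even index agree. -/
theorem isFlatFoldedState_iff {A : Fin n → CreaseOrientation} {b : ℕ → Bool}
    (hb : ∀ i : Fin n, b i = (A i).isValley) {h : Fin (n + 1) → ℝ} {h' : ℕ → ℝ}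
    (hh : ∀ i : Fin (n + 1), h i = h' i) :
    P.IsFlatFoldedState A h ↔ LayerOrder n (foldedDist P.vertexSeq) h' ∧
      ∀ i < n, (h' i < h' (i + 1) ↔ (b i = true ↔ i % 2 = 0)) := by
  have hbetween : ∀ (i : Fin n) (j : Fin (n + 1)),
      LayerBetween h i j ↔ Between (h' i) (h' (i + 1)) (h' j) := by
    intro i j
    simp only [LayerBetween, Between, hh, Fin.val_castSucc, Fin.val_succ]
  have hcrease : ∀ i i' : Fin n, P.foldedCrease i = P.foldedCrease i' ↔
      foldedDist P.vertexSeq (i + 1) = foldedDist P.vertexSeq (i' + 1) := by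
    intro i i'
    simp only [foldedCrease, foldedVertex_eq, Fin.val_succ, Fin.val_castSucc, add_right_inj]
  have hparity : ∀ i i' : ℕ, (Even i ↔ Even i') ↔ i % 2 = i' % 2 := by
    intro i i'
    rw [Nat.even_iff, Nat.even_iff]
    omega
  have hlt : ∀ i : Fin n, h i.castSucc < h i.succ ↔ h' i < h' (i + 1) := by
    intro i
    simp only [hh, Fin.val_castSucc, Fin.val_succ]
  constructor
  · refine fun H => ⟨⟨?_, ?_, ?_⟩, ?_⟩
    · intro j hj j' hj' e
      have := @H.injective ⟨j, by omega⟩ ⟨j', by omega⟩ (by rw [hh, hh, e])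
      exact congrArg Fin.val this
    · intro k hk j hj hz
      have := H.crease_segment ⟨k, hk⟩ ⟨j, by omega⟩ ((P.mem_segmentImage_iff _ _).2 hz)
      rwa [hbetween] at this
    · intro k hk k' hk' hne he hp
      have := H.crease_crease ⟨k, hk⟩ ⟨k', hk'⟩ (by simpa using hne) ((hcrease _ _).2 he)
        ((hparity _ _).2 hp)
      rwa [hbetween, hbetween] at this
    · intro i hi
      have hA := hb ⟨i, hi⟩
      have hi' := hlt ⟨i, hi⟩
      simp only at hA hi'
      rw [← hi', hA]
      rcases hAi : A ⟨i, hi⟩ with _ | _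
      · simpa [CreaseOrientation.isValley, Nat.odd_iff] using H.mountain _ hAi
      · simpa [CreaseOrientation.isValley, Nat.even_iff] using H.valley _ hAi
  · rintro ⟨H, hb'⟩
    refine ⟨?_, ?_, ?_, ?_, ?_⟩
    · intro j j' e
      rw [hh, hh] at e
      exact Fin.ext (H.inj _ (by omega) _ (by omega) e)
    · intro i hi
      rw [hlt, hb' i i.2, hb, hi, Nat.even_iff]
      simp [CreaseOrientation.isValley]
    · intro i hi
      rw [hlt, hb' i i.2, hb, hi, Nat.odd_iff]
      simp [CreaseOrientation.isValley]
    · intro i j hz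
      rw [hbetween]
      exact H.crease_segment i i.2 j (by omega) ((P.mem_segmentImage_iff i j).1 hz)
    · intro i i' hne he hp
      rw [hbetween, hbetween]
      exact H.crease_crease i i.2 i' i'.2 (fun e => hne (Fin.ext e)) ((hcrease _ _).1 he)
        ((hparity _ _).1 hp)

theorem flatFoldable_iff {A : Fin n → CreaseOrientation} {b : ℕ → Bool}
    (hb : ∀ i : Fin n, b i = (A i).isValley) :
    P.FlatFoldable A ↔ FoldsWith P.vertexSeq n b := by
  constructor
  · rintro ⟨h, H⟩
    refine ⟨fun i => if hi : i < n + 1 then h ⟨i, hi⟩ else 0,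
      (P.isFlatFoldedState_iff hb fun i => ?_).1 H⟩
    rw [dif_pos i.2]
  · rintro ⟨h, H⟩
    exact ⟨fun i => h i, (P.isFlatFoldedState_iff hb fun _ => rfl).2 H⟩

end CreasePattern

/-- The codes of the labels as a sequence. -/
noncomputable def MixedCreasePattern.labelSeq {n : ℕ} (P : MixedCreasePattern n) (i : ℕ) : ℕ :=
  if hi : i < n then labelCode (P.label ⟨i, hi⟩) else 0

theorem MixedCreasePattern.satisfiable_iff {n : ℕ} (P : MixedCreasePattern n) :
    RealRAM.Satisfiable P.vertexSeq P.labelSeq n ↔ ∃ A, P.IsValid A := by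
  constructor
  · rintro ⟨b, hb, hf⟩
    refine ⟨fun i => .ofBool (b i), fun i o hi => ?_, (P.flatFoldable_iff (by simp)).2 hf⟩
    have := hb i i.2
    rw [labelSeq, dif_pos i.2, agrees_decodeLabel_labelCode] at this
    exact this o hi
  · rintro ⟨A, hA, hf⟩
    let b : ℕ → Bool := fun i => if hi : i < n then (A ⟨i, hi⟩).isValley else false
    have hb : ∀ i : Fin n, b i = (A i).isValley := by simp [b]
    refine ⟨b, fun i hi => ?_, (P.flatFoldable_iff hb).1 hf⟩
    rw [labelSeq, dif_pos hi, agrees_decodeLabel_labelCode]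
    intro x hx
    rw [← hA _ _ hx]
    apply CreaseOrientation.isValley_injective
    simp [b, hi]

/-- If every label is assigned and agrees with the given labels, then the assignment is valid. -/
theorem MixedCreasePattern.isValid_of_satisfiable {n : ℕ} (P : MixedCreasePattern n)
    {lab : ℕ → ℕ} (h : RealRAM.Satisfiable P.vertexSeq lab n)
    (hlab : ∀ i < n, lab i = 1 ∨ lab i = 2)
    (hagree : ∀ i < n, P.labelSeq i ≠ 0 → lab i = P.labelSeq i) :
    ∃ A, P.IsValid A ∧ ∀ i : Fin n, lab i = labelCode (some (A i)) := by
  obtain ⟨b, hb, hf⟩ := h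
  have hcode : ∀ i : Fin n, lab i = labelCode (some (.ofBool (b i))) := by
    intro i
    have := hb i i.2
    rcases hlab i i.2 with h | h <;> rw [h] at this ⊢ <;>
      simp_all [RealRAM.decodeLabel, Agrees, labelCode, CreaseOrientation.ofBool]
  refine ⟨fun i => .ofBool (b i), ⟨fun i o hi => ?_, (P.flatFoldable_iff (by simp)).2 hf⟩, hcode⟩
  have h1 := hagree i i.2
  rw [labelSeq, dif_pos i.2, hi, hcode] at h1
  rcases o with _ | _ <;> cases hbi : b i <;>
    simp_all [labelCode, CreaseOrientation.ofBool]

/-! ### The program for mixed crease patterns -/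

namespace RealRAM

/-- Prepares the configuration in which only the first segment has been read. -/
def initProgram : Program :=
  .seq (.setReal 1 (.const 0) (.minus (.get 0 (.const 1)) (.get 0 (.const 0)))) <|
  .seq (nset 20 (.const 1)) <|
  .seq (nset 21 (.const 0)) <|
  .seq (nset 22 (.const 0)) <|
  .seq (nset 23 (.const 1)) <|
  .seq (nset 10 (.const 0)) <|
  .seq (nset 11 (.const 1)) <|
  .seq (nset 12 (.const 0)) (nset 16 (.const 1))

/-- Decides whether the labels in array `3` can be completed. -/
def decideProgram : Program :=
  .seq initProgram (.loop (.natLt (.const 0) (nvar 16)) stepProgram)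

/-- Copies the labels from array `1` to array `3`. -/
def copyProgram : Program :=
  .loop (.natLt (nvar 19) (nvar 0)) <|
    .seq (.setNat 3 (nvar 19) (.get 1 (nvar 19))) (nset 19 (.plus (nvar 19) (.const 1)))

/-- Makes a crease without label a mountain or a valley. -/
def assignProgram : Program :=
  .seq (.ite (.natLt (.get 3 (nvar 19)) (.const 1))
    (.seq (.setNat 3 (nvar 19) (.const 1)) <|
      .seq decideProgram <|
      .ite (.natLt (nvar 17) (.const 1)) (.setNat 3 (nvar 19) (.const 2)) .skip)
    .skip) <|
  nset 19 (.plus (nvar 19) (.const 1))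

/-- Finds a valid assignment of a mixed crease pattern. -/
def mixedProgram : Program :=
  .seq copyProgram <|
  .seq decideProgram <|
  .seq (.seq (nset 2 (nvar 17)) (nset 19 (.const 0))) <|
  .loop (.natLt (nvar 19) (nvar 0)) assignProgram

/-! ### Correctness and running time of the whole program. -/

theorem Frame.after_of_writes {v : ℕ → ℝ} {lab : ℕ → ℕ} {n z k : ℕ} {s : State} {p : Program}
    (F : Frame v lab n z k s) (hn : ∀ a ∈ [0, 3, 2, 19], a ∉ p.writesNat)
    (hr : 0 ∉ p.writesReal) : Frame v lab n z k (p.after s) where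
  size := by rw [Program.nat_after (hn 0 (by simp)), F.size]
  vertex := by rw [Program.real_after hr, F.vertex]
  label := by rw [Program.nat_after (hn 3 (by simp)), F.label]
  out := by rw [Program.nat_after (hn 2 (by simp)), F.out]
  counter := by rw [Program.nat_after (hn 19 (by simp)), F.counter]

theorem Frame.setLabel {v : ℕ → ℝ} {lab : ℕ → ℕ} {n z k : ℕ} {s : State}
    (F : Frame v lab n z k s) (x : ℕ) :
    Frame v (Function.update lab k x) n z k (s.writeNat 3 k x) where
  size := by simpa using F.size
  vertex := F.vertex
  label := by
    funext j
    simp [Function.update_apply, F.label]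
  out := by simpa using F.out
  counter := by simpa using F.counter

theorem Frame.incrCounter {v : ℕ → ℝ} {lab : ℕ → ℕ} {n z k : ℕ} {s : State}
    (F : Frame v lab n z k s) : Frame v lab n z (k + 1) (s.writeNat 19 0 (k + 1)) where
  size := by simpa using F.size
  vertex := F.vertex
  label := by
    funext j
    simp [F.label]
  out := by simpa using F.out
  counter := by simp

theorem reaches_initProgram {v : ℕ → ℝ} {lab : ℕ → ℕ} {n z k : ℕ} {s : State}
    (F : Frame v lab n z k s) :
    Reaches initProgram s 50 fun s' => Frame v lab n z k s' ∧ s'.nat 16 0 = 1 ∧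
      ∃ q r, Enc v lab n s' ⟨[(v 1 - v 0, [none])], [], q, r, restChain v lab n 0⟩ := by
  refine Program.LoopFree.reaches_of_after (by simp [initProgram, nset, Program.LoopFree])
    (by decide) ⟨F.after_of_writes (by decide) (by decide), ?_, s.real 2 0, s.real 3 0, ?_⟩
  · simp [initProgram, nset, Program.after, NatExpr.eval]
  · simp only [initProgram, nset, Program.after, NatExpr.eval, RealExpr.eval]
    refine ⟨?_, ?_, ?_, ?_, ?_, ?_, ?_⟩ <;> simp [EncStack, F.vertex]

theorem reaches_decideProgram {v : ℕ → ℝ} {lab : ℕ → ℕ} {n z k : ℕ} {s : State}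
    (hv : ∀ i ≤ n, v i < v (i + 1)) (F : Frame v lab n z k s) :
    Reaches decideProgram s (2100 * (n + 1)) fun s' => Frame v lab n z k s' ∧
      (s'.nat 17 0 = 1 ∧ Satisfiable v lab n ∨ s'.nat 17 0 = 0 ∧ ¬ Satisfiable v lab n) := by
  let I : ℕ → State → Prop := fun j s => Frame v lab n z k s ∧
    ((s.nat 16 0 = 1 ∧ ∃ c, Enc v lab n s c ∧ c.Ok ∧
      (MixedFoldable c.chain ↔ Satisfiable v lab n) ∧ c.potential < j) ∨
    (s.nat 16 0 = 0 ∧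
      (s.nat 17 0 = 1 ∧ Satisfiable v lab n ∨ s.nat 17 0 = 0 ∧ ¬ Satisfiable v lab n)))
  have hstep : ∀ j s, I j s → (Test.natLt (.const 0) (nvar 16)).Holds s →
      Reaches stepProgram s 500 (fun s' => ∃ j' < j, I j' s') := by
    rintro j s ⟨F, ⟨hrun, c, E, hok, hiff, hj⟩ | ⟨h0, -⟩⟩ hb
    · refine stepProgram_loopFree.reaches_of_after stepProgram_maxCost ?_
      have hstack : c.stack ≠ [] := by
        intro h0
        have := hok.stack
        rw [h0] at this
        exact this
      have E' := after_stepProgram hrun F E hstack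
      have F' := F.after_stepProgram
      obtain ⟨hl, hr⟩ := Config.step_spec hok
      rcases hc : c.step with c' | b
      · rw [hc] at E'
        obtain ⟨hok', hiff', hlt⟩ := hl c' hc
        exact ⟨j - 1, by omega, F', .inl ⟨E'.1, c', E'.2, hok', hiff'.symm.trans hiff, by omega⟩⟩
      · rw [hc] at E'
        have hb := (hr b hc).trans hiff
        refine ⟨j - 1, by omega, F', .inr ⟨E'.1, ?_⟩⟩
        rw [E'.2]
        cases b
        · exact .inr ⟨rfl, fun h => Bool.false_ne_true (hb.2 h)⟩
        · exact .inl ⟨rfl, hb.1 rfl⟩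
    · simp [Test.Holds, NatExpr.eval, nvar, h0] at hb
  -- The initial potential is `4 * n + 2`, below the starting bound `4 * n + 3`. A round costs `4`
  -- for the test, `1` for branching and at most `500` for the body; together with the `50` steps of
  -- preparation this stays under `2100 * (n + 1)`.
  refine ((reaches_initProgram F).seq (T₂ := (4 * n + 3 + 1) * (4 + 1 + 500))
    (R := fun s' => ¬ (Test.natLt (.const 0) (nvar 16)).Holds s' ∧ ∃ j, I j s') ?_).mono
    (by omega) ?_
  · rintro s ⟨F, hrun, q, r, E⟩
    refine Reaches.loop hstep ⟨F, .inl ⟨hrun, _, E, ⟨⟨?_, rfl⟩, ?_, ?_, ?_⟩, ?_, ?_⟩⟩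
    · simpa using hv 0 (by omega)
    · exact posLengths_restChain hv lab 0
    · exact fun h => (h rfl).elim
    · exact fun h => by simp at h
    · rw [← mixedFoldable_fullChain_iff]
      rfl
    · simp [Config.potential, restChain]
  · rintro s ⟨hb, j, F, ⟨hrun, -⟩ | ⟨-, h⟩⟩
    · simp [Test.Holds, NatExpr.eval, nvar, hrun] at hb
    · exact ⟨F, h⟩

/-- The labels `lab` refine the labels `lab₀`, and the creases before `k` are assigned. -/
structure Refines (v : ℕ → ℝ) (lab₀ lab : ℕ → ℕ) (n k : ℕ) : Prop where
  assigned : ∀ i < k, lab i = 1 ∨ lab i = 2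
  agree : ∀ i < n, lab₀ i ≠ 0 → lab i = lab₀ i
  unchanged : ∀ i, k ≤ i → lab i = lab₀ i
  -- Conditional, because the assignment loop also runs when there is no valid assignment; its
  -- result is then ignored.
  satisfiable : Satisfiable v lab₀ n → Satisfiable v lab n

theorem Refines.update {v : ℕ → ℝ} {lab₀ lab : ℕ → ℕ} {n k x : ℕ} (h : Refines v lab₀ lab n k)
    (h0 : lab k = 0) (hx : x = 1 ∨ x = 2)
    (hsat : Satisfiable v lab n → Satisfiable v (Function.update lab k x) n) :
    Refines v lab₀ (Function.update lab k x) n (k + 1) where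
  assigned i hi := by
    rcases eq_or_ne i k with rfl | hik
    · simpa using hx
    · simpa [hik] using h.assigned i (by omega)
  agree i hi h1 := by
    rcases eq_or_ne i k with rfl | hik
    · exact absurd ((h.unchanged i le_rfl).symm.trans h0) h1
    · simpa [hik] using h.agree i hi h1
  unchanged i hi := by
    have hik : i ≠ k := by omega
    simpa [hik] using h.unchanged i (by omega)
  satisfiable := hsat ∘ h.satisfiable

theorem Refines.succ {v : ℕ → ℝ} {lab₀ lab : ℕ → ℕ} {n k : ℕ} (h : Refines v lab₀ lab n k)
    (hk : lab k = 1 ∨ lab k = 2) : Refines v lab₀ lab n (k + 1) where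
  assigned i hi := by
    rcases eq_or_ne i k with rfl | hik
    · exact hk
    · exact h.assigned i (by omega)
  agree := h.agree
  unchanged i hi := h.unchanged i (by omega)
  satisfiable := h.satisfiable

theorem reaches_assignProgram {v : ℕ → ℝ} {lab₀ lab : ℕ → ℕ} {n z k : ℕ} {s : State}
    (hv : ∀ i ≤ n, v i < v (i + 1)) (hlab₀ : ∀ i, lab₀ i ≤ 2) (F : Frame v lab n z k s)
    (h : Refines v lab₀ lab n k) (hk : k < n) :
    Reaches assignProgram s (2100 * (n + 1) + 50) fun s' =>
      ∃ lab', Frame v lab' n z (k + 1) s' ∧ Refines v lab₀ lab' n (k + 1) := by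
  refine (Reaches.seq (T₁ := 6 + (2100 * (n + 1) + 20)) (T₂ := 10)
    (Q := fun s' => ∃ lab', Frame v lab' n z k s' ∧ Refines v lab₀ lab' n (k + 1)) ?_ ?_).mono
    (by omega) fun _ => id
  · have ht : (Test.natLt (.get 3 (nvar 19)) (.const 1)).Holds s ↔ lab k = 0 := by
      simp [Test.Holds, NatExpr.eval, nvar, F.label, F.counter]
    refine Reaches.ite (fun hb => ?_) fun hb => ?_
    · have h0 := ht.1 hb
      refine (Reaches.seq (T₁ := 5) (T₂ := 2100 * (n + 1) + 15)
        (Q := fun s' => Frame v (Function.update lab k 1) n z k s') ?_ fun s F => ?_).mono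
        (by omega) fun _ => id
      · refine Program.LoopFree.reaches_of_after (by exact trivial) (by decide) ?_
        simpa [Program.after, NatExpr.eval, nvar, F.counter] using F.setLabel 1
      · refine (reaches_decideProgram hv F).seq fun s ⟨F, hs⟩ => ?_
        refine Program.LoopFree.reaches_of_after (by exact ⟨trivial, trivial⟩) (by decide) ?_
        simp only [Program.after, Test.Holds, NatExpr.eval, nvar, F.counter]
        rcases hs with ⟨h17, hs⟩ | ⟨h17, hs⟩
        · rw [h17, if_neg (by simp)]
          exact ⟨_, F, h.update h0 (.inl rfl) fun _ => hs⟩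
        · rw [h17, if_pos (by simp)]
          have F' := F.setLabel 2
          rw [Function.update_idem] at F'
          -- If the labels can be completed at all and a mountain here fails, a valley must succeed.
          exact ⟨_, F', h.update h0 (.inr rfl) fun h => (h.assign hk).resolve_left hs⟩
    · refine Program.LoopFree.reaches_of_after (by exact trivial) (by simp [Program.maxCost]) ?_
      refine ⟨lab, F, h.succ ?_⟩
      have h0 : lab k ≠ 0 := fun e => hb (ht.2 e)
      have := h.unchanged k le_rfl
      have := hlab₀ k
      omega
  · rintro s ⟨lab', F, h⟩
    refine Program.LoopFree.reaches_of_after (by exact trivial) (by decide) ⟨lab', ?_, h⟩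
    simpa [nset, Program.after, NatExpr.eval, nvar, F.counter] using F.incrCounter

/-- Afterwards array `3` holds a refinement of `lab₀` in which every crease is assigned. -/
theorem reaches_assignLoop {v : ℕ → ℝ} {lab₀ : ℕ → ℕ} {n z : ℕ} {s : State}
    (hv : ∀ i ≤ n, v i < v (i + 1)) (hlab₀ : ∀ i, lab₀ i ≤ 2) (F : Frame v lab₀ n z 0 s) :
    Reaches (.loop (.natLt (nvar 19) (nvar 0)) assignProgram) s
      ((n + 1) * (2100 * (n + 1) + 56)) fun s' =>
      ∃ lab, Frame v lab n z n s' ∧ Refines v lab₀ lab n n := by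
  let I : ℕ → State → Prop := fun j s =>
    ∃ lab k, Frame v lab n z k s ∧ Refines v lab₀ lab n k ∧ k + j = n
  have ht : ∀ {lab k s}, Frame v lab n z k s →
      ((Test.natLt (nvar 19) (nvar 0)).Holds s ↔ k < n) := by
    intro lab k s F
    simp [Test.Holds, NatExpr.eval, nvar, F.counter, F.size]
  have hI : I n s := ⟨lab₀, 0, F, ⟨by simp, fun _ _ _ => rfl, fun _ _ => rfl, id⟩, by omega⟩
  refine (Reaches.loop (T := 2100 * (n + 1) + 50) ?_ hI).mono ?_ ?_
  · rintro j s ⟨lab, k, F, h, hj⟩ hb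
    have hk := (ht F).1 hb
    refine (reaches_assignProgram hv hlab₀ F h hk).mono le_rfl fun s ⟨lab', F', h'⟩ => ?_
    exact ⟨j - 1, by omega, lab', k + 1, F', h', by omega⟩
  · refine Nat.mul_le_mul_left _ ?_
    simp only [Test.cost, NatExpr.cost, nvar]
    omega
  · rintro s ⟨hb, j, lab, k, F, h, hj⟩
    have := mt (ht F).2 hb
    obtain rfl : k = n := by omega
    exact ⟨lab, F, h⟩

theorem reaches_copyProgram {v : ℕ → ℝ} {lab : ℕ → ℕ} {n : ℕ} {s : State}
    (F : Frame v 0 n 0 0 s) (hs : s.nat 1 = lab) (hlab : ∀ i, n ≤ i → lab i = 0) :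
    Reaches copyProgram s ((n + 1) * 50) fun s' => Frame v lab n 0 n s' := by
  let I : ℕ → State → Prop := fun j s => ∃ k, k + j = n ∧ s.nat 1 = lab ∧
    Frame v (fun i => if i < k then lab i else 0) n 0 k s
  have ht : ∀ {lab k s}, Frame v lab n 0 k s →
      ((Test.natLt (nvar 19) (nvar 0)).Holds s ↔ k < n) := by
    intro lab k s F
    simp [Test.Holds, NatExpr.eval, nvar, F.counter, F.size]
  have hI : I n s := ⟨0, by omega, hs, by simpa using! F⟩
  refine (Reaches.loop (T := 20) ?_ hI).mono ?_ ?_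
  · rintro j s ⟨k, hj, hs, F⟩ hb
    have hk := (ht F).1 hb
    refine Program.LoopFree.reaches_of_after (by exact ⟨trivial, trivial⟩) (by decide)
      ⟨j - 1, by omega, k + 1, by omega, ?_, ?_⟩
    · rw [Program.nat_after (by decide), hs]
    · have F' := (F.setLabel (lab k)).incrCounter
      have e : Function.update (fun i => if i < k then lab i else 0) k (lab k) =
          fun i => if i < k + 1 then lab i else 0 := by
        funext i
        rcases Nat.lt_trichotomy i k with h | rfl | h
        · simp [h, h.ne, Nat.lt_succ_of_lt h]
        · simp
        · simp [h.ne', show ¬ i < k by omega, show ¬ i < k + 1 by omega]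
      rw [e] at F'
      simpa [nset, Program.after, NatExpr.eval, nvar, F.counter, hs] using F'
  · exact Nat.mul_le_mul_left _ (by simp [Test.cost, NatExpr.cost, nvar])
  · rintro s ⟨hb, j, k, hj, hs, F⟩
    have := mt (ht F).2 hb
    obtain rfl : k = n := by omega
    convert F using 1
    funext i
    split_ifs with h
    · rfl
    · exact hlab i (by omega)

theorem reaches_mixedProgram {v : ℕ → ℝ} {lab : ℕ → ℕ} {n : ℕ} {s : State}
    (hv : ∀ i ≤ n, v i < v (i + 1)) (hlab : ∀ i, lab i ≤ 2) (hlab' : ∀ i, n ≤ i → lab i = 0)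
    (F : Frame v 0 n 0 0 s) (hs : s.nat 1 = lab) :
    Reaches mixedProgram s (5000 * (n + 1) ^ 3) fun s' =>
      (s'.nat 2 0 = 1 ∧ ∃ lab', s'.nat 3 = lab' ∧ Satisfiable v lab' n ∧
        (∀ i < n, lab' i = 1 ∨ lab' i = 2) ∧ ∀ i < n, lab i ≠ 0 → lab' i = lab i) ∨
      (s'.nat 2 0 = 0 ∧ ¬ Satisfiable v lab n) := by
  -- The program makes at most `n + 1` calls of the linear decision procedure, so the true bound is
  -- quadratic and the cube is slack.
  have hT : (n + 1) * 50 + (2100 * (n + 1) + (20 + (n + 1) * (2100 * (n + 1) + 56))) ≤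
      5000 * (n + 1) ^ 3 := by
    have h1 : 1 ≤ n + 1 := by omega
    generalize n + 1 = m at *
    have h2 : m ≤ m ^ 2 := by nlinarith
    have h3 : m ^ 2 ≤ m ^ 3 := Nat.pow_le_pow_right h1 (by omega)
    nlinarith
  refine ((reaches_copyProgram F hs hlab').seq fun s F => (reaches_decideProgram hv F).seq
    fun s hs => Reaches.seq (Q := fun s' => ∃ z, Frame v lab n z 0 s' ∧
      (z = 1 ∧ Satisfiable v lab n ∨ z = 0 ∧ ¬ Satisfiable v lab n)) ?_
    (R := fun s' => ∃ z lab', Frame v lab' n z n s' ∧ Refines v lab lab' n n ∧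
      (z = 1 ∧ Satisfiable v lab n ∨ z = 0 ∧ ¬ Satisfiable v lab n)) ?_).mono hT ?_
  · obtain ⟨F, hs⟩ := hs
    refine Program.LoopFree.reaches_of_after (by exact ⟨trivial, trivial⟩) (by decide)
      ⟨s.nat 17 0, ?_, hs⟩
    refine ⟨?_, ?_, funext fun i => ?_, ?_, ?_⟩ <;>
      simp [nset, nvar, Program.after, NatExpr.eval, F.size, F.vertex, F.label]
  · rintro s ⟨z, F, hz⟩
    exact (reaches_assignLoop hv hlab F).mono le_rfl
      fun s ⟨lab', F', h⟩ => ⟨z, lab', F', h, hz⟩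
  · rintro s ⟨z, lab', F, h, ⟨rfl, hz⟩ | ⟨rfl, hz⟩⟩
    · exact .inl ⟨F.out, lab', F.label, h.satisfiable hz, h.assigned, h.agree⟩
    · exact .inr ⟨F.out, hz⟩

end RealRAM

theorem labelCode_le (o : Option CreaseOrientation) : labelCode o ≤ 2 := by
  rcases o with _ | _ | _ <;> simp [labelCode]

theorem mainTheorem2 :
    ∃ (p : RealRAM.Program) (C : ℕ), ∀ (n : ℕ) (P : MixedCreasePattern n),
      ∃ (t : ℕ) (s : RealRAM.State) (answer : Option (Fin n → CreaseOrientation)),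
        RealRAM.Runs p P.inputState t s ∧ t ≤ C * (n + 1) ^ 3 ∧
        s.Outputs answer ∧
        (∀ A : Fin n → CreaseOrientation, answer = some A → P.IsValid A) ∧
        (answer = none → ¬ ∃ A : Fin n → CreaseOrientation, P.IsValid A) := by
  refine ⟨RealRAM.mixedProgram, 5000, fun n P => ?_⟩
  have hlab : ∀ i, P.labelSeq i ≤ 2 := by
    intro i
    unfold MixedCreasePattern.labelSeq
    split_ifs
    · exact labelCode_le _
    · omega
  have hlab' : ∀ i, n ≤ i → P.labelSeq i = 0 := fun i hi => dif_neg (by omega)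
  have F : RealRAM.Frame P.vertexSeq 0 n 0 0 P.inputState := by
    constructor
    · simp [MixedCreasePattern.inputState]
    · rfl
    · rfl
    · rfl
    · rfl
  obtain ⟨t, ht, s, hr, ⟨h2, lab, h3, hsat, h12, hagree⟩ | ⟨h2, hsat⟩⟩ :=
    RealRAM.reaches_mixedProgram (fun _ hi => P.vertexSeq_lt hi) hlab hlab' F
      (v := P.vertexSeq) (lab := P.labelSeq) rfl
  · obtain ⟨A, hA, hcode⟩ := P.isValid_of_satisfiable hsat h12 hagree
    refine ⟨t, s, some A, hr, ht, ⟨h2, fun i => by rw [h3, hcode i]⟩, ?_, by simp⟩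
    rintro _ ⟨⟩
    exact hA
  · exact ⟨t, s, none, hr, ht, h2, by simp, fun _ h => hsat (P.satisfiable_iff.2 h)⟩
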